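/- **Setting.** Fix integers $M\ge 2$, $\ell\ge 1$ and $\alpha\in(0,1)$. Let $C^{k+\alpha}(\mathbb T)$ be the space of real-valued Hölder functions on the unit circle $\mathbb T$ and $\mathring C^{k+\alpha}(\mathbb T)$ its subspace of functions with mean $0$. For a density $\mu=\sum_m\widehat\mu_m\tau^m$ put $\mu'=\sum_m m\widehat\mu_m\tau^{m-1}$, i.e. $\mu'(\tau)=(i\tau)^{-1}\partial_\theta\mu(\tau)$ for $\tau=e^{i\theta}$. Let $$\mathscr X=\mathring C^{\ell+\alpha}(\mathbb T)^M\times\mathring C^{\ell+\alpha}(\mathbb T)^M\times\mathbb R^M\times\mathbb P,\qquad \mathscr Y=\mathring C^{\ell-1+\alpha}(\mathbb T)^M\times C^{\ell-1+\alpha}(\mathbb T)^M,$$ where $\mathbb P=\mathbb R^M\times\mathbb C^M\times\mathbb R\times\mathbb R$ consists of the parameters $\Lambda=(\gamma_1,\dots,\gamma_M,\zeta_1,\dots,\zeta_M,c,\Omega)$. Write $u=(\mu,\nu,Q,\Lambda)\in\mathscr X$ and let $\rho\in\mathbb R$. For $m=(m_1,\dots,m_M)$ and $\tau\in\mathbb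 T$ set $$\mathcal Z_k^\rho m(\tau)=\frac1{2\pi i}\int_{\mathbb T}\frac{m_k(\sigma)-m_k(\tau)}{\sigma-\tau}\,d\sigma+\sum_{j\ne k}\frac1{2\pi i}\int_{\mathbb T}\frac{m_j(\sigma)}{\rho(\sigma-\tau)+\zeta_j-\zeta_k}\,\rho\,d\sigma,$$ $$w^0_\zeta(\zeta)=\sum_j\frac{\gamma_j}{2\pi i}\frac1{\zeta-\zeta_j},\qquad \mathcal V_k^\rho(\tau)=\sum_{j\ne k}\frac{\gamma_j}{2\pi i}\frac1{\zeta_k+\rho\tau-\zeta_j}+i\Omega\,\overline{(\zeta_k+\rho\tau)}-c,$$ $$K_k=\mathcal Z_k^\rho\nu'+\mathcal V_k^\rho+\bigl(i\Omega\overline{(\zeta_k+\rho\tau)}-c\bigr)\rho\,\mathcal Z_k^\rho\mu'+i\Omega\rho^2\,\overline{\mathcal Z_k^\rho\mu}+i\Omega\rho^3\,\mathcal Z_k^\rho\mu'\;\overline{\mathcal Z_k^\rho\mu}.$$ The kinematic and Bernoulli residuals are $$\mathscr A_k(u,\rho)=\operatorname{Re}(\tau K_k),\qquad \mathscr B_k(u,\rho)=\mathcal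 B_k^\rho-Q_k,\qquad \frac{\bigl|\frac{\gamma_k}{2\pi i\tau}+\rho K_k\bigr|^2}{|1+\rho\mathcal Z_k^\rho\mu'|^2}=\frac{\gamma_k^2}{4\pi^2}+\rho\,\mathcal B_k^\rho,$$ where the factor $\rho$ in the last relation is cancelled algebraically, so that $\mathcal B_k^\rho$ is also defined at $\rho=0$. Let $\mathcal O\subset\mathscr X\times\mathbb R$ be the set of all $(u,\rho)$ for which there is $\delta>0$ with $|\zeta_j-\zeta_k|>2|\rho|+\delta$ for all $j\ne k$ and $|1+\rho\mathcal Z_k^\rho\mu'|>\delta$ on $\mathbb T$ for all $k$. For $(A,B)\in\mathscr Y$ put $$I_k=\tfrac12B_k\,(1+\rho\mathcal Z_k^\rho\mu')-\frac{\overline{\rho\tau\,(w^0_\zeta(\zeta_k+\rho\tau)+\mathcal Z_k^\rho\nu')}}{\overline{1+\rho\mathcal Z_k^\rho\mu'}}\,A_k ,$$ where $\rho\tau\,w^0_\zeta(\zeta_k+\rho\tau)$ is read as its limit $\gamma_k/(2\pi i)$ when $\rho=0$, and define $$\phi_{\rm t}=\operatorname{Im}\sum_k\int_{\mathbb T}I_k\,d\tau,\qquad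 \phi_{\rm r}=\operatorname{Re}\sum_k\int_{\mathbb T}I_k\,\overline{(\zeta_k+\rho\tau+\rho^2\mathcal Z_k^\rho\mu)}\,d\tau,$$ $$\phi_{\rm s}=\Bigl(\sum_k\int_{\mathbb T}I_k\,d\tau,\ \operatorname{Re}\sum_k\int_{\mathbb T}I_k\,\overline{(\zeta_k+\rho\tau+\rho^2\mathcal Z_k^\rho\mu)}\,d\tau\Bigr)\in\mathbb C\times\mathbb R .$$ **Theorem 5.1 (Hollow vortex identities).** Let $\Lambda_0\in\mathbb P$ have nonzero circulations $\gamma_k$ and pairwise distinct centers $\zeta_k$, and let $(c,\Omega)$ be its last two components. Let $\phi=\phi_{\rm t}$ if $c\ne0$, $\Omega=0$; $\phi=\phi_{\rm r}$ if $c=0$, $\Omega\ne0$; and $\phi=\phi_{\rm s}$ if $c=\Omega=0$. Then there is a neighborhood of the point vortex $(u^0,0)$, $u^0=(0,0,0,\Lambda_0)$, in $\mathscr X\times\mathbb R$ such that for all $(u,\rho)\in\mathcal O$ in this neighborhood with the same value of $(c,\Omega)$: 1. $(\mathscr A(u,\rho),\mathscr B(u,\rho))\in\mathscr Y$ and $\phi(\mathscr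 A(u,\rho),\mathscr B(u,\rho),u,\rho)=0$; 2. $\phi(0,u,\rho)=0$; 3. $(A,B)\mapsto\phi(A,B,u,\rho)$ is differentiable at $0$, and the derivative $D_{(A,B)}\phi(0,u,\rho)$ is surjective (onto $\mathbb R$, $\mathbb R$, $\mathbb C\times\mathbb R$, respectively). -/

import Mathlib

open scoped NNReal

noncomputable section

namespace HollowVortex

/-! ### Hölder spaces on the unit circle -/

/-- A function on the unit circle as a `2π`-periodic function of the angle `θ`, where
`τ = exp (iθ)`. -/
def lift (φ : Circle → ℝ) : ℝ → ℝ := fun θ => φ (Circle.exp θ)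

/-- The real-valued functions on the circle of class `C^{ℓ+α}`: as a function of the angle, `φ` is
`ℓ` times continuously differentiable and its `ℓ`-th derivative is Hölder continuous with
exponent `α`. -/
def holderSubmodule (ℓ : ℕ) (α : ℝ≥0) : Submodule ℝ (Circle → ℝ) where
  carrier := {φ | ContDiff ℝ ℓ (lift φ) ∧ MemHolder α (iteratedDeriv ℓ (lift φ))}
  add_mem' := by
    rintro a b ⟨ha, ha'⟩ ⟨hb, hb'⟩
    refine ⟨ha.add hb, ?_⟩
    have h : iteratedDeriv ℓ (lift (a + b))
        = iteratedDeriv ℓ (lift a) + iteratedDeriv ℓ (lift b) := by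
      funext x
      exact iteratedDeriv_add ha.contDiffAt hb.contDiffAt
    rw [h]
    exact ha'.add hb'
  zero_mem' := by
    have h : lift 0 = fun _ => (0 : ℝ) := rfl
    refine ⟨by rw [h]; exact contDiff_const, ?_⟩
    have h2 : iteratedDeriv ℓ (lift 0) = 0 := by
      rw [h]; funext x; simp
    rw [h2]
    exact memHolder_zero
  smul_mem' := by
    rintro c a ⟨ha, ha'⟩
    refine ⟨ha.const_smul c, ?_⟩
    have h : iteratedDeriv ℓ (lift (c • a)) = c • iteratedDeriv ℓ (lift a) := by
      funext x
      exact iteratedDeriv_const_smul ha.contDiffAt c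
    rw [h]
    exact ha'.smul

/-- The space `C^{ℓ+α}(𝕋)`. It is a separate type so that its topology is the one of the Hölder
norm below, and not the topology of pointwise convergence. -/
def HolderFun (ℓ : ℕ) (α : ℝ≥0) : Type := holderSubmodule ℓ α

variable {ℓ : ℕ} {α : ℝ≥0}

instance : AddCommGroup (HolderFun ℓ α) := inferInstanceAs (AddCommGroup (holderSubmodule ℓ α))

instance : Module ℝ (HolderFun ℓ α) := inferInstanceAs (Module ℝ (holderSubmodule ℓ α))

instance : CoeFun (HolderFun ℓ α) (fun _ => Circle → ℝ) := ⟨fun φ => φ.1⟩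

/-- The supremum over the circle of the `j`-th angular derivative. -/
def derivSup (j : ℕ) (φ : Circle → ℝ) : ℝ := ⨆ θ : ℝ, |iteratedDeriv j (lift φ) θ|

/-- The `C^{ℓ+α}` norm: the suprema of all derivatives up to order `ℓ`, plus the best Hölder
constant of the `ℓ`-th derivative. -/
instance : Norm (HolderFun ℓ α) :=
  ⟨fun φ => (∑ j ∈ Finset.range (ℓ + 1), derivSup j φ) + nnHolderNorm α (iteratedDeriv ℓ (lift φ))⟩

theorem HolderFun.norm_def (φ : HolderFun ℓ α) :
    ‖φ‖ = (∑ j ∈ Finset.range (ℓ + 1), derivSup j φ)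
      + nnHolderNorm α (iteratedDeriv ℓ (lift φ)) := rfl

theorem lift_periodic (φ : Circle → ℝ) : Function.Periodic (lift φ) (2 * Real.pi) := by
  intro θ
  simp [lift]

theorem HolderFun.bddAbove (φ : HolderFun ℓ α) {j : ℕ} (hj : j ≤ ℓ) :
    BddAbove (Set.range fun θ : ℝ => |iteratedDeriv j (lift φ) θ|) := by
  have hc : Continuous (iteratedDeriv j (lift φ)) :=
    φ.2.1.continuous_iteratedDeriv j (by exact_mod_cast hj)
  have hp : Function.Periodic (iteratedDeriv j (lift φ)) (2 * Real.pi) := by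
    intro θ
    have h := iteratedDeriv_comp_add_const j (lift φ) (2 * Real.pi)
    have h2 : (fun z => lift φ (z + 2 * Real.pi)) = lift φ := funext (lift_periodic φ)
    rw [h2] at h
    exact (congrFun h θ).symm
  have hb := hp.isBounded_of_continuous (by positivity) hc
  obtain ⟨C, hC⟩ := hb.exists_norm_le
  refine ⟨C, ?_⟩
  rintro _ ⟨θ, rfl⟩
  exact hC _ ⟨θ, rfl⟩

theorem derivSup_nonneg (j : ℕ) (φ : Circle → ℝ) : 0 ≤ derivSup j φ :=
  Real.iSup_nonneg fun _ => abs_nonneg _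

theorem derivSup_add_le (φ ψ : HolderFun ℓ α) {j : ℕ} (hj : j ≤ ℓ) :
    derivSup j (φ + ψ : HolderFun ℓ α) ≤ derivSup j φ + derivSup j ψ := by
  refine ciSup_le fun θ => ?_
  have h : iteratedDeriv j (lift (φ + ψ : HolderFun ℓ α)) θ
      = iteratedDeriv j (lift φ) θ + iteratedDeriv j (lift ψ) θ :=
    iteratedDeriv_add ((φ.2.1.of_le (by exact_mod_cast hj)).contDiffAt)
      ((ψ.2.1.of_le (by exact_mod_cast hj)).contDiffAt)
  rw [h]
  exact (abs_add_le _ _).trans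
    (add_le_add (le_ciSup (φ.bddAbove hj) θ) (le_ciSup (ψ.bddAbove hj) θ))

theorem derivSup_smul (c : ℝ) (φ : HolderFun ℓ α) {j : ℕ} (hj : j ≤ ℓ) :
    derivSup j (c • φ : HolderFun ℓ α) = |c| * derivSup j φ := by
  have h : ∀ θ, |iteratedDeriv j (lift (c • φ : HolderFun ℓ α)) θ|
      = |c| * |iteratedDeriv j (lift φ) θ| := by
    intro θ
    have h' : iteratedDeriv j (lift (c • φ : HolderFun ℓ α)) θ
        = c • iteratedDeriv j (lift φ) θ :=
      iteratedDeriv_const_smul ((φ.2.1.of_le (by exact_mod_cast hj)).contDiffAt) c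
    rw [h', smul_eq_mul, abs_mul]
  unfold derivSup
  simp_rw [h]
  exact (Real.mul_iSup_of_nonneg (abs_nonneg c) _).symm

theorem HolderFun.core (ℓ : ℕ) (α : ℝ≥0) : NormedSpace.Core ℝ (HolderFun ℓ α) where
  norm_nonneg φ := by
    rw [HolderFun.norm_def]
    exact add_nonneg (Finset.sum_nonneg fun j _ => derivSup_nonneg j φ) (NNReal.coe_nonneg _)
  norm_smul c φ := by
    rw [HolderFun.norm_def, HolderFun.norm_def, mul_add, Finset.mul_sum]
    congr 1
    · refine Finset.sum_congr rfl fun j hj => ?_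
      rw [derivSup_smul c φ (by simpa [Nat.lt_succ_iff] using hj), Real.norm_eq_abs]
    · have h : iteratedDeriv ℓ (lift (c • φ : HolderFun ℓ α)) = c • iteratedDeriv ℓ (lift φ) := by
        funext x
        exact iteratedDeriv_const_smul φ.2.1.contDiffAt c
      rw [h, MemHolder.nnHolderNorm_smul φ.2.2]
      simp [mul_comm]
  norm_triangle φ ψ := by
    rw [HolderFun.norm_def, HolderFun.norm_def, HolderFun.norm_def]
    have h1 : ∑ j ∈ Finset.range (ℓ + 1), derivSup j (φ + ψ : HolderFun ℓ α)
        ≤ ∑ j ∈ Finset.range (ℓ + 1), derivSup j φ + ∑ j ∈ Finset.range (ℓ + 1), derivSup j ψ := by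
      rw [← Finset.sum_add_distrib]
      exact Finset.sum_le_sum fun j hj =>
        derivSup_add_le φ ψ (by simpa [Nat.lt_succ_iff] using hj)
    have h2 : iteratedDeriv ℓ (lift (φ + ψ : HolderFun ℓ α))
        = iteratedDeriv ℓ (lift φ) + iteratedDeriv ℓ (lift ψ) := by
      funext x
      exact iteratedDeriv_add φ.2.1.contDiffAt ψ.2.1.contDiffAt
    have h3 : (nnHolderNorm α (iteratedDeriv ℓ (lift (φ + ψ : HolderFun ℓ α))) : ℝ)
        ≤ nnHolderNorm α (iteratedDeriv ℓ (lift φ))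
          + nnHolderNorm α (iteratedDeriv ℓ (lift ψ)) := by
      rw [h2]
      exact_mod_cast MemHolder.nnHolderNorm_add_le φ.2.2 ψ.2.2
    linarith
  norm_eq_zero_iff φ := by
    constructor
    · intro h
      rw [HolderFun.norm_def] at h
      have hs : 0 ≤ ∑ j ∈ Finset.range (ℓ + 1), derivSup j φ :=
        Finset.sum_nonneg fun j _ => derivSup_nonneg j φ
      have hn := NNReal.coe_nonneg (nnHolderNorm α (iteratedDeriv ℓ (lift φ)))
      have hs0 : ∑ j ∈ Finset.range (ℓ + 1), derivSup j φ = 0 := by linarith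
      have h0 : derivSup 0 φ = 0 :=
        (Finset.sum_eq_zero_iff_of_nonneg fun j _ => derivSup_nonneg j φ).1 hs0 0 (by simp)
      apply Subtype.ext
      funext τ
      have h1 := le_ciSup (φ.bddAbove (Nat.zero_le ℓ)) (Complex.arg (τ : ℂ))
      have h2 : |iteratedDeriv 0 (lift φ) (Complex.arg (τ : ℂ))| ≤ derivSup 0 φ := h1
      rw [h0, iteratedDeriv_zero] at h2
      have h3 := abs_nonpos_iff.1 h2
      have h4 : φ.1 (Circle.exp (Complex.arg (τ : ℂ))) = 0 := h3
      rw [Circle.exp_arg] at h4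
      exact h4
    · rintro rfl
      have h : lift ((0 : HolderFun ℓ α) : Circle → ℝ) = fun _ => (0 : ℝ) := rfl
      have h2 : ∀ j, iteratedDeriv j (lift ((0 : HolderFun ℓ α) : Circle → ℝ)) = 0 := by
        intro j
        rw [h]; funext x; simp
      rw [HolderFun.norm_def]
      simp [derivSup, h2]

instance : NormedAddCommGroup (HolderFun ℓ α) :=
  NormedAddCommGroup.ofCore (HolderFun.core ℓ α)

instance : NormedSpace ℝ (HolderFun ℓ α) :=
  NormedSpace.ofCore (HolderFun.core ℓ α)

theorem HolderFun.continuous_lift (φ : HolderFun ℓ α) : Continuous (lift φ) := φ.2.1.continuous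

/-- The subspace of the functions in `C^{ℓ+α}(𝕋)` with mean `0`. -/
def meanZero (ℓ : ℕ) (α : ℝ≥0) : Submodule ℝ (HolderFun ℓ α) where
  carrier := {φ | ∫ θ in (0 : ℝ)..(2 * Real.pi), lift φ θ = 0}
  add_mem' := by
    intro a b ha hb
    have h := intervalIntegral.integral_add (μ := MeasureTheory.volume)
      (a.continuous_lift.intervalIntegrable 0 (2 * Real.pi))
      (b.continuous_lift.intervalIntegrable 0 (2 * Real.pi))
    have ha' : ∫ θ in (0 : ℝ)..(2 * Real.pi), lift a θ = 0 := ha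
    have hb' : ∫ θ in (0 : ℝ)..(2 * Real.pi), lift b θ = 0 := hb
    rw [ha', hb', add_zero] at h
    exact h
  zero_mem' := by
    change ∫ θ in (0 : ℝ)..(2 * Real.pi), (0 : ℝ) = 0
    simp
  smul_mem' := by
    intro c a ha
    have ha' : ∫ θ in (0 : ℝ)..(2 * Real.pi), lift a θ = 0 := ha
    change ∫ θ in (0 : ℝ)..(2 * Real.pi), c * lift a θ = 0
    rw [intervalIntegral.integral_const_mul, ha', mul_zero]

/-! ### Calculus on the unit circle -/

/-- The contour integral `∫_𝕋 h(τ) dτ` over the unit circle, counterclockwise. -/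
def contourInt (h : Circle → ℂ) : ℂ :=
  ∫ θ in (0 : ℝ)..(2 * Real.pi), h (Circle.exp θ) * (Complex.I * (Circle.exp θ : ℂ))

/-- The derivative `φ'(τ)` with respect to the complex variable `τ ∈ 𝕋`, that is
`(i τ)⁻¹ dφ/dθ`; it sends `τ ^ m` to `m τ ^ (m - 1)`. -/
def tDeriv (φ : Circle → ℝ) (τ : Circle) : ℂ :=
  ((deriv (fun t : ℝ => φ (τ * Circle.exp t)) 0 : ℝ) : ℂ) / (Complex.I * (τ : ℂ))

/-! ### Parameters, unknowns and function spaces -/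

/-- The parameters `Λ = (γ₁, …, γ_M, ζ₁, …, ζ_M, c, Ω)`. -/
abbrev Params (M : ℕ) : Type := (Fin M → ℝ) × (Fin M → ℂ) × ℝ × ℝ

variable {M : ℕ}

/-- The circulation `γ_k`. -/
def Params.circ (Λ : Params M) (k : Fin M) : ℝ := Λ.1 k

/-- The centre `ζ_k`. -/
def Params.ctr (Λ : Params M) (k : Fin M) : ℂ := Λ.2.1 k

/-- The translation speed `c`. -/
def Params.speed (Λ : Params M) : ℝ := Λ.2.2.1

/-- The angular velocity `Ω`. -/
def Params.angVel (Λ : Params M) : ℝ := Λ.2.2.2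

/-- The unknowns `u = (μ, ν, Q, Λ)`. -/
abbrev XSpace (M ℓ : ℕ) (α : ℝ≥0) : Type :=
  (Fin M → meanZero ℓ α) × (Fin M → meanZero ℓ α) × (Fin M → ℝ) × Params M

/-- The density of the conformal map. -/
def XSpace.mu (u : XSpace M ℓ α) (k : Fin M) : Circle → ℝ := (u.1 k : HolderFun ℓ α)

/-- The density of the complex potential. -/
def XSpace.nu (u : XSpace M ℓ α) (k : Fin M) : Circle → ℝ := (u.2.1 k : HolderFun ℓ α)

/-- The Bernoulli constants. -/
def XSpace.bern (u : XSpace M ℓ α) (k : Fin M) : ℝ := u.2.2.1 k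

/-- The parameters `Λ`. -/
def XSpace.par (u : XSpace M ℓ α) : Params M := u.2.2.2

/-- The space of residuals `(A, B)`: kinematic residuals of class `C^{ℓ-1+α}` with mean `0`, and
Bernoulli residuals of class `C^{ℓ-1+α}`. It is used for `ℓ ≥ 1`. -/
abbrev YSpace (M ℓ : ℕ) (α : ℝ≥0) : Type :=
  (Fin M → meanZero (ℓ - 1) α) × (Fin M → HolderFun (ℓ - 1) α)

/-- The kinematic residual on the `k`-th circle. -/
def YSpace.kin (Y : YSpace M ℓ α) (k : Fin M) : Circle → ℝ := (Y.1 k : HolderFun (ℓ - 1) α)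

/-- The Bernoulli residual on the `k`-th circle. -/
def YSpace.dyn (Y : YSpace M ℓ α) (k : Fin M) : Circle → ℝ := Y.2 k

/-- The state `u⁰ = (0, 0, 0, Λ)` of the point vortex configuration `Λ`. -/
def pointVortex (ℓ : ℕ) (α : ℝ≥0) (Λ : Params M) : XSpace M ℓ α := (0, 0, 0, Λ)

/-! ### The layer potential and the hollow vortex operator -/

/-- The trace `𝒵_k^ρ[m](τ)` on `∂B_ρ(ζ_k)`, at `ζ_k + ρ τ` and from the fluid side, of the layer
potential `∑_j (2πi)⁻¹ ∫_𝕋 m_j(σ) / (ρ σ + ζ_j - ζ) ρ dσ`; it makes sense for every small real `ρ`,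
including `ρ = 0`. -/
def traceZ (ρ : ℝ) (Λ : Params M) (m : Fin M → Circle → ℂ) (k : Fin M) (τ : Circle) : ℂ :=
  (2 * Real.pi * Complex.I)⁻¹ * contourInt (fun σ => (m k σ - m k τ) / ((σ : ℂ) - τ))
  + ∑ j ∈ Finset.univ.erase k, (2 * Real.pi * Complex.I)⁻¹ *
      contourInt (fun σ => m j σ / (ρ * ((σ : ℂ) - τ) + Λ.ctr j - Λ.ctr k) * ρ)

/-- `𝒵_k^ρ μ`. The conformal map `f = id + ρ² 𝒵^ρ μ` has trace `ζ_k + ρ τ + ρ² 𝒵_k^ρ μ`. -/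
def zMu (u : XSpace M ℓ α) (ρ : ℝ) (k : Fin M) (τ : Circle) : ℂ :=
  traceZ ρ u.par (fun j σ => (u.mu j σ : ℂ)) k τ

/-- `𝒵_k^ρ μ'`. The derivative `f_ζ` has trace `1 + ρ 𝒵_k^ρ μ'`. -/
def zMu' (u : XSpace M ℓ α) (ρ : ℝ) (k : Fin M) (τ : Circle) : ℂ :=
  traceZ ρ u.par (fun j => tDeriv (u.mu j)) k τ

/-- `𝒵_k^ρ ν'`. The derivative of the potential `w = w⁰ + ρ 𝒵^ρ ν` has trace
`w⁰_ζ + 𝒵_k^ρ ν'`. -/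
def zNu' (u : XSpace M ℓ α) (ρ : ℝ) (k : Fin M) (τ : Circle) : ℂ :=
  traceZ ρ u.par (fun j => tDeriv (u.nu j)) k τ

/-- The derivative `w⁰_ζ` of the point vortex potential `∑_j γ_j / (2πi) log (ζ - ζ_j)`. -/
def w0Deriv (Λ : Params M) (ζ : ℂ) : ℂ :=
  ∑ j, (Λ.circ j : ℂ) / (2 * Real.pi * Complex.I) * (1 / (ζ - Λ.ctr j))

/-- The part of `w⁰_ζ` at `ζ_k + ρ τ` that is due to the vortices other than the `k`-th. -/
def w0Rest (Λ : Params M) (ρ : ℝ) (k : Fin M) (τ : Circle) : ℂ :=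
  ∑ j ∈ Finset.univ.erase k,
    (Λ.circ j : ℂ) / (2 * Real.pi * Complex.I) * (1 / (Λ.ctr k + ρ * τ - Λ.ctr j))

/-- `ρ τ w⁰_ζ(ζ_k + ρ τ)`, with its limit as the value at `ρ = 0`. -/
def scaledW0 (Λ : Params M) (ρ : ℝ) (k : Fin M) (τ : Circle) : ℂ :=
  (Λ.circ k : ℂ) / (2 * Real.pi * Complex.I) + ρ * τ * w0Rest Λ ρ k τ

theorem scaledW0_eq (Λ : Params M) {ρ : ℝ} (hρ : ρ ≠ 0) (k : Fin M) (τ : Circle) :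
    scaledW0 Λ ρ k τ = ρ * τ * w0Deriv Λ (Λ.ctr k + ρ * τ) := by
  have h1 : (ρ : ℂ) ≠ 0 := by exact_mod_cast hρ
  have h2 : (τ : ℂ) ≠ 0 := Circle.coe_ne_zero τ
  have h3 := Finset.add_sum_erase Finset.univ
    (fun j => (Λ.circ j : ℂ) / (2 * Real.pi * Complex.I) * (1 / (Λ.ctr k + ρ * τ - Λ.ctr j)))
    (Finset.mem_univ k)
  unfold scaledW0 w0Rest w0Deriv
  rw [← h3, mul_add]
  congr 1
  rw [add_sub_cancel_left]
  field_simp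

/-- The non-singular relative velocity `𝒱_k^ρ(τ)` of the point vortices: the value at
`ζ = ζ_k + ρ τ` of `w⁰_ζ + i Ω conj ζ - c` with the pole of the `k`-th vortex removed. -/
def relVel (Λ : Params M) (ρ : ℝ) (k : Fin M) (τ : Circle) : ℂ :=
  w0Rest Λ ρ k τ + Complex.I * Λ.angVel * (starRingEnd ℂ) (Λ.ctr k + ρ * τ) - Λ.speed

/-- The quantity that, multiplied by `τ`, has the kinematic residual as its real part:
`𝒵_k ν' + 𝒱_k + (i Ω conj (ζ_k + ρ τ) - c) ρ 𝒵_k μ' + i Ω ρ² conj (𝒵_k μ)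
+ i Ω ρ³ 𝒵_k μ' conj (𝒵_k μ)`. -/
def kinExpr (u : XSpace M ℓ α) (ρ : ℝ) (k : Fin M) (τ : Circle) : ℂ :=
  zNu' u ρ k τ + relVel u.par ρ k τ
  + (Complex.I * u.par.angVel * (starRingEnd ℂ) (u.par.ctr k + ρ * τ) - u.par.speed)
      * ρ * zMu' u ρ k τ
  + Complex.I * u.par.angVel * ρ ^ 2 * (starRingEnd ℂ) (zMu u ρ k τ)
  + Complex.I * u.par.angVel * ρ ^ 3 * zMu' u ρ k τ * (starRingEnd ℂ) (zMu u ρ k τ)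

/-- The kinematic component `𝒜_k(u, ρ)`. -/
def opA (u : XSpace M ℓ α) (ρ : ℝ) (k : Fin M) (τ : Circle) : ℝ :=
  ((τ : ℂ) * kinExpr u ρ k τ).re

/-- The Bernoulli operator `ℬ_k^ρ`, which is determined for `ρ ≠ 0` by
`|γ_k / (2πi τ) + ρ K|² / |1 + ρ D|² = γ_k² / (4π²) + ρ ℬ_k^ρ` with `K = kinExpr`,
`D = 𝒵_k^ρ μ'`; here the factor `ρ` has been cancelled, so that `ρ = 0` is included. -/
def bernoulliOp (u : XSpace M ℓ α) (ρ : ℝ) (k : Fin M) (τ : Circle) : ℝ :=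
  (2 * ((starRingEnd ℂ) ((u.par.circ k : ℂ) / (2 * Real.pi * Complex.I * τ))
          * kinExpr u ρ k τ).re
    + ρ * ‖kinExpr u ρ k τ‖ ^ 2
    - (u.par.circ k) ^ 2 / (4 * Real.pi ^ 2)
        * (2 * (zMu' u ρ k τ).re + ρ * ‖zMu' u ρ k τ‖ ^ 2))
  / ‖1 + ρ * zMu' u ρ k τ‖ ^ 2

theorem norm_add_real_mul_sq (a b : ℂ) (ρ : ℝ) :
    ‖a + ρ * b‖ ^ 2 = ‖a‖ ^ 2 + 2 * ρ * ((starRingEnd ℂ) a * b).re + ρ ^ 2 * ‖b‖ ^ 2 := by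
  simp only [← Complex.normSq_eq_norm_sq, Complex.normSq_apply, Complex.add_re, Complex.add_im,
    Complex.mul_re, Complex.mul_im, Complex.conj_re, Complex.conj_im, Complex.ofReal_re,
    Complex.ofReal_im]
  ring

/-- The relation that determines the Bernoulli operator. -/
theorem bernoulliOp_spec (u : XSpace M ℓ α) (ρ : ℝ) (k : Fin M) (τ : Circle)
    (h : 1 + ρ * zMu' u ρ k τ ≠ 0) :
    ‖(u.par.circ k : ℂ) / (2 * Real.pi * Complex.I * τ) + ρ * kinExpr u ρ k τ‖ ^ 2
        / ‖1 + ρ * zMu' u ρ k τ‖ ^ 2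
      = (u.par.circ k) ^ 2 / (4 * Real.pi ^ 2) + ρ * bernoulliOp u ρ k τ := by
  have hD : ‖1 + ρ * zMu' u ρ k τ‖ ^ 2 ≠ 0 := by
    simpa using h
  have h1 := norm_add_real_mul_sq 1 (zMu' u ρ k τ) ρ
  have h2 := norm_add_real_mul_sq ((u.par.circ k : ℂ) / (2 * Real.pi * Complex.I * τ))
    (kinExpr u ρ k τ) ρ
  have h3 : ‖(u.par.circ k : ℂ) / (2 * Real.pi * Complex.I * τ)‖ ^ 2
      = (u.par.circ k) ^ 2 / (4 * Real.pi ^ 2) := by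
    simp only [norm_div, norm_mul, Complex.norm_real, Complex.norm_I, Circle.norm_coe, mul_one,
      RCLike.norm_ofNat, Real.norm_eq_abs, abs_of_pos Real.pi_pos, div_pow, mul_pow, sq_abs]
    norm_num
  rw [h3] at h2
  simp only [map_one, one_mul, norm_one, one_pow] at h1
  rw [h2, div_eq_iff hD, bernoulliOp, add_mul, mul_assoc ρ, div_mul_cancel₀ _ hD, h1]
  ring

/-- The Bernoulli component `ℬ_k(u, ρ) = ℬ_k^ρ - Q_k`. -/
def opB (u : XSpace M ℓ α) (ρ : ℝ) (k : Fin M) (τ : Circle) : ℝ :=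
  bernoulliOp u ρ k τ - u.bern k

/-- The domain `𝒪` of the operator: the circles `∂B_ρ(ζ_k)` are disjoint, and `f_ζ` does not
vanish on them, both with a uniform margin `δ`. -/
def domainO (M ℓ : ℕ) (α : ℝ≥0) : Set (XSpace M ℓ α × ℝ) :=
  {p | ∃ δ > (0 : ℝ),
    (∀ j k, j ≠ k → 2 * |p.2| + δ < ‖p.1.par.ctr j - p.1.par.ctr k‖) ∧
    ∀ k τ, δ < ‖1 + p.2 * zMu' p.1 p.2 k τ‖}

/-! ### The maps `φ_t`, `φ_r`, `φ_s` -/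

/-- The common factor of the integrands:
`½ B_k (1 + ρ 𝒵_k μ') - conj (ρ τ (w⁰_ζ + 𝒵_k ν')) / conj (1 + ρ 𝒵_k μ') A_k`. -/
def core (Y : YSpace M ℓ α) (u : XSpace M ℓ α) (ρ : ℝ) (k : Fin M) (τ : Circle) : ℂ :=
  (1 / 2 : ℂ) * (Y.dyn k τ : ℂ) * (1 + ρ * zMu' u ρ k τ)
  - (starRingEnd ℂ) (scaledW0 u.par ρ k τ + ρ * τ * zNu' u ρ k τ)
      / (starRingEnd ℂ) (1 + ρ * zMu' u ρ k τ) * (Y.kin k τ : ℂ)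

/-- `∑_k ∫_𝕋 (core) dτ`, attached to translations. -/
def transInt (Y : YSpace M ℓ α) (u : XSpace M ℓ α) (ρ : ℝ) : ℂ :=
  ∑ k, contourInt (fun τ => core Y u ρ k τ)

/-- `∑_k ∫_𝕋 (core) conj (ζ_k + ρ τ + ρ² 𝒵_k μ) dτ`, attached to rotations. -/
def rotInt (Y : YSpace M ℓ α) (u : XSpace M ℓ α) (ρ : ℝ) : ℂ :=
  ∑ k, contourInt (fun τ => core Y u ρ k τ
    * (starRingEnd ℂ) (u.par.ctr k + ρ * τ + ρ ^ 2 * zMu u ρ k τ))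

/-- The map for translating configurations. -/
def phiT (Y : YSpace M ℓ α) (u : XSpace M ℓ α) (ρ : ℝ) : ℝ := (transInt Y u ρ).im

/-- The map for rotating configurations. -/
def phiR (Y : YSpace M ℓ α) (u : XSpace M ℓ α) (ρ : ℝ) : ℝ := (rotInt Y u ρ).re

/-- The map for stationary configurations. -/
def phiS (Y : YSpace M ℓ α) (u : XSpace M ℓ α) (ρ : ℝ) : ℂ × ℝ :=
  (transInt Y u ρ, (rotInt Y u ρ).re)

/-- The three properties of a map `φ(A, B, u, ρ)` at a given `(u, ρ)`. The first one includes that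
the residuals `𝒜(u, ρ)`, `ℬ(u, ρ)` do form an element of the space `YSpace`, the last one that the
derivative in `(A, B)` at `0` exists. -/
structure IdentitiesAt {E : Type*} [NormedAddCommGroup E] [NormedSpace ℝ E]
    (φ : YSpace M ℓ α → XSpace M ℓ α → ℝ → E) (u : XSpace M ℓ α) (ρ : ℝ) : Prop where
  residual : ∃ Y : YSpace M ℓ α,
    (∀ k τ, Y.kin k τ = opA u ρ k τ) ∧ (∀ k τ, Y.dyn k τ = opB u ρ k τ) ∧ φ Y u ρ = 0
  zero : φ 0 u ρ = 0
  differentiableAt : DifferentiableAt ℝ (fun Y => φ Y u ρ) 0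
  surjective : Function.Surjective (fderiv ℝ (fun Y => φ Y u ρ) 0)

end HollowVortex

end

open scoped NNReal

noncomputable section

namespace HollowVortex

/-! ### Calculus of periodic Hölder functions on the line -/

section HolderCalculus

set_option linter.unusedSectionVars false

open Real Set Function

variable {E F : Type*} [NormedAddCommGroup E] [NormedSpace ℝ E] [NormedAddCommGroup F]
  [NormedSpace ℝ F] {a : ℝ} {k : ℕ}

/-! On the k-th circle let f = ζ_k + ρτ + ρ² 𝒵_k μ and F = 1 + ρ 𝒵_k μ' be the traces of the
conformal map and of its derivative, W = w⁰_ζ + 𝒵_k ν' that of the potential's derivative, and b =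
iΩ conj f − c. For ρ ≠ 0 put g = ρτ(W + bF). The pole γ_k/(2πi) is imaginary, so ρ𝒜_k = Re g, while
ρ(ℬ_k^ρ − Q_k) is |g|²/|F|² minus a real constant. Inserting both into I_k removes the products of W
with conj W (`rho_mul_core`): ρ I_k = (ρ²/2) (conj b (W − conj τ² conj W) + |b|² F − conj τ² conj
(W²/F)) − const · F.

Three facts evaluate the integrals. On the circle conj(dτ) = −conj τ² dτ, so conjugated integrands
give conjugated integrals. Since ρF dτ = df, the form F dτ is exact, and conj f F dτ and |f|² conj f
F dτ have imaginary integrals. Finally W, W²/F and W² f/F are traces of functions holomorphic in the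
fluid, so their integrals over all circles together are residues at infinity; with Γ = ∑ γ_j these
are Γ/ρ, 0 and Γ²/(2πiρ) (`potential_identities`). Hence ∑ ∫ I_k dτ = −cΓ when Ω = 0, which is real
and vanishes if also c = 0, and the rotational integral is imaginary when c = 0.

Instead of extending functions to the fluid, the residue calculus works in the uniform closure of
the algebra generated by the traces of 1/(ζ − p), p in the discs. Products of two elements have
total integral zero by partial fractions (`circlesInt_mul_eq_zero`). Layer potentials belong to the
closure because their densities may be moved to slightly smaller circles
(`traceZ_mem_exteriorTraces`), and 1/F − 1 belongs to it by a Neumann series.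

At ρ = 0 the division by ρ is not available. There ∫ I_k dτ = γ_k conj V_k with V_k the relative
velocity of the k-th point vortex (`contourInt_core_zero`), and the claims become the classical
identities for ∑ γ_k V_k and Re ∑ γ_k V_k ζ_k.

The residuals lie in the right space by the Plemelj–Privalov theorem (`isHolder_cauchyS`), and
because conj f df has imaginary integral, which gives 𝒜_k mean zero. The maps φ are real-linear and
bounded in (A, B), so they equal their derivatives. For surjectivity, A = 0 and B_k = Re(b_k conj τ)
give at the point vortex weights with prescribed sum and first moment; two distinct centres suffice
to reach all of ℂ × ℝ, and nearby states are perturbations (`surjective_phiS`). -/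

/-- Global Hölder continuity on the line with exponent `a`. -/
def IsHolder (a : ℝ) (g : ℝ → E) : Prop := ∃ C : ℝ, ∀ x y, ‖g x - g y‖ ≤ C * |x - y| ^ a

/-- The `2π`-periodic functions of class `C^{k+a}`. -/
def CHolder (a : ℝ) : ℕ → (ℝ → E) → Prop
  | 0, g => Periodic g (2 * π) ∧ IsHolder a g
  | k + 1, g => Periodic g (2 * π) ∧ Differentiable ℝ g ∧ CHolder a k (deriv g)

theorem IsHolder.exists_nonneg {g : ℝ → E} (h : IsHolder a g) :
    ∃ C : ℝ, 0 ≤ C ∧ ∀ x y, ‖g x - g y‖ ≤ C * |x - y| ^ a := by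
  obtain ⟨C, hC⟩ := h
  exact ⟨|C|, abs_nonneg C, fun x y => (hC x y).trans
    (mul_le_mul_of_nonneg_right (le_abs_self C) (by positivity))⟩

theorem IsHolder.continuous {g : ℝ → E} (ha : 0 < a) (h : IsHolder a g) : Continuous g := by
  obtain ⟨C, hC⟩ := h
  refine continuous_iff_continuousAt.2 fun x => ?_
  rw [ContinuousAt, tendsto_iff_norm_sub_tendsto_zero]
  have h1 : Filter.Tendsto (fun y : ℝ => C * |y - x| ^ a) (nhds x) (nhds (C * |x - x| ^ a)) := by
    have : Continuous fun y : ℝ => C * |y - x| ^ a :=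
      continuous_const.mul ((by fun_prop : Continuous fun y : ℝ => |y - x|).rpow_const
        fun _ => Or.inr ha.le)
    exact this.tendsto x
  rw [sub_self, abs_zero, zero_rpow ha.ne', mul_zero] at h1
  exact squeeze_zero (fun _ => norm_nonneg _) (fun y => hC y x) h1

theorem exists_norm_le_of_periodic {g : ℝ → E} (hp : Periodic g (2 * π)) (hc : Continuous g) :
    ∃ B : ℝ, 0 ≤ B ∧ ∀ x, ‖g x‖ ≤ B := by
  obtain ⟨B, hB⟩ := (hp.isBounded_of_continuous (by positivity) hc).exists_norm_le
  exact ⟨B, (norm_nonneg _).trans (hB _ ⟨0, rfl⟩), fun x => hB _ ⟨x, rfl⟩⟩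

theorem periodic_deriv {g : ℝ → E} {c : ℝ} (hp : Periodic g c) : Periodic (deriv g) c := by
  intro x
  have h := deriv_comp_add_const g c x
  rw [show (fun y => g (y + c)) = g from funext hp] at h
  exact h.symm

/-- The Lipschitz bound serves pairs at distance at most 1, where |x − y| ≤ |x − y|^a, and the sup
bound serves the others. -/
theorem isHolder_of_lipschitz_of_bounded {g : ℝ → E} (ha0 : 0 < a) (ha1 : a ≤ 1) {B L : ℝ}
    (hB : ∀ x, ‖g x‖ ≤ B) (hL : ∀ x y, ‖g x - g y‖ ≤ L * |x - y|) : IsHolder a g := by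
  have hB0 : 0 ≤ B := (norm_nonneg _).trans (hB 0)
  have hL0 : 0 ≤ L := by simpa using (norm_nonneg _).trans (hL 1 0)
  refine ⟨L + 2 * B, fun x y => ?_⟩
  have hn : 0 ≤ |x - y| := abs_nonneg _
  rcases le_total |x - y| 1 with h | h
  · have h1 : |x - y| ≤ |x - y| ^ a := by
      rcases hn.eq_or_lt with h0 | h0
      · rw [← h0, zero_rpow ha0.ne']
      · simpa using rpow_le_rpow_of_exponent_ge h0 h ha1
    calc ‖g x - g y‖ ≤ L * |x - y| := hL x y
      _ ≤ L * |x - y| ^ a := by gcongr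
      _ ≤ (L + 2 * B) * |x - y| ^ a := by gcongr; linarith
  · have h1 : 1 ≤ |x - y| ^ a := one_le_rpow h ha0.le
    calc ‖g x - g y‖ ≤ ‖g x‖ + ‖g y‖ := norm_sub_le _ _
      _ ≤ (L + 2 * B) * 1 := by linarith [hB x, hB y]
      _ ≤ (L + 2 * B) * |x - y| ^ a := by gcongr

theorem norm_sub_le_of_deriv_bound {g : ℝ → E} (hd : Differentiable ℝ g) {L : ℝ}
    (hL : ∀ x, ‖deriv g x‖ ≤ L) (x y : ℝ) : ‖g x - g y‖ ≤ L * |x - y| :=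
  convex_univ.norm_image_sub_le_of_norm_deriv_le (fun z _ => hd z) (fun z _ => hL z)
    (mem_univ y) (mem_univ x)

theorem isHolder_of_periodic_deriv {g : ℝ → E} (ha0 : 0 < a) (ha1 : a ≤ 1)
    (hp : Periodic g (2 * π)) (hd : Differentiable ℝ g) (hc : Continuous (deriv g)) :
    IsHolder a g := by
  obtain ⟨B, -, hB⟩ := exists_norm_le_of_periodic hp hd.continuous
  obtain ⟨L, -, hL⟩ := exists_norm_le_of_periodic (periodic_deriv hp) hc
  exact isHolder_of_lipschitz_of_bounded ha0 ha1 hB (norm_sub_le_of_deriv_bound hd hL)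

namespace CHolder

theorem continuous (ha : 0 < a) {g : ℝ → E} : ∀ {k}, CHolder a k g → Continuous g
  | 0, h => h.2.continuous ha
  | _ + 1, h => h.2.1.continuous

theorem of_succ (ha0 : 0 < a) (ha1 : a ≤ 1) {g : ℝ → E} (h : CHolder a (k + 1) g) :
    CHolder a k g := by
  induction k generalizing g with
  | zero => exact ⟨h.1, isHolder_of_periodic_deriv ha0 ha1 h.1 h.2.1 (h.2.2.continuous ha0)⟩
  | succ k ih => exact ⟨h.1, h.2.1, ih h.2.2⟩

theorem zero_of (ha0 : 0 < a) (ha1 : a ≤ 1) {g : ℝ → E} (h : CHolder a k g) : CHolder a 0 g := by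
  induction k generalizing g with
  | zero => exact h
  | succ k ih => exact ih (h.of_succ ha0 ha1)

theorem isHolder (ha0 : 0 < a) (ha1 : a ≤ 1) {g : ℝ → E} (h : CHolder a k g) : IsHolder a g :=
  (h.zero_of ha0 ha1).2

theorem clm_comp (L : E →L[ℝ] F) {g : ℝ → E} (h : CHolder a k g) :
    CHolder a k fun x => L (g x) := by
  induction k generalizing g with
  | zero =>
    refine ⟨fun x => by simp only [h.1 x], ?_⟩
    obtain ⟨C, hC⟩ := h.2
    refine ⟨‖L‖ * C, fun x y => ?_⟩
    rw [← map_sub, mul_assoc]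
    exact (L.le_opNorm _).trans (mul_le_mul_of_nonneg_left (hC x y) (norm_nonneg _))
  | succ k ih =>
    refine ⟨fun x => by simp only [h.1 x], L.differentiable.comp h.2.1, ?_⟩
    have : deriv (fun x => L (g x)) = fun x => L (deriv g x) := by
      funext x
      exact (L.hasFDerivAt.comp_hasDerivAt x (h.2.1 x).hasDerivAt).deriv
    rw [this]
    exact ih h.2.2

theorem add {f g : ℝ → E} (hf : CHolder a k f) (hg : CHolder a k g) :
    CHolder a k fun x => f x + g x := by
  induction k generalizing f g with
  | zero =>
    refine ⟨fun x => by simp only [hf.1 x, hg.1 x], ?_⟩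
    obtain ⟨C, hC⟩ := hf.2
    obtain ⟨C', hC'⟩ := hg.2
    refine ⟨C + C', fun x y => ?_⟩
    rw [add_sub_add_comm, add_mul]
    exact (norm_add_le _ _).trans (add_le_add (hC x y) (hC' x y))
  | succ k ih =>
    refine ⟨fun x => by simp only [hf.1 x, hg.1 x], hf.2.1.add hg.2.1, ?_⟩
    have : deriv (fun x => f x + g x) = fun x => deriv f x + deriv g x :=
      funext fun x => deriv_add (hf.2.1 x) (hg.2.1 x)
    rw [this]
    exact ih hf.2.2 hg.2.2

theorem const (c : E) : CHolder a k fun _ => c := by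
  induction k generalizing c with
  | zero => exact ⟨fun _ => rfl, 0, fun x y => by simp⟩
  | succ k ih => exact ⟨fun _ => rfl, differentiable_const c, by simpa using ih 0⟩

theorem neg {f : ℝ → E} (hf : CHolder a k f) : CHolder a k fun x => -f x := by
  simpa using hf.clm_comp (-(ContinuousLinearMap.id ℝ E))

theorem sub {f g : ℝ → E} (hf : CHolder a k f) (hg : CHolder a k g) :
    CHolder a k fun x => f x - g x := by
  simpa only [sub_eq_add_neg] using hf.add hg.neg

theorem sum {ι : Type*} (s : Finset ι) {f : ι → ℝ → E}
    (hf : ∀ i ∈ s, CHolder a k (f i)) : CHolder a k fun x => ∑ i ∈ s, f i x := by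
  classical
  induction s using Finset.induction_on with
  | empty => simpa using const (0 : E)
  | insert i s hi ih =>
    simp only [Finset.sum_insert hi]
    exact (hf i (by simp)).add (ih fun j hj => hf j (by simp [hj]))

theorem mul (ha0 : 0 < a) (ha1 : a ≤ 1) {f g : ℝ → ℂ} (hf : CHolder a k f)
    (hg : CHolder a k g) : CHolder a k fun x => f x * g x := by
  induction k generalizing f g with
  | zero =>
    refine ⟨fun x => by simp only [hf.1 x, hg.1 x], ?_⟩
    obtain ⟨B, hB0, hB⟩ := exists_norm_le_of_periodic hf.1 (hf.continuous ha0)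
    obtain ⟨B', hB0', hB'⟩ := exists_norm_le_of_periodic hg.1 (hg.continuous ha0)
    obtain ⟨C, hC0, hC⟩ := hf.2.exists_nonneg
    obtain ⟨C', hC0', hC'⟩ := hg.2.exists_nonneg
    refine ⟨B * C' + C * B', fun x y => ?_⟩
    have : f x * g x - f y * g y = f x * (g x - g y) + (f x - f y) * g y := by ring
    rw [this]
    refine (norm_add_le _ _).trans ?_
    rw [norm_mul, norm_mul]
    calc ‖f x‖ * ‖g x - g y‖ + ‖f x - f y‖ * ‖g y‖
        ≤ B * (C' * |x - y| ^ a) + (C * |x - y| ^ a) * B' :=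
          add_le_add (mul_le_mul (hB x) (hC' x y) (norm_nonneg _) hB0)
            (mul_le_mul (hC x y) (hB' y) (norm_nonneg _) (by positivity))
      _ = _ := by ring
  | succ k ih =>
    refine ⟨fun x => by simp only [hf.1 x, hg.1 x], hf.2.1.mul hg.2.1, ?_⟩
    have : deriv (fun x => f x * g x) = fun x => deriv f x * g x + f x * deriv g x :=
      funext fun x => deriv_fun_mul (hf.2.1 x) (hg.2.1 x)
    rw [this]
    exact (ih hf.2.2 (hg.of_succ ha0 ha1)).add (ih (hf.of_succ ha0 ha1) hg.2.2)

theorem inv (ha0 : 0 < a) (ha1 : a ≤ 1) {f : ℝ → ℂ} (hf : CHolder a k f) (h0 : ∀ x, f x ≠ 0) :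
    CHolder a k fun x => (f x)⁻¹ := by
  induction k generalizing f with
  | zero =>
    have hp : Periodic (fun x => (f x)⁻¹) (2 * π) := fun x => by simp only [hf.1 x]
    refine ⟨hp, ?_⟩
    obtain ⟨B, hB0, hB⟩ := exists_norm_le_of_periodic hp ((hf.continuous ha0).inv₀ h0)
    obtain ⟨C, hC0, hC⟩ := hf.2.exists_nonneg
    refine ⟨B * C * B, fun x y => ?_⟩
    have : (f x)⁻¹ - (f y)⁻¹ = (f x)⁻¹ * (f y - f x) * (f y)⁻¹ := by
      field_simp [h0 x, h0 y]
    rw [this, norm_mul, norm_mul, norm_sub_rev]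
    calc ‖(f x)⁻¹‖ * ‖f x - f y‖ * ‖(f y)⁻¹‖ ≤ B * (C * |x - y| ^ a) * B :=
          mul_le_mul (mul_le_mul (hB x) (hC x y) (norm_nonneg _) hB0) (hB y) (norm_nonneg _)
            (by positivity)
      _ = _ := by ring
  | succ k ih =>
    refine ⟨fun x => by simp only [hf.1 x], hf.2.1.inv h0, ?_⟩
    have : deriv (fun x => (f x)⁻¹) = fun x => -(deriv f x * ((f x)⁻¹ * (f x)⁻¹)) := by
      funext x
      have := ((hf.2.1 x).hasDerivAt.inv (h0 x)).deriv
      rw [show (fun x => (f x)⁻¹) = f⁻¹ from rfl, this]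
      field_simp [h0 x]
    rw [this]
    have hi := ih (hf.of_succ ha0 ha1) h0
    exact (hf.2.2.mul ha0 ha1 (hi.mul ha0 ha1 hi)).neg

theorem const_mul (ha0 : 0 < a) (ha1 : a ≤ 1) (c : ℂ) {f : ℝ → ℂ} (hf : CHolder a k f) :
    CHolder a k fun x => c * f x :=
  (const c).mul ha0 ha1 hf

theorem of_contDiff (ha0 : 0 < a) (ha1 : a ≤ 1) {g : ℝ → E} (hp : Periodic g (2 * π))
    (hg : ContDiff ℝ ((⊤ : ℕ∞) : WithTop ℕ∞) g) : CHolder a k g := by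
  -- One derivative beyond order k replaces the Hölder condition, since a continuous periodic
  -- derivative is bounded.
  have key : ∀ (k : ℕ) (g : ℝ → E), Periodic g (2 * π) → ContDiff ℝ (k + 1 : ℕ) g →
      CHolder a k g := by
    intro k
    induction k with
    | zero =>
      intro g hp hg
      have hg1 : ContDiff ℝ 1 g := by simpa using hg
      exact ⟨hp, isHolder_of_periodic_deriv ha0 ha1 hp (hg1.differentiable (by simp))
        (hg1.continuous_deriv (by simp))⟩
    | succ k ih =>
      intro g hp hg
      have h2 : ContDiff ℝ ((k + 1 : ℕ) + 1) g := by exact_mod_cast hg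
      have h1 := contDiff_succ_iff_deriv.1 h2
      exact ⟨hp, h1.1, ih _ (periodic_deriv hp) h1.2.2⟩
  exact key k g hp (hg.of_le (by exact_mod_cast le_top))

end CHolder

theorem memHolder_iff_isHolder {r : ℝ≥0} {g : ℝ → E} : MemHolder r g ↔ IsHolder r g := by
  constructor
  · rintro ⟨C, hC⟩
    refine ⟨C, fun x y => ?_⟩
    have := hC.dist_le x y
    rwa [dist_eq_norm, Real.dist_eq] at this
  · intro h
    obtain ⟨C, hC0, hC⟩ := h.exists_nonneg
    refine ⟨C.toNNReal, fun x y => ?_⟩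
    rw [edist_dist, edist_dist, ENNReal.ofReal_rpow_of_nonneg dist_nonneg (NNReal.coe_nonneg r),
      ← ENNReal.ofReal_coe_nnreal, Real.coe_toNNReal C hC0, ← ENNReal.ofReal_mul hC0]
    refine ENNReal.ofReal_le_ofReal ?_
    rw [dist_eq_norm, Real.dist_eq]
    exact hC x y

/-- Passage between the recursive class, in which products, inverses and Cauchy integrals are
treated by induction on k, and the defining condition of `HolderFun`. -/
theorem cHolder_iff {r : ℝ≥0} {g : ℝ → E} (hr : 0 < r) (hp : Periodic g (2 * π)) :
    CHolder r k g ↔ ContDiff ℝ k g ∧ MemHolder r (iteratedDeriv k g) := by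
  induction k generalizing g with
  | zero =>
    rw [iteratedDeriv_zero, memHolder_iff_isHolder]
    refine ⟨fun h => ⟨contDiff_zero.2 (h.2.continuous (by exact_mod_cast hr)), h.2⟩,
      fun h => ⟨hp, h.2⟩⟩
  | succ k ih =>
    have hc : ContDiff ℝ (k + 1 : ℕ) g ↔ Differentiable ℝ g ∧ ContDiff ℝ k (deriv g) := by
      have := contDiff_succ_iff_deriv (𝕜 := ℝ) (n := k) (f := g)
      simpa using this
    rw [iteratedDeriv_succ', hc, and_assoc, ← ih (periodic_deriv hp)]
    exact ⟨fun h => h.2, fun h => ⟨hp, h⟩⟩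

end HolderCalculus

end HollowVortex

end

open scoped NNReal

noncomputable section

namespace HollowVortex

/-! ### The Cauchy singular integral on the circle -/

section CauchyIntegral

open Real Set MeasureTheory Function

variable {a : ℝ}

theorem intervalIntegrable_comp_abs {φ : ℝ → ℝ} {r : ℝ} (hr : 0 ≤ r)
    (h : IntervalIntegrable φ volume 0 r) :
    IntervalIntegrable (fun s => φ |s|) volume (-r) r ∧
      ∫ s in -r..r, φ |s| = 2 * ∫ s in (0 : ℝ)..r, φ s := by
  have h1 : IntervalIntegrable (fun s => φ |s|) volume 0 r := by
    refine h.congr fun s hs => ?_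
    rw [uIoc_of_le hr] at hs
    simp only [abs_of_pos hs.1]
  have h2 : IntervalIntegrable (fun s => φ |s|) volume (-r) 0 := by
    have := (IntervalIntegrable.iff_comp_neg (f := fun s => φ |s|) (a := -r) (b := 0)).2
      (by simpa using h1.symm)
    exact this
  refine ⟨h2.trans h1, ?_⟩
  have e1 : ∫ s in (0 : ℝ)..r, φ |s| = ∫ s in (0 : ℝ)..r, φ s := by
    refine intervalIntegral.integral_congr fun s hs => ?_
    rw [uIcc_of_le hr] at hs
    simp only [abs_of_nonneg hs.1]
  have e2 : ∫ s in -r..0, φ |s| = ∫ s in (0 : ℝ)..r, φ |s| := by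
    have := intervalIntegral.integral_comp_neg (a := 0) (b := r) fun s => φ |s|
    simpa using this.symm
  rw [← intervalIntegral.integral_add_adjacent_intervals h2 h1, e2, e1, two_mul]

theorem integral_abs_rpow_sub_one (ha : 0 < a) :
    IntervalIntegrable (fun s : ℝ => |s| ^ (a - 1)) volume (-π) π ∧
      ∫ s in -π..π, |s| ^ (a - 1) = 2 * (π ^ a / a) := by
  have h := intervalIntegrable_comp_abs (φ := fun s => s ^ (a - 1)) pi_pos.le
    (intervalIntegral.intervalIntegrable_rpow' (by linarith))
  refine ⟨h.1, h.2.trans ?_⟩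
  rw [integral_rpow (Or.inl (by linarith)), sub_add_cancel, zero_rpow ha.ne', sub_zero]

theorem intervalIntegrable_weight (ha : 0 < a) {h : ℝ} (hh : 0 < h) {b : ℝ} (hb : 0 ≤ b) :
    IntervalIntegrable (fun s : ℝ => s ^ (a - 1) * (h / (s + h))) volume 0 b := by
  refine (intervalIntegral.intervalIntegrable_rpow' (by linarith)).mul_continuousOn ?_
  refine continuousOn_const.div (by fun_prop) fun s hs => ?_
  rw [uIcc_of_le hb] at hs
  have := hs.1
  positivity

/-- The weight h/(s + h) is at most 1 for s ≤ h and at most h/s for s ≥ h. The first range uses a >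
0, the second a < 1, and both give a multiple of h^a. -/
theorem integral_weight_le (ha0 : 0 < a) (ha1 : a < 1) {h : ℝ} (hh : 0 < h) (hh1 : h ≤ 1) :
    IntervalIntegrable (fun s : ℝ => |s| ^ (a - 1) * (h / (|s| + h))) volume (-π) π ∧
      ∫ s in -π..π, |s| ^ (a - 1) * (h / (|s| + h)) ≤ 2 * (1 / a + 1 / (1 - a)) * h ^ a := by
  have hπ : h ≤ π := hh1.trans (by linarith [pi_gt_three])
  have hi := intervalIntegrable_weight ha0 hh pi_pos.le
  have he := intervalIntegrable_comp_abs (φ := fun s => s ^ (a - 1) * (h / (s + h))) pi_pos.le hi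
  refine ⟨he.1, he.2.trans_le ?_⟩
  rw [mul_assoc]
  refine mul_le_mul_of_nonneg_left ?_ two_pos.le
  have hi1 := intervalIntegrable_weight ha0 hh hh.le
  have hi2 : IntervalIntegrable (fun s : ℝ => s ^ (a - 1) * (h / (s + h))) volume h π :=
    hi1.symm.trans hi
  rw [← intervalIntegral.integral_add_adjacent_intervals hi1 hi2, add_mul]
  refine add_le_add ?_ ?_
  · have h1 : ∫ s in (0 : ℝ)..h, s ^ (a - 1) * (h / (s + h)) ≤ ∫ s in (0 : ℝ)..h, s ^ (a - 1) := by
      refine intervalIntegral.integral_mono_on hh.le hi1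
        (intervalIntegral.intervalIntegrable_rpow' (by linarith)) fun s hs => ?_
      have h2 : h / (s + h) ≤ 1 := (div_le_one (by linarith [hs.1])).2 (by linarith [hs.1])
      exact mul_le_of_le_one_right (rpow_nonneg hs.1 _) h2
    rw [integral_rpow (Or.inl (by linarith)), sub_add_cancel, zero_rpow ha0.ne', sub_zero] at h1
    rw [one_div, inv_mul_eq_div]
    exact h1
  · have hn : (0 : ℝ) ∉ Set.uIcc h π := by
      rw [uIcc_of_le hπ]
      exact fun hx => absurd hx.1 (not_le.2 hh)
    have h1 : ∫ s in h..π, s ^ (a - 1) * (h / (s + h)) ≤ ∫ s in h..π, h * s ^ (a - 2) := by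
      refine intervalIntegral.integral_mono_on hπ hi2
        ((intervalIntegral.intervalIntegrable_rpow (Or.inr hn)).const_mul h) fun s hs => ?_
      have hs0 : 0 < s := hh.trans_le hs.1
      have h2 : h / (s + h) ≤ h / s := by gcongr; linarith
      calc s ^ (a - 1) * (h / (s + h)) ≤ s ^ (a - 1) * (h / s) := by gcongr
        _ = h * (s ^ (a - 1) / s) := by ring
        _ = h * s ^ (a - 2) := by rw [← rpow_sub_one hs0.ne']; ring_nf
    refine h1.trans ?_
    rw [intervalIntegral.integral_const_mul, integral_rpow (Or.inr ⟨by linarith, hn⟩)]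
    have e : a - 2 + 1 = -(1 - a) := by ring
    have hp : 0 ≤ π ^ (-(1 - a)) := by positivity
    have h4 : h * h ^ (-(1 - a)) = h ^ a := by
      nth_rewrite 1 [← rpow_one h]
      rw [← rpow_add hh]; ring_nf
    have h3 : (π ^ (-(1 - a)) - h ^ (-(1 - a))) / (-(1 - a))
        = (h ^ (-(1 - a)) - π ^ (-(1 - a))) / (1 - a) := by
      rw [div_neg, ← neg_div, neg_sub]
    have h5 : (0 : ℝ) < 1 - a := by linarith
    rw [e, h3, ← mul_div_assoc, one_div, inv_mul_eq_div]
    gcongr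
    rw [mul_sub, h4]
    have : 0 ≤ h * π ^ (-(1 - a)) := by positivity
    linarith

theorem integral_shifted_rpow_le (ha1 : a < 1) {h : ℝ} (hh : 0 < h) :
    IntervalIntegrable (fun s : ℝ => (|s| + h) ^ (a - 2)) volume (-π) π ∧
      ∫ s in -π..π, (|s| + h) ^ (a - 2) ≤ 2 * (1 / (1 - a)) * h ^ (a - 1) := by
  have hi : IntervalIntegrable (fun s : ℝ => (s + h) ^ (a - 2)) volume 0 π := by
    refine ContinuousOn.intervalIntegrable ?_
    refine ContinuousOn.rpow_const (by fun_prop) fun s hs => Or.inl ?_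
    rw [uIcc_of_le pi_pos.le] at hs
    linarith [hs.1]
  have he := intervalIntegrable_comp_abs (φ := fun s => (s + h) ^ (a - 2)) pi_pos.le hi
  refine ⟨he.1, he.2.trans_le ?_⟩
  rw [mul_assoc]
  refine mul_le_mul_of_nonneg_left ?_ two_pos.le
  have hn : (0 : ℝ) ∉ Set.uIcc (0 + h) (π + h) := by
    rw [uIcc_of_le (by linarith [pi_pos])]
    exact fun hx => absurd hx.1 (by linarith)
  rw [intervalIntegral.integral_comp_add_right (fun s => s ^ (a - 2)) h,
    integral_rpow (Or.inr ⟨by linarith, hn⟩)]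
  have e : a - 2 + 1 = -(1 - a) := by ring
  have e2 : a - 1 = -(1 - a) := by ring
  have hp : 0 ≤ (π + h) ^ (-(1 - a)) := by positivity
  have h5 : (0 : ℝ) < 1 - a := by linarith
  rw [e, e2, zero_add, div_neg, ← neg_div, neg_sub, one_div, inv_mul_eq_div]
  gcongr
  linarith

/-- Average of two lower bounds: the distance to 1, at least 2|s|/π by Jordan's inequality, and the
radial distance h ≥ 2h/π. Moving the pole from 1 outwards to 1 + h only increases the distance to
points of the circle. -/
theorem norm_exp_sub_ge {s h : ℝ} (hs : |s| ≤ π) (hh : 0 ≤ h) :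
    (|s| + h) / π ≤ ‖Complex.exp (Complex.I * s) - (1 + h : ℝ)‖ := by
  have h1 : 2 * |s| / π ≤ ‖Complex.exp (Complex.I * s) - 1‖ := by
    rw [Complex.norm_exp_I_mul_ofReal_sub_one, norm_mul, Real.norm_eq_abs, Real.norm_eq_abs,
      abs_two]
    have h2 : |sin (s / 2)| = sin (|s| / 2) := by
      rcases abs_cases s with ⟨h3, h4⟩ | ⟨h3, h4⟩
      · rw [h3] at hs ⊢
        exact abs_of_nonneg (sin_nonneg_of_nonneg_of_le_pi (by linarith) (by linarith))
      · rw [h3] at hs ⊢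
        rw [neg_div, sin_neg]
        exact abs_of_nonpos (sin_nonpos_of_nonpos_of_neg_pi_le (by linarith) (by linarith))
    have h3 := mul_le_sin (x := |s| / 2) (by positivity) (by linarith)
    rw [h2]
    calc 2 * |s| / π = 2 * (2 / π * (|s| / 2)) := by ring
      _ ≤ _ := by gcongr
  have hexp : Complex.exp (Complex.I * s) = ⟨cos s, sin s⟩ := by
    rw [mul_comm, Complex.exp_mul_I]
    apply Complex.ext <;> simp [Complex.cos_ofReal_re, Complex.sin_ofReal_re,
      Complex.cos_ofReal_im, Complex.sin_ofReal_im]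
  have h2 : ‖Complex.exp (Complex.I * s) - 1‖ ≤ ‖Complex.exp (Complex.I * s) - (1 + h : ℝ)‖ := by
    refine (sq_le_sq₀ (norm_nonneg _) (norm_nonneg _)).1 ?_
    rw [← Complex.normSq_eq_norm_sq, ← Complex.normSq_eq_norm_sq, Complex.normSq_apply,
      Complex.normSq_apply, hexp]
    simp only [Complex.sub_re, Complex.sub_im, Complex.one_re, Complex.one_im, Complex.ofReal_re,
      Complex.ofReal_im]
    nlinarith [cos_le_one s, mul_nonneg hh (sub_nonneg.2 (cos_le_one s))]
  have h3 : h ≤ ‖Complex.exp (Complex.I * s) - (1 + h : ℝ)‖ := by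
    have := norm_sub_norm_le ((1 + h : ℝ) : ℂ) (Complex.exp (Complex.I * s))
    rw [Complex.norm_real, Real.norm_eq_abs, abs_of_nonneg (by linarith), mul_comm Complex.I,
      Complex.norm_exp_ofReal_mul_I, norm_sub_rev, mul_comm _ Complex.I] at this
    linarith
  have h4 : 2 * h / π ≤ h := by
    rw [div_le_iff₀ pi_pos]
    nlinarith [pi_gt_three]
  have : 2 * ((|s| + h) / π) = 2 * |s| / π + 2 * h / π := by ring
  linarith

/-- The Cauchy kernel `dσ / (σ - R τ)` for `σ = τ exp (i s)`, up to the factor `i ds`. -/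
def cauchyKer (R s : ℝ) : ℂ := Complex.exp (Complex.I * s) / (Complex.exp (Complex.I * s) - R)

theorem norm_cauchyKer_le {s h : ℝ} (hs : |s| ≤ π) (hh : 0 ≤ h) (h0 : 0 < |s| + h) :
    ‖cauchyKer (1 + h) s‖ ≤ π * (|s| + h)⁻¹ := by
  rw [cauchyKer, norm_div, mul_comm Complex.I, Complex.norm_exp_ofReal_mul_I,
    mul_comm _ Complex.I, ← div_eq_mul_inv, div_le_div_iff₀ _ h0, one_mul]
  · have := norm_exp_sub_ge hs hh
    rw [div_le_iff₀ pi_pos] at this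
    linarith
  · exact lt_of_lt_of_le (by positivity) (norm_exp_sub_ge hs hh)

theorem norm_cauchyKer_one_le {s : ℝ} (hs : |s| ≤ π) (h0 : s ≠ 0) :
    ‖cauchyKer 1 s‖ ≤ π * |s|⁻¹ := by
  simpa using norm_cauchyKer_le hs le_rfl (by simpa using h0)

@[fun_prop]
theorem measurable_cauchyKer (R : ℝ) : Measurable (cauchyKer R) := by
  unfold cauchyKer
  fun_prop

/-- Over a common denominator the difference is exp(is) · h divided by the product of the two
distances, each bounded below by `norm_exp_sub_ge`. -/
theorem norm_cauchyKer_sub_le {s h : ℝ} (hs : |s| ≤ π) (hh : 0 ≤ h) (h0 : s ≠ 0) :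
    ‖cauchyKer (1 + h) s - cauchyKer 1 s‖ ≤ π ^ 2 * (|s|⁻¹ * (h / (|s| + h))) := by
  have hs0 : 0 < |s| := abs_pos.2 h0
  have n1 := norm_exp_sub_ge hs hh
  have n2 := norm_exp_sub_ge hs le_rfl
  have p1 : 0 < ‖Complex.exp (Complex.I * s) - (1 + h : ℝ)‖ := lt_of_lt_of_le (by positivity) n1
  have p2 : 0 < ‖Complex.exp (Complex.I * s) - (1 + 0 : ℝ)‖ := lt_of_lt_of_le (by positivity) n2
  have z1 := norm_pos_iff.1 p1
  have z2 := norm_pos_iff.1 p2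
  have e : cauchyKer (1 + h) s - cauchyKer 1 s = Complex.exp (Complex.I * s) * h /
      ((Complex.exp (Complex.I * s) - (1 + h : ℝ)) *
          (Complex.exp (Complex.I * s) - (1 + 0 : ℝ))) := by
    unfold cauchyKer
    rw [show ((1 : ℝ) : ℂ) = ((1 + 0 : ℝ) : ℂ) by simp, div_sub_div _ _ z1 z2]
    congr 1
    push_cast
    ring
  rw [e, norm_div, norm_mul, norm_mul, mul_comm Complex.I, Complex.norm_exp_ofReal_mul_I,
    mul_comm _ Complex.I, one_mul, Complex.norm_real, Real.norm_eq_abs, abs_of_nonneg hh]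
  have e2 : π ^ 2 * (|s|⁻¹ * (h / (|s| + h))) = h / (((|s| + h) / π) * ((|s| + 0) / π)) := by
    field_simp
    ring
  rw [e2]
  gcongr

/-- The Cauchy integral `(2πi)⁻¹ ∫ (g(σ) - g(τ)) / (σ - R τ) dσ` at `τ = exp (iθ)`, in terms of
the angle. -/
def cauchyS (R : ℝ) (g : ℝ → ℂ) (θ : ℝ) : ℂ :=
  (2 * π : ℂ)⁻¹ * ∫ s in -π..π, (g (θ + s) - g θ) * cauchyKer R s

theorem norm_two_pi_inv : ‖(2 * π : ℂ)⁻¹‖ = (2 * π)⁻¹ := by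
  rw [norm_inv, norm_mul, Complex.norm_real, Real.norm_eq_abs, abs_of_pos pi_pos]
  simp

theorem ae_ne_zero_restrict : ∀ᵐ s : ℝ, s ≠ 0 := by
  rw [ae_iff]
  simp

theorem abs_le_pi_of_mem {s : ℝ} (hs : s ∈ Ioc (-π) π) : |s| ≤ π := abs_le.2 ⟨hs.1.le, hs.2⟩

theorem abs_rpow_mul_inv {s : ℝ} (hs : s ≠ 0) : |s| ^ a * |s|⁻¹ = |s| ^ (a - 1) := by
  rw [rpow_sub_one (abs_pos.2 hs).ne', div_eq_mul_inv]

theorem intervalIntegrable_cauchyS_one (ha : 0 < a) {g : ℝ → ℂ} (hg : Continuous g) {C θ : ℝ}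
    (hC : ∀ s, |s| ≤ π → ‖g (θ + s) - g θ‖ ≤ C * |s| ^ a) :
    IntervalIntegrable (fun s => (g (θ + s) - g θ) * cauchyKer 1 s) volume (-π) π := by
  refine ((integral_abs_rpow_sub_one ha).1.const_mul (C * π)).mono_fun' ?_ ?_
  · exact ((by fun_prop : Measurable fun s => g (θ + s) - g θ).mul
      (measurable_cauchyKer 1)).aestronglyMeasurable
  · rw [uIoc_of_le (by linarith [pi_pos])]
    filter_upwards [ae_restrict_mem measurableSet_Ioc, ae_restrict_of_ae ae_ne_zero_restrict]
      with s hs hs0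
    have hs' := abs_le_pi_of_mem hs
    rw [norm_mul, ← abs_rpow_mul_inv hs0]
    calc ‖g (θ + s) - g θ‖ * ‖cauchyKer 1 s‖ ≤ (C * |s| ^ a) * (π * |s|⁻¹) :=
          mul_le_mul (hC s hs') (norm_cauchyKer_one_le hs' hs0) (norm_nonneg _)
            ((norm_nonneg _).trans (hC s hs'))
      _ = _ := by ring

theorem norm_cauchyS_one_le (ha : 0 < a) {g : ℝ → ℂ} {C θ : ℝ}
    (hC : ∀ s, |s| ≤ π → ‖g (θ + s) - g θ‖ ≤ C * |s| ^ a) :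
    ‖cauchyS 1 g θ‖ ≤ C * (π ^ a / a) := by
  have h1 : ‖∫ s in -π..π, (g (θ + s) - g θ) * cauchyKer 1 s‖
      ≤ ∫ s in -π..π, (C * π) * |s| ^ (a - 1) := by
    refine intervalIntegral.norm_integral_le_of_norm_le (by linarith [pi_pos]) ?_
      ((integral_abs_rpow_sub_one ha).1.const_mul (C * π))
    filter_upwards [ae_ne_zero_restrict] with s hs0 hs
    have hs' := abs_le_pi_of_mem hs
    rw [norm_mul, ← abs_rpow_mul_inv hs0]
    calc ‖g (θ + s) - g θ‖ * ‖cauchyKer 1 s‖ ≤ (C * |s| ^ a) * (π * |s|⁻¹) :=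
          mul_le_mul (hC s hs') (norm_cauchyKer_one_le hs' hs0) (norm_nonneg _)
            ((norm_nonneg _).trans (hC s hs'))
      _ = _ := by ring
  rw [intervalIntegral.integral_const_mul, (integral_abs_rpow_sub_one ha).2] at h1
  rw [cauchyS, norm_mul, norm_two_pi_inv]
  calc (2 * π)⁻¹ * ‖∫ s in -π..π, (g (θ + s) - g θ) * cauchyKer 1 s‖
      ≤ (2 * π)⁻¹ * (C * π * (2 * (π ^ a / a))) := by gcongr
    _ = C * (π ^ a / a) := by field_simp

theorem continuous_cauchyKer {h : ℝ} (hh : 0 < h) : Continuous (cauchyKer (1 + h)) := by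
  unfold cauchyKer
  refine Continuous.div (by fun_prop) (by fun_prop) fun s hs => ?_
  rw [sub_eq_zero] at hs
  have h1 := congrArg norm hs
  rw [mul_comm, Complex.norm_exp_ofReal_mul_I, Complex.norm_real, Real.norm_eq_abs,
    abs_of_pos (by linarith)] at h1
  linarith

/-- Convergence from the exterior to the singular integral at a rate uniform in θ: the factor |s|^a
of the density turns the kernel difference into the weight of `integral_weight_le`. It serves both
the Privalov theorem and the approximation of traces from smaller circles. -/
theorem norm_cauchyS_sub_le (ha0 : 0 < a) (ha1 : a < 1) {g : ℝ → ℂ} (hg : Continuous g) {C θ : ℝ}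
    (hC : ∀ s, |s| ≤ π → ‖g (θ + s) - g θ‖ ≤ C * |s| ^ a) {h : ℝ} (hh : 0 < h) (hh1 : h ≤ 1) :
    ‖cauchyS (1 + h) g θ - cauchyS 1 g θ‖ ≤ C * (π * (1 / a + 1 / (1 - a))) * h ^ a := by
  have hC0 : 0 ≤ C := by
    have := (norm_nonneg _).trans (hC π (abs_of_pos pi_pos).le)
    exact nonneg_of_mul_nonneg_left this (by positivity)
  have i1 : IntervalIntegrable (fun s => (g (θ + s) - g θ) * cauchyKer (1 + h) s) volume (-π) π :=
    ((by fun_prop : Continuous fun s => g (θ + s) - g θ).mul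
      (continuous_cauchyKer hh)).intervalIntegrable _ _
  have h1 : ‖∫ s in -π..π, ((g (θ + s) - g θ) * cauchyKer (1 + h) s
        - (g (θ + s) - g θ) * cauchyKer 1 s)‖
      ≤ ∫ s in -π..π, (C * π ^ 2) * (|s| ^ (a - 1) * (h / (|s| + h))) := by
    refine intervalIntegral.norm_integral_le_of_norm_le (by linarith [pi_pos]) ?_
      ((integral_weight_le ha0 ha1 hh hh1).1.const_mul _)
    filter_upwards [ae_ne_zero_restrict] with s hs0 hs
    have hs' := abs_le_pi_of_mem hs
    rw [← mul_sub, norm_mul, ← abs_rpow_mul_inv hs0]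
    calc ‖g (θ + s) - g θ‖ * ‖cauchyKer (1 + h) s - cauchyKer 1 s‖
        ≤ (C * |s| ^ a) * (π ^ 2 * (|s|⁻¹ * (h / (|s| + h)))) :=
          mul_le_mul (hC s hs') (norm_cauchyKer_sub_le hs' hh.le hs0) (norm_nonneg _)
            ((norm_nonneg _).trans (hC s hs'))
      _ = _ := by ring
  rw [intervalIntegral.integral_const_mul,
    intervalIntegral.integral_sub i1 (intervalIntegrable_cauchyS_one ha0 hg hC)] at h1
  rw [cauchyS, cauchyS, ← mul_sub, norm_mul, norm_two_pi_inv]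
  calc _ ≤ (2 * π)⁻¹ * (C * π ^ 2 * (2 * (1 / a + 1 / (1 - a)) * h ^ a)) := by
        refine mul_le_mul_of_nonneg_left (h1.trans ?_) (by positivity)
        exact mul_le_mul_of_nonneg_left (integral_weight_le ha0 ha1 hh hh1).2 (by positivity)
    _ = _ := by field_simp

end CauchyIntegral

end HollowVortex

end

open scoped NNReal

noncomputable section

namespace HollowVortex

/-! ### Hölder regularity of the Cauchy singular integral -/

section Privalov

open Real Set MeasureTheory Function

variable {a : ℝ} {k : ℕ}

theorem contourInt_coe (H : ℂ → ℂ) : contourInt (fun σ => H σ) = ∮ z in C(0, 1), H z := by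
  rw [contourInt, circleIntegral]
  refine intervalIntegral.integral_congr fun θ _ => ?_
  simp [circleMap, Circle.coe_exp]
  ring

theorem periodic_cauchyKer (R : ℝ) : Periodic (cauchyKer R) (2 * π) := by
  intro s
  have : Complex.exp (Complex.I * ((s + 2 * π : ℝ) : ℂ)) = Complex.exp (Complex.I * s) := by
    rw [← Complex.exp_periodic (Complex.I * s)]
    congr 1
    push_cast
    ring
  unfold cauchyKer
  rw [this]

theorem integral_neg_pi_pi_of_periodic {E : Type*} [NormedAddCommGroup E] [NormedSpace ℝ E]
    {g : ℝ → E} (hp : Periodic g (2 * π)) (t : ℝ) :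
    ∫ s in -π..π, g (t + s) = ∫ s in (0 : ℝ)..(2 * π), g s := by
  rw [intervalIntegral.integral_comp_add_left]
  have := hp.intervalIntegral_add_eq (t + -π) 0
  rw [zero_add] at this
  rw [← this]
  congr 1
  ring

/-- Cauchy's theorem: the pole 1 + h lies outside the closed unit disc. -/
theorem integral_cauchyKer {h : ℝ} (hh : 0 < h) : ∫ s in -π..π, cauchyKer (1 + h) s = 0 := by
  have h1 := integral_neg_pi_pi_of_periodic (periodic_cauchyKer (1 + h)) 0
  simp only [zero_add] at h1
  rw [h1]
  have h2 : ∮ z in C(0, 1), (z - ((1 + h : ℝ) : ℂ))⁻¹ = 0 := by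
    refine Complex.circleIntegral_eq_zero_of_differentiable_on_off_countable zero_le_one
      countable_empty (f := fun z => (z - ((1 + h : ℝ) : ℂ))⁻¹) ?_ ?_
    · refine ContinuousOn.inv₀ (by fun_prop) fun z hz h0 => ?_
      rw [mem_closedBall_zero_iff, sub_eq_zero.1 h0, Complex.norm_real, Real.norm_eq_abs,
        abs_of_pos (by linarith)] at hz
      linarith
    · intro z hz
      refine DifferentiableAt.inv (by fun_prop) fun h0 => ?_
      have hz1 := hz.1
      rw [mem_ball_zero_iff, sub_eq_zero.1 h0, Complex.norm_real, Real.norm_eq_abs,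
        abs_of_pos (by linarith)] at hz1
      linarith
  rw [← contourInt_coe, contourInt] at h2
  have h3 : ∀ θ : ℝ, ((Circle.exp θ : ℂ) - ((1 + h : ℝ) : ℂ))⁻¹ * (Complex.I * (Circle.exp θ : ℂ))
      = Complex.I * cauchyKer (1 + h) θ := by
    intro θ
    rw [cauchyKer, Circle.coe_exp, mul_comm (θ : ℂ)]
    ring
  simp only [h3] at h2
  rw [intervalIntegral.integral_const_mul] at h2
  exact (mul_eq_zero.1 h2).resolve_left Complex.I_ne_zero

/-- Since the kernel off the circle has mean zero, the value subtracted from g may be any constant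
c, and periodicity allows the variable s to be recentred. Thus the integrals at two points can be
written with the same numerator. -/
theorem cauchyS_eq_shift {g : ℝ → ℂ} (hp : Periodic g (2 * π)) (hg : Continuous g) {h : ℝ}
    (hh : 0 < h) (c : ℂ) (θ d : ℝ) :
    cauchyS (1 + h) g θ
      = (2 * π : ℂ)⁻¹ * ∫ s in -π..π, (g (θ + d + s) - c) * cauchyKer (1 + h) (s + d) := by
  have hk := continuous_cauchyKer hh
  have h1 : ∫ s in -π..π, (g (θ + s) - g θ) * cauchyKer (1 + h) s
      = ∫ s in -π..π, (g (θ + s) - c) * cauchyKer (1 + h) s := by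
    have : ∀ s, (g (θ + s) - g θ) * cauchyKer (1 + h) s
        = (g (θ + s) - c) * cauchyKer (1 + h) s - (g θ - c) * cauchyKer (1 + h) s :=
      fun s => by ring
    simp only [this]
    rw [intervalIntegral.integral_sub, intervalIntegral.integral_const_mul, integral_cauchyKer hh,
      mul_zero, sub_zero]
    · exact (Continuous.mul (by fun_prop) hk).intervalIntegrable _ _
    · exact (Continuous.mul (by fun_prop) hk).intervalIntegrable _ _
  have hq : Periodic (fun s => (g (θ + s) - c) * cauchyKer (1 + h) s) (2 * π) := by
    intro s
    simp only [← add_assoc, hp (θ + s), periodic_cauchyKer (1 + h) s]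
  rw [cauchyS, h1]
  congr 1
  have e1 := integral_neg_pi_pi_of_periodic hq 0
  have e2 := integral_neg_pi_pi_of_periodic hq d
  simp only [zero_add] at e1
  rw [e1, ← e2]
  refine intervalIntegral.integral_congr fun s _ => ?_
  simp only [add_assoc, add_comm d s]

theorem norm_exp_sub_exp_le (s d : ℝ) :
    ‖Complex.exp (Complex.I * (s + d : ℝ)) - Complex.exp (Complex.I * s)‖ ≤ |d| := by
  have : Complex.exp (Complex.I * (s + d : ℝ)) - Complex.exp (Complex.I * s)
      = Complex.exp (Complex.I * s) * (Complex.exp (Complex.I * d) - 1) := by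
    push_cast
    rw [mul_add, Complex.exp_add]
    ring
  rw [this, norm_mul, mul_comm Complex.I (s : ℂ), Complex.norm_exp_ofReal_mul_I, one_mul]
  exact Real.norm_exp_I_mul_ofReal_sub_one_le

theorem norm_cauchyKer_shift_sub_le {s d h : ℝ} (hs : |s| ≤ π) (hh : 0 < h) (hh1 : h ≤ 1)
    (hd : |d| ≤ h) :
    ‖cauchyKer (1 + h) s - cauchyKer (1 + h) (s + d)‖ ≤ 4 * π ^ 2 * h * ((|s| + h)⁻¹ ^ 2) := by
  have n1 := norm_exp_sub_ge hs hh.le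
  have n3 := norm_exp_sub_exp_le s d
  set w := Complex.exp (Complex.I * s) with hw
  set w' := Complex.exp (Complex.I * (s + d : ℝ)) with hw'
  have n2 : h ≤ ‖w' - (1 + h : ℝ)‖ := by
    have := norm_sub_norm_le ((1 + h : ℝ) : ℂ) w'
    rw [Complex.norm_real, Real.norm_eq_abs, abs_of_nonneg (by linarith), hw', mul_comm Complex.I,
      Complex.norm_exp_ofReal_mul_I, norm_sub_rev, mul_comm _ Complex.I] at this
    linarith
  have p1 : 0 < ‖w - (1 + h : ℝ)‖ := lt_of_lt_of_le (by positivity) n1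
  have z1 := norm_pos_iff.1 p1
  have z2 := norm_pos_iff.1 (hh.trans_le n2)
  -- The shift moves w by at most h, which does not exceed the distance of w' from 1 + h; the two
  -- distances are therefore comparable.
  have n4 : ‖w - (1 + h : ℝ)‖ ≤ 2 * ‖w' - (1 + h : ℝ)‖ := by
    have : w - (1 + h : ℝ) = (w' - (1 + h : ℝ)) - (w' - w) := by ring
    rw [this]
    refine (norm_sub_le _ _).trans ?_
    linarith
  have e : cauchyKer (1 + h) s - cauchyKer (1 + h) (s + d)
      = ((1 + h : ℝ) : ℂ) * (w' - w) / ((w - (1 + h : ℝ)) * (w' - (1 + h : ℝ))) := by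
    unfold cauchyKer
    rw [← hw, ← hw', div_sub_div _ _ z1 z2]
    congr 1
    ring
  rw [e, norm_div, norm_mul, norm_mul, Complex.norm_real, Real.norm_eq_abs,
    abs_of_nonneg (by linarith)]
  have hp : 0 < (|s| + h) / π := by positivity
  calc (1 + h) * ‖w' - w‖ / (‖w - (1 + h : ℝ)‖ * ‖w' - (1 + h : ℝ)‖)
      ≤ 2 * h / ((|s| + h) / π * ((|s| + h) / π / 2)) := by
        gcongr
        · linarith
        · linarith
        · linarith
    _ = _ := by field_simp; ring

/-- With the common numerator g(x + s) − g(x) only the kernels differ. The integrand is bounded by a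
multiple of h (|s| + h)^(a − 2), whose integral is of order h^a. -/
theorem norm_cauchyS_shift_sub_le (ha0 : 0 < a) (ha1 : a < 1) {g : ℝ → ℂ}
    (hp : Periodic g (2 * π)) {C : ℝ} (hC : ∀ x y, ‖g x - g y‖ ≤ C * |x - y| ^ a) {h : ℝ}
    (hh : 0 < h) (hh1 : h ≤ 1) {x y : ℝ} (hxy : |x - y| ≤ h) :
    ‖cauchyS (1 + h) g x - cauchyS (1 + h) g y‖ ≤ C * (4 * π / (1 - a)) * h ^ a := by
  have hg : Continuous g := IsHolder.continuous ha0 ⟨C, hC⟩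
  have hC0 : 0 ≤ C := by simpa using (norm_nonneg _).trans (hC 1 0)
  have hk := continuous_cauchyKer hh
  have e1 := cauchyS_eq_shift hp hg hh (g x) x 0
  have e2 := cauchyS_eq_shift hp hg hh (g x) y (x - y)
  rw [show y + (x - y) = x by ring] at e2
  simp only [add_zero] at e1
  have i1 : IntervalIntegrable (fun s => (g (x + s) - g x) * cauchyKer (1 + h) s) volume (-π) π :=
    (Continuous.mul (by fun_prop) hk).intervalIntegrable _ _
  have i2 : IntervalIntegrable (fun s => (g (x + s) - g x) * cauchyKer (1 + h) (s + (x - y)))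
      volume (-π) π := (Continuous.mul (by fun_prop) (by fun_prop)).intervalIntegrable _ _
  have h1 : ‖∫ s in -π..π, ((g (x + s) - g x) * cauchyKer (1 + h) s
        - (g (x + s) - g x) * cauchyKer (1 + h) (s + (x - y)))‖
      ≤ ∫ s in -π..π, (C * (4 * π ^ 2 * h)) * (|s| + h) ^ (a - 2) := by
    refine intervalIntegral.norm_integral_le_of_norm_le (by linarith [pi_pos])
      (Filter.Eventually.of_forall fun s hs => ?_)
      ((integral_shifted_rpow_le ha1 hh).1.const_mul _)
    have hs' := abs_le_pi_of_mem hs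
    have hsh : 0 < |s| + h := by positivity
    rw [← mul_sub, norm_mul]
    have h2 : ‖g (x + s) - g x‖ ≤ C * (|s| + h) ^ a := by
      refine (hC _ _).trans ?_
      rw [add_sub_cancel_left]
      gcongr
      linarith
    calc ‖g (x + s) - g x‖ * ‖cauchyKer (1 + h) s - cauchyKer (1 + h) (s + (x - y))‖
        ≤ (C * (|s| + h) ^ a) * (4 * π ^ 2 * h * ((|s| + h)⁻¹ ^ 2)) :=
          mul_le_mul h2 (norm_cauchyKer_shift_sub_le hs' hh hh1 hxy) (norm_nonneg _)
            (by positivity)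
      _ = C * (4 * π ^ 2 * h) * ((|s| + h) ^ a / (|s| + h) ^ 2) := by
          rw [div_eq_mul_inv, inv_pow]; ring
      _ = _ := by rw [rpow_sub hsh, rpow_two]
  rw [intervalIntegral.integral_const_mul, intervalIntegral.integral_sub i1 i2] at h1
  rw [e1, e2, ← mul_sub, norm_mul, norm_two_pi_inv]
  have h4 : h * h ^ (a - 1) = h ^ a := by
    nth_rewrite 1 [← rpow_one h]
    rw [← rpow_add hh]; ring_nf
  have h5 : (0 : ℝ) < 1 - a := by linarith
  calc _ ≤ (2 * π)⁻¹ * (C * (4 * π ^ 2 * h) * (2 * (1 / (1 - a)) * h ^ (a - 1))) := by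
        refine mul_le_mul_of_nonneg_left (h1.trans ?_) (by positivity)
        exact mul_le_mul_of_nonneg_left (integral_shifted_rpow_le ha1 hh).2 (by positivity)
    _ = C * (4 * π / (1 - a)) * (h * h ^ (a - 1)) := by field_simp
    _ = _ := by rw [h4]

theorem periodic_cauchyS (R : ℝ) {g : ℝ → ℂ} (hp : Periodic g (2 * π)) :
    Periodic (cauchyS R g) (2 * π) := by
  intro θ
  unfold cauchyS
  simp only [hp θ, add_right_comm θ (2 * π), hp (θ + _)]

/-- The theorem of Plemelj and Privalov for the Cauchy singular integral. -/
theorem isHolder_cauchyS (ha0 : 0 < a) (ha1 : a < 1) {g : ℝ → ℂ} (hp : Periodic g (2 * π))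
    (hg : IsHolder a g) : IsHolder a (cauchyS 1 g) := by
  obtain ⟨C, hC0, hC⟩ := hg.exists_nonneg
  have hc := hg.continuous ha0
  have h5 : (0 : ℝ) < 1 - a := by linarith
  have hC' : ∀ θ s, |s| ≤ π → ‖g (θ + s) - g θ‖ ≤ C * |s| ^ a := fun θ s _ => by
    simpa using hC (θ + s) θ
  refine ⟨C * (π * (1 / a + 1 / (1 - a))) + C * (4 * π / (1 - a))
    + C * (π * (1 / a + 1 / (1 - a))) + 2 * (C * (π ^ a / a)), fun x y => ?_⟩
  rcases eq_or_ne x y with rfl | hxy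
  · simp only [sub_self, norm_zero]
    positivity
  have hh : 0 < |x - y| := abs_pos.2 (sub_ne_zero.2 hxy)
  have hn : 0 ≤ |x - y| ^ a := by positivity
  have hP : 0 ≤ C * (π ^ a / a) := by positivity
  have hQ : 0 ≤ C * (π * (1 / a + 1 / (1 - a))) := by positivity
  have hQ' : 0 ≤ C * (4 * π / (1 - a)) := by positivity
  rcases le_total |x - y| 1 with h1 | h1
  -- Both points are moved out to radius 1 + |x − y|: the radial moves and the comparison at that
  -- radius each cost a multiple of |x − y|^a.
  · have b1 := norm_cauchyS_sub_le ha0 ha1 hc (hC' x) hh h1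
    have b2 := norm_cauchyS_sub_le ha0 ha1 hc (hC' y) hh h1
    have b3 := norm_cauchyS_shift_sub_le ha0 ha1 hp hC hh h1 le_rfl
    have e : cauchyS 1 g x - cauchyS 1 g y
        = -(cauchyS (1 + |x - y|) g x - cauchyS 1 g x)
          + (cauchyS (1 + |x - y|) g x - cauchyS (1 + |x - y|) g y)
          + (cauchyS (1 + |x - y|) g y - cauchyS 1 g y) := by ring
    rw [e]
    refine (norm_add₃_le).trans ?_
    rw [norm_neg]
    calc _ ≤ _ := add_le_add (add_le_add b1 b3) b2
      _ = (C * (π * (1 / a + 1 / (1 - a))) + C * (4 * π / (1 - a))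
            + C * (π * (1 / a + 1 / (1 - a)))) * |x - y| ^ a := by ring
      _ ≤ _ := mul_le_mul_of_nonneg_right (by linarith) hn
  -- For distant points the uniform bound of the singular integral suffices.
  · have b1 := norm_cauchyS_one_le ha0 (hC' x)
    have b2 := norm_cauchyS_one_le ha0 (hC' y)
    have h2 : 1 ≤ |x - y| ^ a := one_le_rpow h1 ha0.le
    calc ‖cauchyS 1 g x - cauchyS 1 g y‖ ≤ 2 * (C * (π ^ a / a)) * 1 := by
          refine (norm_sub_le _ _).trans ?_
          linarith
      _ ≤ _ := mul_le_mul (by linarith) h2 zero_le_one (by linarith)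

/-- The kernel depends on s alone, so differentiation in θ falls on the density; the Hölder bound of
the derivative supplies the integrable majorant |s|^(a − 1). -/
theorem hasDerivAt_cauchyS (ha0 : 0 < a) (ha1 : a ≤ 1) {g : ℝ → ℂ} (hp : Periodic g (2 * π))
    (hd : Differentiable ℝ g) (hg : IsHolder a (deriv g)) (θ : ℝ) :
    HasDerivAt (cauchyS 1 g) (cauchyS 1 (deriv g) θ) θ := by
  obtain ⟨C, hC0, hC⟩ := hg.exists_nonneg
  have hc' := hg.continuous ha0
  obtain ⟨C', hC'⟩ := isHolder_of_periodic_deriv ha0 ha1 hp hd hc'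
  have hc := hd.continuous
  have key := intervalIntegral.hasDerivAt_integral_of_dominated_loc_of_deriv_le
    (μ := volume) (a := -π) (b := π) (s := univ) (x₀ := θ)
    (F := fun x s => (g (x + s) - g x) * cauchyKer 1 s)
    (F' := fun x s => (deriv g (x + s) - deriv g x) * cauchyKer 1 s)
    (bound := fun s => C * π * |s| ^ (a - 1)) Filter.univ_mem
    (Filter.Eventually.of_forall fun x => ((by fun_prop : Measurable fun s => g (x + s) - g x).mul
      (measurable_cauchyKer 1)).aestronglyMeasurable)
    (intervalIntegrable_cauchyS_one ha0 hc fun s _ => by simpa using hC' (θ + s) θ)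
    ((by fun_prop : Measurable fun s => deriv g (θ + s) - deriv g θ).mul
      (measurable_cauchyKer 1)).aestronglyMeasurable
    (by
      filter_upwards [ae_ne_zero_restrict] with s hs0 hs x _
      rw [uIoc_of_le (by linarith [pi_pos])] at hs
      have hs' := abs_le_pi_of_mem hs
      rw [norm_mul, ← abs_rpow_mul_inv hs0]
      have h1 : ‖deriv g (x + s) - deriv g x‖ ≤ C * |s| ^ a := by simpa using hC (x + s) x
      calc ‖deriv g (x + s) - deriv g x‖ * ‖cauchyKer 1 s‖ ≤ (C * |s| ^ a) * (π * |s|⁻¹) :=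
            mul_le_mul h1 (norm_cauchyKer_one_le hs' hs0) (norm_nonneg _) (by positivity)
        _ = _ := by ring)
    ((integral_abs_rpow_sub_one ha0).1.const_mul _)
    (Filter.Eventually.of_forall fun s _ x _ =>
      (((hd (x + s)).hasDerivAt.comp_add_const x s).sub (hd x).hasDerivAt).mul_const _)
  exact key.2.const_mul _

theorem CHolder.cauchyS (ha0 : 0 < a) (ha1 : a < 1) {g : ℝ → ℂ} (hg : CHolder a k g) :
    CHolder a k (cauchyS 1 g) := by
  induction k generalizing g with
  | zero => exact ⟨periodic_cauchyS 1 hg.1, isHolder_cauchyS ha0 ha1 hg.1 hg.2⟩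
  | succ k ih =>
    have h := hasDerivAt_cauchyS ha0 ha1.le hg.1 hg.2.1 (hg.2.2.isHolder ha0 ha1.le)
    refine ⟨periodic_cauchyS 1 hg.1, fun θ => (h θ).differentiableAt, ?_⟩
    rw [show deriv (HollowVortex.cauchyS 1 g) = HollowVortex.cauchyS 1 (deriv g) from
      funext fun θ => (h θ).deriv]
    exact ih hg.2.2

end Privalov

end HollowVortex

end

open scoped NNReal

noncomputable section

namespace HollowVortex

/-! ### Traces of layer potentials -/

section Traces

open Real Set MeasureTheory Function

variable {a : ℝ} {k : ℕ}

theorem exp_periodic {E : Type*} (h : Circle → E) :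
    Periodic (fun θ : ℝ => h (Circle.exp θ)) (2 * π) := fun θ => by simp

theorem exp_surjective : Surjective Circle.exp := fun τ => ⟨_, Circle.exp_arg τ⟩

theorem continuous_of_comp_exp {E : Type*} [TopologicalSpace E] {h : Circle → E}
    (hc : Continuous fun θ : ℝ => h (Circle.exp θ)) : Continuous h :=
  (Circle.isCoveringMap_exp.isQuotientMap exp_surjective).continuous_iff.2 hc

theorem contourInt_eq_shift (h : Circle → ℂ) (θ : ℝ) :
    contourInt h = ∫ s in -π..π, h (Circle.exp (θ + s)) *
      (Complex.I * (Circle.exp (θ + s) : ℂ)) :=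
  (integral_neg_pi_pi_of_periodic
    (exp_periodic fun τ => h τ * (Complex.I * (τ : ℂ))) θ).symm

theorem coe_exp_add (θ s : ℝ) :
    (Circle.exp (θ + s) : ℂ) = Circle.exp θ * Complex.exp (Complex.I * s) := by
  rw [Circle.exp_add, Circle.coe_mul, Circle.coe_exp s, mul_comm (s : ℂ)]

/-- Under σ = τ exp(is) the factor τ cancels between dσ and the denominator. -/
theorem selfTerm_eq_cauchyS (m : Circle → ℂ) (R θ : ℝ) :
    (2 * π * Complex.I)⁻¹ * contourInt (fun σ => (m σ - m (Circle.exp θ)) /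
      ((σ : ℂ) - R * Circle.exp θ)) = cauchyS R (fun t => m (Circle.exp t)) θ := by
  rw [contourInt_eq_shift _ θ, cauchyS, mul_inv, mul_assoc, ← intervalIntegral.integral_const_mul]
  congr 1
  refine intervalIntegral.integral_congr fun s _ => ?_
  have h0 : (Circle.exp θ : ℂ) ≠ 0 := Circle.coe_ne_zero _
  simp only [cauchyKer, coe_exp_add]
  have e : (Circle.exp θ : ℂ) * Complex.exp (Complex.I * s) - R * Circle.exp θ
      = Circle.exp θ * (Complex.exp (Complex.I * s) - R) := by ring
  rw [e]
  field_simp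

theorem cauchyKer_one_mul {s : ℝ} (hs : |s| ≤ π) (h0 : s ≠ 0) :
    (Complex.exp (Complex.I * s) - 1) * cauchyKer 1 s = Complex.exp (Complex.I * s) := by
  have h1 := norm_exp_sub_ge hs le_rfl
  have h2 : Complex.exp (Complex.I * s) - (1 + 0 : ℝ) ≠ 0 := by
    refine norm_pos_iff.1 (lt_of_lt_of_le ?_ h1)
    have := abs_pos.2 h0
    positivity
  simp only [add_zero, Complex.ofReal_one] at h2
  rw [cauchyKer, Complex.ofReal_one]
  field_simp

/-- Multiplication of the density by `σ` adds the mean of the density. -/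
theorem cauchyS_exp_mul (ha0 : 0 < a) {g : ℝ → ℂ} (hg : CHolder a 0 g) (θ : ℝ) :
    cauchyS 1 (fun t => Circle.exp t * g t) θ = Circle.exp θ * cauchyS 1 g θ
      + (2 * π : ℂ)⁻¹ * ∫ t in (0 : ℝ)..(2 * π), g t * Circle.exp t := by
  have hc := hg.continuous ha0
  obtain ⟨C, hC⟩ := hg.2
  have hp : Periodic (fun t => g t * Circle.exp t) (2 * π) := fun t => by simp [hg.1 t]
  rw [← integral_neg_pi_pi_of_periodic hp θ, cauchyS, cauchyS, mul_left_comm, ← mul_add]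
  congr 1
  have i1 := intervalIntegrable_cauchyS_one ha0 hc (θ := θ) fun s _ => by simpa using hC (θ + s) θ
  have i2 : IntervalIntegrable (fun s => g (θ + s) * (Circle.exp (θ + s) : ℂ)) volume (-π) π :=
    (by fun_prop : Continuous fun s => g (θ + s) * (Circle.exp (θ + s) : ℂ)).intervalIntegrable _ _
  rw [← intervalIntegral.integral_const_mul, ← intervalIntegral.integral_add (i1.const_mul _) i2]
  refine intervalIntegral.integral_congr_ae ?_
  filter_upwards [ae_ne_zero_restrict] with s hs0 hs
  rw [uIoc_of_le (by linarith [pi_pos])] at hs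
  have h1 := cauchyKer_one_mul (abs_le_pi_of_mem hs) hs0
  rw [coe_exp_add]
  linear_combination (Circle.exp θ : ℂ) * g (θ + s) * h1

theorem tDeriv_exp (φ : Circle → ℝ) (θ : ℝ) :
    tDeriv φ (Circle.exp θ) = ((deriv (lift φ) θ : ℝ) : ℂ) / (Complex.I * Circle.exp θ) := by
  have h := deriv_comp_const_add (lift φ) θ 0
  rw [add_zero] at h
  have e : (fun t : ℝ => φ (Circle.exp θ * Circle.exp t)) = fun t => lift φ (θ + t) := by
    funext t
    rw [lift, Circle.exp_add]
  rw [tDeriv, e, h]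

theorem contDiff_circleExp {n : WithTop ℕ∞} : ContDiff ℝ n fun θ : ℝ => (Circle.exp θ : ℂ) := by
  simp only [Circle.coe_exp]
  have h1 : ContDiff ℝ n Complex.ofReal := Complex.ofRealCLM.contDiff
  exact ((h1.mul contDiff_const)).cexp

theorem cHolder_exp (ha0 : 0 < a) (ha1 : a ≤ 1) : CHolder a k fun θ : ℝ => (Circle.exp θ : ℂ) :=
  CHolder.of_contDiff ha0 ha1 (exp_periodic _) contDiff_circleExp

theorem hasDerivAt_circleExp (θ : ℝ) :
    HasDerivAt (fun θ : ℝ => (Circle.exp θ : ℂ)) (Complex.I * Circle.exp θ) θ := by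
  simp only [Circle.coe_exp]
  have h1 : HasDerivAt (fun θ : ℝ => (θ : ℂ) * Complex.I) (1 * Complex.I) θ :=
    (Complex.ofRealCLM.hasDerivAt (x := θ)).mul_const _
  simpa [mul_comm] using h1.cexp

theorem cHolder_ofReal {g : ℝ → ℝ} (hg : CHolder a k g) : CHolder a k fun θ => (g θ : ℂ) :=
  hg.clm_comp Complex.ofRealCLM

theorem deriv_ofReal_comp {g : ℝ → ℝ} (hd : Differentiable ℝ g) (θ : ℝ) :
    HasDerivAt (fun t => (g t : ℂ)) ((deriv g θ : ℝ) : ℂ) θ :=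
  (hd θ).hasDerivAt.ofReal_comp

theorem cHolder_tDeriv (ha0 : 0 < a) (ha1 : a ≤ 1) {φ : Circle → ℝ}
    (hφ : CHolder a (k + 1) (lift φ)) : CHolder a k fun θ : ℝ => tDeriv φ (Circle.exp θ) := by
  simp only [tDeriv_exp, div_eq_mul_inv]
  exact (cHolder_ofReal hφ.2.2).mul ha0 ha1
    (((cHolder_exp ha0 ha1).const_mul ha0 ha1 Complex.I).inv ha0 ha1 fun θ =>
      mul_ne_zero Complex.I_ne_zero (Circle.coe_ne_zero _))

/-- The derivative of a density has no mean with respect to `dτ`. -/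
theorem contourInt_tDeriv (ha0 : 0 < a) {φ : Circle → ℝ} (hφ : CHolder a 1 (lift φ)) :
    contourInt (tDeriv φ) = 0 := by
  have h1 : ∀ θ : ℝ, tDeriv φ (Circle.exp θ) * (Complex.I * Circle.exp θ)
      = ((deriv (lift φ) θ : ℝ) : ℂ) := fun θ => by
    rw [tDeriv_exp, div_mul_cancel₀]
    exact mul_ne_zero Complex.I_ne_zero (Circle.coe_ne_zero _)
  simp only [contourInt, h1]
  have hc : Continuous fun θ => ((deriv (lift φ) θ : ℝ) : ℂ) :=
    Complex.continuous_ofReal.comp (hφ.2.2.continuous ha0)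
  rw [intervalIntegral.integral_eq_sub_of_hasDerivAt (fun θ _ => deriv_ofReal_comp hφ.2.1 θ)
    (hc.intervalIntegrable _ _)]
  have := lift_periodic φ 0
  rw [zero_add] at this
  rw [this, sub_self]

/-- The angular derivative of the density is iτφ'. Extracting the factor τ from the Cauchy integral
costs the mean ∫ φ' dτ, which is zero. -/
theorem hasDerivAt_cauchyS_density (ha0 : 0 < a) (ha1 : a < 1) {φ : Circle → ℝ}
    (hφ : CHolder a 1 (lift φ)) (θ : ℝ) :
    HasDerivAt (cauchyS 1 fun t => (φ (Circle.exp t) : ℂ))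
      (Complex.I * Circle.exp θ * cauchyS 1 (fun t => tDeriv φ (Circle.exp t)) θ) θ := by
  have hc := cHolder_ofReal hφ
  have hd : deriv (fun t => (lift φ t : ℂ)) = fun t => ((deriv (lift φ) t : ℝ) : ℂ) :=
    funext fun t => (deriv_ofReal_comp hφ.2.1 t).deriv
  have h := hasDerivAt_cauchyS ha0 ha1.le hc.1 hc.2.1 (hc.2.2.isHolder ha0 ha1.le) θ
  have hm := contourInt_tDeriv ha0 hφ
  have ht := cHolder_tDeriv ha0 ha1.le hφ
  have e := cauchyS_exp_mul ha0 (ht.const_mul ha0 ha1.le Complex.I) θ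
  have e1 : (fun t : ℝ => (Circle.exp t : ℂ) * (Complex.I * tDeriv φ (Circle.exp t)))
      = deriv (fun t => (lift φ t : ℂ)) := by
    rw [hd]
    funext t
    have h0 : (Circle.exp t : ℂ) ≠ 0 := Circle.coe_ne_zero _
    rw [tDeriv_exp]
    field_simp [Complex.I_ne_zero]
  have e2 : ∫ t in (0 : ℝ)..(2 * π), Complex.I * tDeriv φ (Circle.exp t) * Circle.exp t = 0 := by
    rw [← hm, contourInt]
    refine intervalIntegral.integral_congr fun t _ => ?_
    ring
  have e3 : cauchyS 1 (fun t => Complex.I * tDeriv φ (Circle.exp t)) θ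
      = Complex.I * cauchyS 1 (fun t => tDeriv φ (Circle.exp t)) θ := by
    simp only [cauchyS, ← mul_sub, mul_assoc]
    rw [intervalIntegral.integral_const_mul]
    ring
  rw [e1, e2, e3, mul_zero, add_zero] at e
  rw [e] at h
  convert! h using 1
  ring

/-! The contribution of the other circles. -/

/-- The layer potential at `z` of the density `m` on the circle with centre `b` and radius `ρ`. -/
def layerPot (ρ : ℝ) (b : ℂ) (m : Circle → ℂ) (z : ℂ) : ℂ :=
  (2 * π * Complex.I)⁻¹ * contourInt fun σ => m σ / (ρ * σ + b - z) * ρ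

theorem traceZ_eq (ρ : ℝ) {M : ℕ} (Λ : Params M) (m : Fin M → Circle → ℂ) (k : Fin M) (θ : ℝ) :
    traceZ ρ Λ m k (Circle.exp θ) = cauchyS 1 (fun t => m k (Circle.exp t)) θ
      + ∑ j ∈ Finset.univ.erase k,
          layerPot ρ (Λ.ctr j) (m j) (Λ.ctr k + ρ * Circle.exp θ) := by
  rw [traceZ, ← selfTerm_eq_cauchyS]
  simp only [Complex.ofReal_one, one_mul]
  congr 1
  refine Finset.sum_congr rfl fun j _ => ?_
  rw [layerPot]
  congr 2
  funext σ
  congr 2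
  ring

theorem sub_norm_le_denom (ρ : ℝ) (b z : ℂ) (σ : Circle) :
    ‖z - b‖ - |ρ| ≤ ‖ρ * (σ : ℂ) + b - z‖ := by
  have h := norm_sub_norm_le (z - b) (ρ * (σ : ℂ))
  rw [norm_mul, Circle.norm_coe, mul_one, Complex.norm_real, Real.norm_eq_abs] at h
  rw [← norm_neg (ρ * (σ : ℂ) + b - z), show -(ρ * (σ : ℂ) + b - z) = z - b - ρ * σ by ring]
  exact h

theorem denom_ne_zero {ρ : ℝ} {b z : ℂ} (hz : |ρ| < ‖z - b‖) (σ : Circle) :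
    ρ * (σ : ℂ) + b - z ≠ 0 :=
  norm_pos_iff.1 (lt_of_lt_of_le (sub_pos.2 hz) (sub_norm_le_denom ρ b z σ))

theorem hasDerivAt_layerPot {ρ : ℝ} {b z : ℂ} (hz : |ρ| < ‖z - b‖) {m : Circle → ℂ}
    (hm : Continuous m) : HasDerivAt (layerPot ρ b m)
      ((2 * π * Complex.I)⁻¹ * contourInt fun σ => m σ / (ρ * σ + b - z) ^ 2 * ρ) z := by
  -- A quarter of the gap: on the ball of radius ε about z the denominators stay at least ε.
  obtain ⟨ε, hε0, hε⟩ : ∃ ε > 0, |ρ| + 2 * ε < ‖z - b‖ :=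
    ⟨(‖z - b‖ - |ρ|) / 4, by linarith, by linarith⟩
  have hd : ∀ w ∈ Metric.ball z ε, ∀ σ : Circle, ε ≤ ‖ρ * (σ : ℂ) + b - w‖ := by
    intro w hw σ
    refine le_trans ?_ (sub_norm_le_denom ρ b w σ)
    have h1 := norm_sub_norm_le (z - b) (z - w)
    rw [show z - b - (z - w) = w - b by ring] at h1
    have h2 : ‖z - w‖ < ε := by rwa [← dist_eq_norm, dist_comm]
    linarith
  have hd0 : ∀ w ∈ Metric.ball z ε, ∀ σ : Circle, ρ * (σ : ℂ) + b - w ≠ 0 := fun w hw σ =>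
    norm_pos_iff.1 (hε0.trans_le (hd w hw σ))
  have hzm := Metric.mem_ball_self (x := z) hε0
  obtain ⟨B, hB0, hB⟩ := exists_norm_le_of_periodic (exp_periodic m)
    (hm.comp Circle.exp.continuous)
  have hcont : ∀ w ∈ Metric.ball z ε, Continuous fun t : ℝ =>
      m (Circle.exp t) / (ρ * Circle.exp t + b - w) * ρ * (Complex.I * (Circle.exp t : ℂ)) := by
    intro w hw
    refine Continuous.mul (Continuous.mul (Continuous.div (by fun_prop) (by fun_prop)
      fun t => hd0 w hw _) (by fun_prop)) (by fun_prop)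
  have hcont' : Continuous fun t : ℝ =>
      m (Circle.exp t) / (ρ * Circle.exp t + b - z) ^ 2 * ρ *
        (Complex.I * (Circle.exp t : ℂ)) := by
    refine Continuous.mul (Continuous.mul (Continuous.div (by fun_prop) (by fun_prop)
      fun t => pow_ne_zero 2 (hd0 z hzm _)) (by fun_prop)) (by fun_prop)
  have key := intervalIntegral.hasDerivAt_integral_of_dominated_loc_of_deriv_le
    (μ := volume) (a := 0) (b := 2 * π) (s := Metric.ball z ε) (x₀ := z)
    (F := fun w (t : ℝ) => m (Circle.exp t) / (ρ * Circle.exp t + b - w) * ρ *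
      (Complex.I * (Circle.exp t : ℂ)))
    (F' := fun w (t : ℝ) => m (Circle.exp t) / (ρ * Circle.exp t + b - w) ^ 2 * ρ *
      (Complex.I * (Circle.exp t : ℂ)))
    (bound := fun _ => B / ε ^ 2 * |ρ|) (Metric.ball_mem_nhds z hε0)
    (by
      filter_upwards [Metric.ball_mem_nhds z hε0] with w hw
      exact (hcont w hw).aestronglyMeasurable)
    ((hcont z hzm).intervalIntegrable _ _) hcont'.aestronglyMeasurable
    (Filter.Eventually.of_forall fun t _ w hw => by
      rw [norm_mul, norm_mul, norm_mul, norm_div, norm_pow, Circle.norm_coe, Complex.norm_I,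
        mul_one, mul_one, Complex.norm_real, Real.norm_eq_abs]
      have := hd w hw (Circle.exp t)
      have := hB t
      gcongr)
    intervalIntegrable_const
    (Filter.Eventually.of_forall fun t _ w hw => by
      have h0 := hd0 w hw (Circle.exp t)
      have h1 : HasDerivAt (fun w : ℂ => ρ * (Circle.exp t : ℂ) + b - w) (-1) w := by
        simpa using (hasDerivAt_id w).const_sub (ρ * (Circle.exp t : ℂ) + b)
      have h2 := ((hasDerivAt_const w (m (Circle.exp t))).div h1 h0).mul_const (ρ : ℂ)
      have h3 := h2.mul_const (Complex.I * (Circle.exp t : ℂ))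
      convert! h3 using 1
      ring)
  exact key.2.const_mul _

theorem abs_lt_norm_of_sep {ρ : ℝ} {b c : ℂ} (h : 2 * |ρ| < ‖b - c‖) (τ : Circle) :
    |ρ| < ‖c + ρ * τ - b‖ := by
  have h1 := norm_sub_norm_le (b - c) (ρ * (τ : ℂ))
  rw [norm_mul, Circle.norm_coe, mul_one, Complex.norm_real, Real.norm_eq_abs,
    show b - c - ρ * (τ : ℂ) = -(c + ρ * τ - b) by ring, norm_neg] at h1
  linarith

/-- The potential is holomorphic off its own circle, so its restriction to a disjoint circle is
smooth however rough the density is. Only the self-induced term requires the Privalov theorem. -/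
theorem contDiff_layerPot {ρ : ℝ} {b c : ℂ} (h : 2 * |ρ| < ‖b - c‖) {m : Circle → ℂ}
    (hm : Continuous m) {n : WithTop ℕ∞} :
    ContDiff ℝ n fun θ : ℝ => layerPot ρ b m (c + ρ * Circle.exp θ) := by
  have hU : IsOpen {z : ℂ | |ρ| < ‖z - b‖} := isOpen_lt continuous_const (by fun_prop)
  have hd : DifferentiableOn ℂ (layerPot ρ b m) {z : ℂ | |ρ| < ‖z - b‖} := fun z hz =>
    (hasDerivAt_layerPot hz hm).differentiableAt.differentiableWithinAt
  have h1 : ContDiffOn ℝ n (layerPot ρ b m) {z : ℂ | |ρ| < ‖z - b‖} :=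
    (hd.contDiffOn hU).restrict_scalars ℝ
  exact h1.comp_contDiff (contDiff_const.add (contDiff_const.mul contDiff_circleExp))
    fun θ => abs_lt_norm_of_sep h _

/-- Integration by parts moves the derivative from the density to the kernel; the inner derivative
of ρσ produces the extra factor ρ. -/
theorem layerPot_tDeriv (ha0 : 0 < a) {ρ : ℝ} {b z : ℂ} (hz : |ρ| < ‖z - b‖) {φ : Circle → ℝ}
    (hφ : CHolder a 1 (lift φ)) : layerPot ρ b (tDeriv φ) z
      = ρ * ((2 * π * Complex.I)⁻¹ *
        contourInt fun σ => (φ σ : ℂ) / (ρ * σ + b - z) ^ 2 * ρ) := by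
  have hd := hφ.2.1
  have hc' : Continuous fun θ => ((deriv (lift φ) θ : ℝ) : ℂ) :=
    Complex.continuous_ofReal.comp (hφ.2.2.continuous ha0)
  have hcφ : Continuous fun t : ℝ => (lift φ t : ℂ) :=
    Complex.continuous_ofReal.comp hd.continuous
  have h0 := fun t : ℝ => denom_ne_zero hz (Circle.exp t)
  have hu : ∀ t : ℝ, HasDerivAt (fun t : ℝ => (ρ : ℂ) / (ρ * Circle.exp t + b - z))
      (-(ρ * (ρ * (Complex.I * Circle.exp t))) / (ρ * Circle.exp t + b - z) ^ 2) t := by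
    intro t
    have h1 : HasDerivAt (fun t : ℝ => ρ * (Circle.exp t : ℂ) + b - z)
        (ρ * (Complex.I * Circle.exp t)) t :=
      (((hasDerivAt_circleExp t).const_mul (ρ : ℂ)).add_const b).sub_const z
    convert! (hasDerivAt_const t (ρ : ℂ)).div h1 (h0 t) using 1
    ring
  have hcu : Continuous fun t : ℝ => -(ρ * (ρ * (Complex.I * (Circle.exp t : ℂ))))
      / (ρ * Circle.exp t + b - z) ^ 2 :=
    Continuous.div (by fun_prop) (by fun_prop) fun t => pow_ne_zero 2 (h0 t)
  have parts := intervalIntegral.integral_mul_deriv_eq_deriv_mul (a := 0) (b := 2 * π)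
    (fun t _ => hu t) (fun t _ => deriv_ofReal_comp hd t) (hcu.intervalIntegrable _ _)
    (hc'.intervalIntegrable _ _)
  have hb : lift φ (2 * π) = lift φ 0 := by simpa using lift_periodic φ 0
  have he : (Circle.exp (2 * π) : ℂ) = Circle.exp 0 := by simp
  rw [hb, he, sub_self, zero_sub, ← intervalIntegral.integral_neg] at parts
  rw [layerPot, mul_left_comm]
  congr 1
  have e1 : contourInt (fun σ => tDeriv φ σ / (ρ * σ + b - z) * ρ)
      = ∫ t in (0 : ℝ)..(2 * π), (ρ : ℂ) / (ρ * Circle.exp t + b - z) *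
          ((deriv (lift φ) t : ℝ) : ℂ) := by
    refine intervalIntegral.integral_congr fun t _ => ?_
    have hτ : (Circle.exp t : ℂ) ≠ 0 := Circle.coe_ne_zero _
    have := h0 t
    simp only [tDeriv_exp]
    field_simp
  rw [e1, parts, contourInt, ← intervalIntegral.integral_const_mul]
  refine intervalIntegral.integral_congr fun t _ => ?_
  simp only [lift]
  ring

/-! Regularity of the traces. -/

variable {M : ℕ} {Λ : Params M} {ρ : ℝ}

theorem cHolder_traceZ (ha0 : 0 < a) (ha1 : a < 1)
    (hs : ∀ j k, j ≠ k → 2 * |ρ| < ‖Λ.ctr j - Λ.ctr k‖)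
    {m : Fin M → Circle → ℂ} (hm : ∀ j, CHolder a k fun t : ℝ => m j (Circle.exp t)) (i : Fin M) :
    CHolder a k fun t : ℝ => traceZ ρ Λ m i (Circle.exp t) := by
  simp only [traceZ_eq]
  refine ((hm i).cauchyS ha0 ha1).add (CHolder.sum _ fun j hj => ?_)
  have hp : Periodic (fun θ : ℝ => layerPot ρ (Λ.ctr j) (m j) (Λ.ctr i + ρ * Circle.exp θ))
      (2 * π) := exp_periodic fun τ => layerPot ρ (Λ.ctr j) (m j) (Λ.ctr i + ρ * τ)
  exact CHolder.of_contDiff ha0 ha1.le hp (contDiff_layerPot (hs j i (Finset.ne_of_mem_erase hj))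
    (continuous_of_comp_exp ((hm j).continuous ha0)))

theorem continuous_traceZ (ha0 : 0 < a) (ha1 : a < 1)
    (hs : ∀ j k, j ≠ k → 2 * |ρ| < ‖Λ.ctr j - Λ.ctr k‖)
    {m : Fin M → Circle → ℂ} (hm : ∀ j, CHolder a 0 fun t : ℝ => m j (Circle.exp t)) (i : Fin M) :
    Continuous (traceZ ρ Λ m i) :=
  continuous_of_comp_exp ((cHolder_traceZ ha0 ha1 hs hm i).continuous ha0)

/-- On the other circles the factor ρ from the chain rule matches the one from the integration by
parts, so the self-induced and the foreign terms obey the same rule and `zMu'` really is the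
τ-derivative of `zMu`. -/
theorem hasDerivAt_traceZ (ha0 : 0 < a) (ha1 : a < 1)
    (hs : ∀ j k, j ≠ k → 2 * |ρ| < ‖Λ.ctr j - Λ.ctr k‖)
    {φ : Fin M → Circle → ℝ} (hφ : ∀ j, CHolder a 1 (lift (φ j))) (i : Fin M) (θ : ℝ) :
    HasDerivAt (fun t : ℝ => traceZ ρ Λ (fun j σ => (φ j σ : ℂ)) i (Circle.exp t))
      (Complex.I * Circle.exp θ * traceZ ρ Λ (fun j => tDeriv (φ j)) i (Circle.exp θ)) θ := by
  simp only [traceZ_eq, mul_add, Finset.mul_sum]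
  refine (hasDerivAt_cauchyS_density ha0 ha1 (hφ i) θ).add (HasDerivAt.fun_sum fun j hj => ?_)
  have hz := abs_lt_norm_of_sep (hs j i (Finset.ne_of_mem_erase hj)) (Circle.exp θ)
  have hc : Continuous fun σ => (φ j σ : ℂ) :=
    continuous_of_comp_exp (Complex.continuous_ofReal.comp (hφ j).2.1.continuous)
  have h1 : HasDerivAt (fun t : ℝ => Λ.ctr i + ρ * (Circle.exp t : ℂ))
      (ρ * (Complex.I * Circle.exp θ)) θ :=
    ((hasDerivAt_circleExp θ).const_mul (ρ : ℂ)).const_add _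
  have h2 := (hasDerivAt_layerPot hz hc).comp θ h1
  rw [layerPot_tDeriv ha0 hz (hφ j)]
  convert! h2 using 1
  ring

/-- Multiplication of a trace by the coordinate `ζ`. -/
theorem mul_traceZ (ha0 : 0 < a) (ha1 : a < 1)
    (hs : ∀ j k, j ≠ k → 2 * |ρ| < ‖Λ.ctr j - Λ.ctr k‖)
    {m : Fin M → Circle → ℂ} (hm : ∀ j, CHolder a 0 fun t : ℝ => m j (Circle.exp t))
    (hm0 : ∀ j, contourInt (m j) = 0) (i : Fin M) (τ : Circle) :
    (Λ.ctr i + ρ * τ) * traceZ ρ Λ m i τ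
      = traceZ ρ Λ (fun j σ => (Λ.ctr j + ρ * σ) * m j σ) i τ := by
  obtain ⟨θ, rfl⟩ := exp_surjective τ
  have hself : cauchyS 1 (fun t => (Λ.ctr i + ρ * Circle.exp t) * m i (Circle.exp t)) θ
      = (Λ.ctr i + ρ * Circle.exp θ) * cauchyS 1 (fun t => m i (Circle.exp t)) θ := by
    have e := cauchyS_exp_mul ha0 (hm i) θ
    have e2 : ∫ t in (0 : ℝ)..(2 * π), m i (Circle.exp t) * Circle.exp t = 0 := by
      have h := hm0 i
      simp only [contourInt, mul_left_comm _ Complex.I] at h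
      rw [intervalIntegral.integral_const_mul] at h
      exact (mul_eq_zero.1 h).resolve_left Complex.I_ne_zero
    rw [e2, mul_zero, add_zero] at e
    have hc := (hm i).continuous ha0
    have hcm := continuous_of_comp_exp hc
    obtain ⟨C, hC⟩ := (hm i).2
    obtain ⟨C', hC'⟩ := ((cHolder_exp (k := 0) ha0 ha1.le).mul ha0 ha1.le (hm i)).2
    have i1 := intervalIntegrable_cauchyS_one ha0 hc (θ := θ) fun s _ => by
      simpa using hC (θ + s) θ
    have i2 := intervalIntegrable_cauchyS_one ha0
      (g := fun t => (Circle.exp t : ℂ) * m i (Circle.exp t)) (by fun_prop) (θ := θ) fun s _ => by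
      simpa using hC' (θ + s) θ
    have e3 : cauchyS 1 (fun t => (Λ.ctr i + ρ * Circle.exp t) * m i (Circle.exp t)) θ
        = Λ.ctr i * cauchyS 1 (fun t => m i (Circle.exp t)) θ
          + ρ * cauchyS 1 (fun t => (Circle.exp t : ℂ) * m i (Circle.exp t)) θ := by
      have e4 := intervalIntegral.integral_add (i1.const_mul (Λ.ctr i)) (i2.const_mul (ρ : ℂ))
      rw [intervalIntegral.integral_const_mul, intervalIntegral.integral_const_mul] at e4
      unfold cauchyS
      rw [mul_left_comm (Λ.ctr i), mul_left_comm (ρ : ℂ), ← mul_add, ← e4]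
      congr 1
      refine intervalIntegral.integral_congr fun s _ => ?_
      ring
    rw [e3, e]
    ring
  rw [traceZ_eq, traceZ_eq, hself, mul_add, Finset.mul_sum]
  congr 1
  refine Finset.sum_congr rfl fun j hj => ?_
  have hz := abs_lt_norm_of_sep (hs j i (Finset.ne_of_mem_erase hj)) (Circle.exp θ)
  have hc := (hm j).continuous ha0
  have hcm := continuous_of_comp_exp hc
  have h0 := fun t : ℝ => denom_ne_zero hz (Circle.exp t)
  rw [layerPot, layerPot, mul_left_comm]
  congr 1
  -- Evaluation point minus source point is minus the denominator. The two integrands hence differ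
  -- by −ρ m_j, which integrates to zero.
  have e1 : contourInt (fun σ => m j σ) * ρ = 0 := by rw [hm0 j, zero_mul]
  rw [contourInt, contourInt, ← intervalIntegral.integral_const_mul, ← sub_eq_zero,
    ← intervalIntegral.integral_sub]
  · rw [← neg_eq_zero, ← e1, contourInt, ← intervalIntegral.integral_neg,
      ← intervalIntegral.integral_mul_const]
    refine intervalIntegral.integral_congr fun t _ => ?_
    have := h0 t
    field_simp
    ring
  · exact (Continuous.mul continuous_const (Continuous.mul (Continuous.mul (Continuous.div hc
      (by fun_prop) h0) (by fun_prop)) (by fun_prop))).intervalIntegrable _ _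
  · exact (Continuous.mul (Continuous.mul (Continuous.div (by fun_prop)
      (by fun_prop) h0) (by fun_prop)) (by fun_prop)).intervalIntegrable _ _

end Traces

end HollowVortex

end

open scoped NNReal

noncomputable section

namespace HollowVortex

/-! ### Traces of functions that are holomorphic outside the discs -/

section Exterior

open Real Set MeasureTheory Function

variable {a : ℝ} {M : ℕ} {Λ : Params M} {ρ : ℝ}

/-- The point with parameter `x` on the boundary of the discs. -/
def bdryPt (Λ : Params M) (ρ : ℝ) (x : Fin M × Circle) : ℂ := Λ.ctr x.1 + ρ * x.2

/-- The open discs of radius `|ρ|`. -/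
def discs (Λ : Params M) (ρ : ℝ) : Set ℂ := {p | ∃ j, ‖p - Λ.ctr j‖ < |ρ|}

/-- The circles of radius `|ρ|` around the centres are disjoint. -/
def Separated (Λ : Params M) (ρ : ℝ) : Prop := ∀ j k, j ≠ k → 2 * |ρ| < ‖Λ.ctr j - Λ.ctr k‖

@[fun_prop]
theorem continuous_bdryPt : Continuous (bdryPt Λ ρ) := by
  unfold bdryPt
  have : Continuous fun x : Fin M × Circle => Λ.ctr x.1 :=
    (continuous_of_discreteTopology (f := Λ.ctr)).comp continuous_fst
  fun_prop

theorem norm_bdryPt_sub_ge (hs : Separated Λ ρ) (x : Fin M × Circle) (j : Fin M) :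
    |ρ| ≤ ‖bdryPt Λ ρ x - Λ.ctr j‖ := by
  rcases eq_or_ne j x.1 with rfl | hj
  · rw [bdryPt, add_sub_cancel_left, norm_mul, Circle.norm_coe, mul_one, Complex.norm_real,
      Real.norm_eq_abs]
  · exact (abs_lt_norm_of_sep (hs j x.1 hj) x.2).le

theorem bdryPt_sub_ne_zero (hs : Separated Λ ρ) {p : ℂ} (hp : p ∈ discs Λ ρ)
    (x : Fin M × Circle) : bdryPt Λ ρ x - p ≠ 0 := by
  obtain ⟨j, hj⟩ := hp
  intro h
  rw [← sub_eq_zero.1 h] at hj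
  exact absurd hj (not_lt.2 (norm_bdryPt_sub_ge hs x j))

/-- The traces of the functions `1 / (ζ - p)` with `p` in one of the discs. -/
def poleTraces (Λ : Params M) (ρ : ℝ) : Set C(Fin M × Circle, ℂ) :=
  {e | ∃ p ∈ discs Λ ρ, ∀ x, e x = (bdryPt Λ ρ x - p)⁻¹}

/-- The uniform limits of traces of rational functions that have their poles in the discs and
vanish at infinity. -/
def exteriorTraces (Λ : Params M) (ρ : ℝ) : NonUnitalSubalgebra ℂ C(Fin M × Circle, ℂ) :=
  (NonUnitalAlgebra.adjoin ℂ (poleTraces Λ ρ)).topologicalClosure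

/-- The sum over the circles of the contour integrals. -/
def circlesInt (H : Fin M × Circle → ℂ) : ℂ := ∑ k, contourInt fun τ => H (k, τ)

theorem contourInt_add {f g : Circle → ℂ} (hf : Continuous f) (hg : Continuous g) :
    contourInt (fun τ => f τ + g τ) = contourInt f + contourInt g := by
  simp only [contourInt, add_mul]
  exact intervalIntegral.integral_add ((by fun_prop : Continuous fun θ : ℝ =>
    f (Circle.exp θ) * (Complex.I * (Circle.exp θ : ℂ))).intervalIntegrable _ _)
    ((by fun_prop : Continuous fun θ : ℝ =>
    g (Circle.exp θ) * (Complex.I * (Circle.exp θ : ℂ))).intervalIntegrable _ _)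

theorem contourInt_const_mul (c : ℂ) (f : Circle → ℂ) :
    contourInt (fun τ => c * f τ) = c * contourInt f := by
  simp only [contourInt, mul_assoc]
  exact intervalIntegral.integral_const_mul _ _

theorem circlesInt_add (f g : C(Fin M × Circle, ℂ)) :
    circlesInt (f + g) = circlesInt f + circlesInt g := by
  simp only [circlesInt, ← Finset.sum_add_distrib]
  exact Finset.sum_congr rfl fun k _ => contourInt_add (by fun_prop) (by fun_prop)

theorem circlesInt_const_mul (c : ℂ) (f : Fin M × Circle → ℂ) :
    circlesInt (fun x => c * f x) = c * circlesInt f := by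
  simp only [circlesInt, contourInt_const_mul, Finset.mul_sum]

theorem circlesInt_smul (c : ℂ) (f : C(Fin M × Circle, ℂ)) :
    circlesInt (c • f) = c * circlesInt f := circlesInt_const_mul c f

theorem circlesInt_zero : circlesInt (0 : C(Fin M × Circle, ℂ)) = 0 := by
  simp [circlesInt, contourInt]

theorem continuous_circlesInt :
    Continuous fun f : C(Fin M × Circle, ℂ) => circlesInt f := by
  unfold circlesInt contourInt
  refine continuous_finsetSum _ fun k _ => ?_
  refine intervalIntegral.continuous_parametric_intervalIntegral_of_continuous' ?_ _ _
  simp only [Function.uncurry_def]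
  fun_prop

theorem contourInt_zpow_sub (hρ : ρ ≠ 0) (c p : ℂ) (n : ℤ) :
    contourInt (fun τ => (c + ρ * τ - p) ^ n)
      = (ρ : ℂ) ^ n * ∮ z in C(0, 1), (z - (p - c) / ρ) ^ n := by
  have h : (ρ : ℂ) ≠ 0 := by exact_mod_cast hρ
  rw [← contourInt_coe, ← contourInt_const_mul]
  congr 1
  funext τ
  rw [← mul_zpow]
  congr 1
  field_simp
  ring

/-- A pole in the j-th disc is enclosed by the j-th circle only, by separation. The factor 1/ρ
appears because integration is in τ rather than in ζ = ζ_k + ρτ. -/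
theorem circlesInt_pole (hs : Separated Λ ρ) {p : ℂ} (hp : p ∈ discs Λ ρ) :
    circlesInt (fun x => (bdryPt Λ ρ x - p)⁻¹) = 2 * π * Complex.I / ρ := by
  obtain ⟨j, hj⟩ := hp
  have hρ : ρ ≠ 0 := abs_pos.1 ((norm_nonneg _).trans_lt hj)
  have hρ' : 0 < |ρ| := abs_pos.2 hρ
  have hn : ∀ k, ‖(p - Λ.ctr k) / ρ‖ = ‖p - Λ.ctr k‖ / |ρ| := fun k => by
    rw [norm_div, Complex.norm_real, Real.norm_eq_abs]
  have hk : ∀ k, contourInt (fun τ => (bdryPt Λ ρ (k, τ) - p)⁻¹)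
      = (ρ : ℂ)⁻¹ * ∮ z in C(0, 1), (z - (p - Λ.ctr k) / ρ)⁻¹ := by
    intro k
    have := contourInt_zpow_sub hρ (Λ.ctr k) p (-1)
    simpa only [zpow_neg_one, bdryPt] using this
  rw [circlesInt, Finset.sum_eq_single j]
  · rw [hk, circleIntegral.integral_sub_inv_of_mem_ball]
    · ring
    · rw [mem_ball_zero_iff, hn, div_lt_one hρ']
      exact hj
  · intro k _ hkj
    have h1 : 1 < ‖(p - Λ.ctr k) / ρ‖ := by
      rw [hn, one_lt_div hρ']
      have h2 := hs j k hkj.symm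
      have h3 := norm_sub_norm_le (Λ.ctr j - Λ.ctr k) (Λ.ctr j - p)
      rw [show Λ.ctr j - Λ.ctr k - (Λ.ctr j - p) = p - Λ.ctr k by ring,
        norm_sub_rev (Λ.ctr j) p] at h3
      linarith
    rw [hk, Complex.circleIntegral_eq_zero_of_differentiable_on_off_countable zero_le_one
      countable_empty (f := fun z => (z - (p - Λ.ctr k) / ρ)⁻¹), mul_zero]
    · refine ContinuousOn.inv₀ (by fun_prop) fun z hz h0 => ?_
      rw [mem_closedBall_zero_iff, sub_eq_zero.1 h0] at hz
      linarith
    · intro z hz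
      refine DifferentiableAt.inv (by fun_prop) fun h0 => ?_
      have hz1 := hz.1
      rw [mem_ball_zero_iff, sub_eq_zero.1 h0] at hz1
      linarith
  · simp

/-- The product of the functions `1 / (z - p)` with `p` in a multiset. -/
def poleProd (s : Multiset ℂ) (z : ℂ) : ℂ := (s.map fun p => (z - p)⁻¹).prod

theorem poleProd_cons (p : ℂ) (s : Multiset ℂ) (z : ℂ) :
    poleProd (p ::ₘ s) z = (z - p)⁻¹ * poleProd s z := by
  simp [poleProd]

theorem continuous_poleProd (hs : Separated Λ ρ) (s : Multiset ℂ) (h : ∀ p ∈ s, p ∈ discs Λ ρ) :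
    Continuous fun x => poleProd s (bdryPt Λ ρ x) := by
  induction s using Multiset.induction_on with
  | empty => simpa [poleProd] using continuous_const
  | cons p s ih =>
    simp only [poleProd_cons]
    refine Continuous.mul (Continuous.inv₀ (by fun_prop) ?_) (ih fun q hq => h q (by simp [hq]))
    exact bdryPt_sub_ne_zero hs (h p (by simp))

/-- If all poles coincide, the integrand is a power with exponent at most −2 and has no residue. If
two differ, partial fractions express the product through two products with one factor less. -/
theorem circlesInt_poleProd (hρ : ρ ≠ 0) (hs : Separated Λ ρ) (n : ℕ) (s : Multiset ℂ)
    (hn : s.card = n + 2) (h : ∀ p ∈ s, p ∈ discs Λ ρ) :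
    circlesInt (fun x => poleProd s (bdryPt Λ ρ x)) = 0 := by
  induction n generalizing s with
  | zero | succ n ih =>
    obtain ⟨p, hps⟩ := Multiset.card_pos_iff_exists_mem.1 (by omega : 0 < s.card)
    obtain ⟨s', rfl⟩ := Multiset.exists_cons_of_mem hps
    by_cases hall : ∀ q ∈ s', q = p
    · have h1 : s' = Multiset.replicate s'.card p := Multiset.eq_replicate_card.2 hall
      have h2 : ∀ k, contourInt (fun τ => poleProd (p ::ₘ s') (bdryPt Λ ρ (k, τ))) = 0 := by
        intro k
        have h3 : ∀ z, poleProd (p ::ₘ s') z = (z - p) ^ (-((s'.card + 1 : ℕ) : ℤ)) := by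
          intro z
          rw [poleProd_cons, h1]
          simp only [poleProd, Multiset.map_replicate, Multiset.prod_replicate,
            Multiset.card_replicate, zpow_neg, zpow_natCast, pow_succ, mul_inv, inv_pow]
          ring
        simp only [h3, bdryPt]
        rw [contourInt_zpow_sub hρ, circleIntegral.integral_sub_zpow_of_ne, mul_zero]
        simp only [Multiset.card_cons] at hn
        omega
      simp [circlesInt, h2]
    · push Not at hall
      obtain ⟨q, hq, hqp⟩ := hall
      obtain ⟨t, rfl⟩ := Multiset.exists_cons_of_mem hq
      have hpd := h p (by simp)
      have hqd := h q (by simp)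
      have htd : ∀ r ∈ t, r ∈ discs Λ ρ := fun r hr => h r (by simp [hr])
      have hp' : ∀ r ∈ p ::ₘ t, r ∈ discs Λ ρ := by
        simpa using ⟨hpd, htd⟩
      have hq' : ∀ r ∈ q ::ₘ t, r ∈ discs Λ ρ := by
        simpa using ⟨hqd, htd⟩
      have e : (fun x => poleProd (p ::ₘ q ::ₘ t) (bdryPt Λ ρ x))
          = ((p - q)⁻¹ • (⟨_, continuous_poleProd hs _ hp'⟩ : C(Fin M × Circle, ℂ))
            + (-(p - q)⁻¹) • (⟨_, continuous_poleProd hs _ hq'⟩ : C(Fin M × Circle, ℂ)) :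
              C(Fin M × Circle, ℂ)) := by
        funext x
        have h1 := bdryPt_sub_ne_zero hs hpd x
        have h2 := bdryPt_sub_ne_zero hs hqd x
        have h3 : p - q ≠ 0 := sub_ne_zero.2 hqp.symm
        simp only [ContinuousMap.coe_add, ContinuousMap.coe_smul, Pi.add_apply, Pi.smul_apply,
          ContinuousMap.coe_mk, smul_eq_mul, poleProd_cons]
        field_simp
        ring
      have e2 := circlesInt_add
        ((p - q)⁻¹ • (⟨_, continuous_poleProd hs _ hp'⟩ : C(Fin M × Circle, ℂ)))
        ((-(p - q)⁻¹) • (⟨_, continuous_poleProd hs _ hq'⟩ : C(Fin M × Circle, ℂ)))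
      rw [circlesInt_smul, circlesInt_smul] at e2
      rw [e, e2]
      simp only [ContinuousMap.coe_mk]
      -- When no other factor is left, the two simple poles have the same total integral and cancel.
      -- Otherwise the induction hypothesis applies to both products.
      first
      | have ht : t = 0 := by
          rw [← Multiset.card_eq_zero]
          simpa using hn
        subst ht
        have h5 : ∀ p, (fun x : Fin M × Circle => poleProd (p ::ₘ 0) (bdryPt Λ ρ x))
            = fun x => (bdryPt Λ ρ x - p)⁻¹ := fun p => by
          funext x
          simp [poleProd]
        rw [h5, h5, circlesInt_pole hs hpd, circlesInt_pole hs hqd]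
        ring
      | rw [ih (p ::ₘ t) (by simpa using hn) hp', ih (q ::ₘ t) (by simpa using hn) hq']
        ring

theorem exists_poleProd_of_mem {e : C(Fin M × Circle, ℂ)}
    (he : e ∈ Subsemigroup.closure (poleTraces Λ ρ)) :
    ∃ s : Multiset ℂ, 0 < s.card ∧ (∀ p ∈ s, p ∈ discs Λ ρ) ∧
      ∀ x, e x = poleProd s (bdryPt Λ ρ x) := by
  induction he using Subsemigroup.closure_induction with
  | mem e he =>
    obtain ⟨p, hp, h⟩ := he
    exact ⟨{p}, by simp, by simpa using hp, fun x => by simp [poleProd, h x]⟩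
  | mul e f _ _ he hf =>
    obtain ⟨s, hs0, hs, hse⟩ := he
    obtain ⟨t, ht0, ht, htf⟩ := hf
    refine ⟨s + t, by simp; omega, fun p hp => ?_, fun x => ?_⟩
    · rcases Multiset.mem_add.1 hp with hp | hp
      exacts [hs p hp, ht p hp]
    · simp [poleProd, hse x, htf x]

/-- The residue at infinity of the product of two functions that vanish at infinity is zero. -/
theorem circlesInt_mul_eq_zero (hρ : ρ ≠ 0) (hs : Separated Λ ρ) {e f : C(Fin M × Circle, ℂ)}
    (he : e ∈ exteriorTraces Λ ρ) (hf : f ∈ exteriorTraces Λ ρ) : circlesInt (e * f) = 0 := by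
  have key : ∀ e ∈ NonUnitalAlgebra.adjoin ℂ (poleTraces Λ ρ),
      ∀ f ∈ NonUnitalAlgebra.adjoin ℂ (poleTraces Λ ρ), circlesInt (e * f) = 0 := by
    intro e he f hf
    rw [← NonUnitalSubalgebra.mem_toSubmodule, NonUnitalAlgebra.adjoin_eq_span] at he hf
    induction he using Submodule.span_induction with
    | mem e he =>
      induction hf using Submodule.span_induction with
      | mem f hf =>
        obtain ⟨s, hs0, hsd, hse⟩ := exists_poleProd_of_mem he
        obtain ⟨t, ht0, htd, htf⟩ := exists_poleProd_of_mem hf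
        have h1 : (fun x => (e * f) x) = fun x => poleProd (s + t) (bdryPt Λ ρ x) := by
          funext x
          simp [poleProd, hse x, htf x]
        have h2 := circlesInt_poleProd hρ hs (s.card + t.card - 2) (s + t)
          (by rw [Multiset.card_add]; omega) (fun p hp => by
            rcases Multiset.mem_add.1 hp with hp | hp
            exacts [hsd p hp, htd p hp])
        rw [← h1] at h2
        exact h2
      | zero => simp [circlesInt, contourInt]
      | add f g _ _ hf hg => rw [mul_add, circlesInt_add, hf, hg, add_zero]
      | smul c f _ hf => rw [mul_smul_comm, circlesInt_smul, hf, mul_zero]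
    | zero => simp [circlesInt, contourInt]
    | add e g _ _ he hg => rw [add_mul, circlesInt_add, he, hg, add_zero]
    | smul c e _ he => rw [smul_mul_assoc, circlesInt_smul, he, mul_zero]
  have hc : Continuous (Function.uncurry fun e f : C(Fin M × Circle, ℂ) => circlesInt (e * f)) :=
    continuous_circlesInt.comp (continuous_fst.mul continuous_snd)
  -- The integral of a product depends continuously on both factors in the uniform norm, so
  -- vanishing passes from the algebra to its closure.
  have := map_mem_closure₂ hc he hf (u := {0}) fun e he f hf => key e he f hf
  simpa using this

theorem isClosed_exteriorTraces :
    IsClosed (exteriorTraces Λ ρ : Set C(Fin M × Circle, ℂ)) :=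
  NonUnitalSubalgebra.isClosed_topologicalClosure _

theorem poleTrace_mem {e : C(Fin M × Circle, ℂ)} (he : e ∈ poleTraces Λ ρ) :
    e ∈ exteriorTraces Λ ρ :=
  NonUnitalSubalgebra.le_topologicalClosure _ (NonUnitalAlgebra.subset_adjoin ℂ he)

/-- Neumann series without a unit: iterating g = −d − d g gives partial sums in the algebra, with
remainder (−d)^N g tending to 0. -/
theorem mem_exteriorTraces_of_inverse {d g : C(Fin M × Circle, ℂ)} (hd : d ∈ exteriorTraces Λ ρ)
    (hd1 : ‖d‖ < 1) (h : ∀ x, (1 + d x) * (1 + g x) = 1) : g ∈ exteriorTraces Λ ρ := by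
  have hg : g = -d + -d * g := by
    ext x
    have := h x
    simp only [ContinuousMap.add_apply, ContinuousMap.neg_apply, ContinuousMap.mul_apply]
    linear_combination this
  have key : ∀ N : ℕ, ∃ s ∈ exteriorTraces Λ ρ, g = s + (-d) ^ N * g := by
    intro N
    induction N with
    | zero => exact ⟨0, zero_mem _, by simp⟩
    | succ N ih =>
      obtain ⟨s, hs, hsg⟩ := ih
      refine ⟨-d + -d * s, add_mem (neg_mem hd) (mul_mem (neg_mem hd) hs), ?_⟩
      nth_rewrite 1 [hg]
      nth_rewrite 1 [hsg]
      ring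
  choose s hs hsg using key
  refine isClosed_exteriorTraces.mem_of_tendsto (f := s) (b := Filter.atTop) ?_
    (Filter.Eventually.of_forall hs)
  have h1 : ∀ N, s N = g - (-d) ^ N * g := fun N => eq_sub_of_add_eq (hsg N).symm
  have h2 : Filter.Tendsto (fun N : ℕ => (-d) ^ N * g) Filter.atTop (nhds 0) := by
    have := (tendsto_pow_atTop_nhds_zero_of_norm_lt_one (x := -d) (by rwa [norm_neg])).mul_const g
    simpa using this
  have h3 := h2.const_sub g
  rw [sub_zero] at h3
  exact h3.congr fun N => (h1 N).symm

end Exterior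

end HollowVortex

end

open scoped NNReal

noncomputable section

namespace HollowVortex

/-! ### Layer potentials as uniform limits of rational functions -/

section PotentialTraces

open Real Set MeasureTheory Function

variable {a : ℝ} {M : ℕ} {Λ : Params M} {ρ : ℝ}

theorem convex_exteriorTraces : Convex ℝ (exteriorTraces Λ ρ : Set C(Fin M × Circle, ℂ)) :=
  ((exteriorTraces Λ ρ).toSubmodule.restrictScalars ℝ).convex

theorem real_smul_mem {e : C(Fin M × Circle, ℂ)} (c : ℝ) (he : e ∈ exteriorTraces Λ ρ) :
    c • e ∈ exteriorTraces Λ ρ :=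
  ((exteriorTraces Λ ρ).toSubmodule.restrictScalars ℝ).smul_mem c he

theorem shrink_mem_discs {ρ' : ℝ} (hρ' : |ρ'| < |ρ|) (j : Fin M) (σ : Circle) :
    Λ.ctr j + ρ' * σ ∈ discs Λ ρ := by
  refine ⟨j, ?_⟩
  rwa [add_sub_cancel_left, norm_mul, Circle.norm_coe, mul_one, Complex.norm_real,
    Real.norm_eq_abs]

/-- The potential of a density on a smaller circle. -/
theorem exists_layerPot_mem (hs : Separated Λ ρ) {ρ' : ℝ} (hρ' : |ρ'| < |ρ|) (j : Fin M)
    {m : Circle → ℂ} (hm : Continuous m) :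
    ∃ e ∈ exteriorTraces Λ ρ, ∀ x, e x = layerPot ρ' (Λ.ctr j) m (bdryPt Λ ρ x) := by
  have h0 : ∀ (σ : Circle) (x : Fin M × Circle), ρ' * (σ : ℂ) + Λ.ctr j - bdryPt Λ ρ x ≠ 0 := by
    intro σ x h
    refine bdryPt_sub_ne_zero hs (shrink_mem_discs hρ' j σ) x ?_
    linear_combination -h
  let G : C(ℝ × (Fin M × Circle), ℂ) :=
    ⟨fun y => (2 * π * Complex.I)⁻¹ * (m (Circle.exp y.1) /
      (ρ' * Circle.exp y.1 + Λ.ctr j - bdryPt Λ ρ y.2) * ρ' * (Complex.I * Circle.exp y.1)), by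
      refine Continuous.mul continuous_const (Continuous.mul (Continuous.mul (Continuous.div
        (by fun_prop) (by fun_prop) fun y => h0 _ _) (by fun_prop)) (by fun_prop))⟩
  -- For each source point the integrand is a scalar multiple of a single pole trace, with the pole
  -- inside a disc.
  have hmem : ∀ t, G.curry t ∈ exteriorTraces Λ ρ := by
    intro t
    let e : C(Fin M × Circle, ℂ) := ⟨fun x => (bdryPt Λ ρ x - (Λ.ctr j + ρ' * Circle.exp t))⁻¹,
      Continuous.inv₀ (by fun_prop) (bdryPt_sub_ne_zero hs (shrink_mem_discs hρ' j _))⟩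
    have he : e ∈ exteriorTraces Λ ρ :=
      poleTrace_mem ⟨_, shrink_mem_discs hρ' j (Circle.exp t), fun x => rfl⟩
    have h1 : G.curry t = (-((2 * π * Complex.I)⁻¹ * (m (Circle.exp t) * ρ' *
        (Complex.I * Circle.exp t)))) • e := by
      ext x
      have h2 := bdryPt_sub_ne_zero hs (shrink_mem_discs hρ' j (Circle.exp t)) x
      have h3 : ρ' * (Circle.exp t : ℂ) + Λ.ctr j - bdryPt Λ ρ x
          = -(bdryPt Λ ρ x - (Λ.ctr j + ρ' * Circle.exp t)) := by ring
      simp only [ContinuousMap.curry_apply, ContinuousMap.coe_mk, ContinuousMap.smul_apply,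
        smul_eq_mul, G, e, h3, div_eq_mul_inv, inv_neg]
      ring
    rw [h1]
    exact SMulMemClass.smul_mem _ he
  have hc : Continuous fun t => G.curry t := G.curry.continuous
  have hi : IntegrableOn (fun t => G.curry t) (Ioc 0 (2 * π)) volume :=
    (hc.intervalIntegrable 0 (2 * π)).1
  -- The integral is 2π times an average, and averages of values in a closed convex set stay in it.
  have havg := convex_exteriorTraces.set_average_mem (isClosed_exteriorTraces (Λ := Λ) (ρ := ρ))
    (μ := volume) (t := Ioc 0 (2 * π)) (f := fun t => G.curry t)
    (by simp [pi_pos]) measure_Ioc_lt_top.ne (Filter.Eventually.of_forall hmem) hi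
  have hmem2 := real_smul_mem (2 * π) havg
  refine ⟨_, hmem2, fun x => ?_⟩
  have hv : volume.real (Ioc 0 (2 * π)) = 2 * π := by
    rw [Measure.real, Real.volume_Ioc, sub_zero, ENNReal.toReal_ofReal (by positivity)]
  rw [setAverage_eq, hv, smul_inv_smul₀ (by positivity), ContinuousMap.integral_apply hi, layerPot,
    contourInt, intervalIntegral.integral_of_le (by positivity), ← integral_const_mul]
  rfl

/-- By scaling, shrinking the source circle to radius ρ/(1 + h) amounts to moving the evaluation
point out to relative radius 1 + h. The exterior estimate `norm_cauchyS_sub_le` then applies. -/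
theorem layerPot_self {m : Circle → ℂ} (hm : Continuous m) {h : ℝ} (hh : 0 < h) (hρ : ρ ≠ 0)
    (c : ℂ) (θ : ℝ) :
    layerPot (ρ / (1 + h)) c m (c + ρ * Circle.exp θ)
      = cauchyS (1 + h) (fun t => m (Circle.exp t)) θ := by
  have e := cauchyS_eq_shift (exp_periodic m) (by fun_prop) hh 0 θ 0
  simp only [add_zero, sub_zero] at e
  rw [e, layerPot, contourInt_eq_shift _ θ, mul_inv, mul_assoc,
    ← intervalIntegral.integral_const_mul]
  congr 1
  refine intervalIntegral.integral_congr fun s _ => ?_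
  have hθ : (Circle.exp θ : ℂ) ≠ 0 := Circle.coe_ne_zero _
  have hρ' : (ρ : ℂ) ≠ 0 := by exact_mod_cast hρ
  have hh' : ((1 : ℂ) + h) ≠ 0 := by
    exact_mod_cast (by linarith : (1 + h) ≠ 0)
  simp only [cauchyKer, coe_exp_add, Complex.ofReal_div, Complex.ofReal_add, Complex.ofReal_one]
  have e2 : (ρ : ℂ) / (1 + h) * (Circle.exp θ * Complex.exp (Complex.I * s)) + c
      - (c + ρ * Circle.exp θ)
      = ρ / (1 + h) * Circle.exp θ * (Complex.exp (Complex.I * s) - (1 + h)) := by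
    field_simp
    ring
  rw [e2]
  field_simp

theorem norm_contourInt_le {f : Circle → ℂ} {B : ℝ} (hB : ∀ τ, ‖f τ‖ ≤ B) :
    ‖contourInt f‖ ≤ 2 * π * B := by
  have := intervalIntegral.norm_integral_le_of_norm_le_const (a := 0) (b := 2 * π) (C := B)
    (f := fun θ : ℝ => f (Circle.exp θ) * (Complex.I * (Circle.exp θ : ℂ))) fun t _ => by
      rw [norm_mul, norm_mul, Circle.norm_coe, Complex.norm_I, mul_one, mul_one]
      exact hB _
  rw [sub_zero, abs_of_pos (by positivity)] at this
  rw [contourInt]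
  linarith

theorem norm_two_pi_I_inv : ‖(2 * π * Complex.I : ℂ)⁻¹‖ = (2 * π)⁻¹ := by
  rw [norm_inv, norm_mul, norm_mul, Complex.norm_real, Real.norm_eq_abs, abs_of_pos pi_pos]
  simp

theorem contourInt_sub {f g : Circle → ℂ} (hf : Continuous f) (hg : Continuous g) :
    contourInt (fun τ => f τ - g τ) = contourInt f - contourInt g := by
  have h := contourInt_add (g := fun τ => (-1 : ℂ) * g τ) hf (continuous_const.mul hg)
  have h2 := contourInt_const_mul (-1) g
  simp only [neg_mul, one_mul] at h h2
  simp only [sub_eq_add_neg]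
  rw [← h2]
  exact h

/-- Between different circles the kernel is regular: the gap δ bounds all denominators from below,
so the potential depends on the source radius at a linear rate. -/
theorem exists_layerPot_far_bound {b c : ℂ} (hbc : 2 * |ρ| < ‖b - c‖)
    {m : Circle → ℂ} (hm : Continuous m) : ∃ C, 0 ≤ C ∧ ∀ h : ℝ, 0 < h → ∀ τ : Circle,
      ‖layerPot (ρ / (1 + h)) b m (c + ρ * τ) - layerPot ρ b m (c + ρ * τ)‖ ≤ C * h := by
  obtain ⟨B, hB0, hB⟩ := exists_norm_le_of_periodic (exp_periodic m)
    (hm.comp Circle.exp.continuous)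
  set δ := ‖b - c‖ - 2 * |ρ| with hδ
  have hδ0 : 0 < δ := by linarith
  refine ⟨B * (|ρ| * (‖b - c‖ + |ρ|) / δ ^ 2), by positivity, fun h hh τ => ?_⟩
  have hρτ : ‖(ρ : ℂ) * τ‖ = |ρ| := by
    rw [norm_mul, Circle.norm_coe, mul_one, Complex.norm_real, Real.norm_eq_abs]
  set w := b - (c + ρ * τ) with hw
  have hw1 : ‖w‖ ≤ ‖b - c‖ + |ρ| := by
    rw [hw, show b - (c + ρ * (τ : ℂ)) = (b - c) - ρ * τ by ring, ← hρτ]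
    exact norm_sub_le _ _
  have hw2 : ‖b - c‖ - |ρ| ≤ ‖w‖ := by
    rw [hw, show b - (c + ρ * (τ : ℂ)) = (b - c) - ρ * τ by ring, ← hρτ]
    exact norm_sub_norm_le _ _
  -- Multiplied by 1 + h, the denominator for the shrunken circle becomes ρσ + (1 + h)w; the values
  -- t = 1 and t = 1 + h cover both radii.
  have hden : ∀ t : ℝ, 1 ≤ t → ∀ σ : Circle, δ ≤ ‖ρ * (σ : ℂ) + t * w‖ := by
    intro t ht σ
    have h1 := norm_sub_norm_le ((t : ℂ) * w) (-(ρ * (σ : ℂ)))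
    rw [norm_neg, norm_mul, norm_mul, Circle.norm_coe, mul_one, Complex.norm_real,
      Complex.norm_real, Real.norm_eq_abs, Real.norm_eq_abs, abs_of_nonneg (by linarith),
      sub_neg_eq_add, add_comm ((t : ℂ) * w)] at h1
    nlinarith [norm_nonneg w]
  have hden1 : ∀ σ : Circle, δ ≤ ‖ρ * (σ : ℂ) + w‖ := fun σ => by
    simpa using hden 1 le_rfl σ
  have hden2 : ∀ σ : Circle, δ ≤ ‖ρ * (σ : ℂ) + (1 + h) * w‖ := fun σ => by
    simpa using hden (1 + h) (by linarith) σ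
  have hn1 := fun σ => norm_pos_iff.1 (hδ0.trans_le (hden1 σ))
  have hn2 := fun σ => norm_pos_iff.1 (hδ0.trans_le (hden2 σ))
  have hh' : ((1 : ℂ) + h) ≠ 0 := by exact_mod_cast (by linarith : (1 + h) ≠ 0)
  have e1 : layerPot (ρ / (1 + h)) b m (c + ρ * τ) = (2 * π * Complex.I)⁻¹ *
      contourInt fun σ => m σ * (ρ / (ρ * σ + (1 + h) * w)) := by
    rw [layerPot]
    congr 2
    funext σ
    have e3 : ((ρ / (1 + h) : ℝ) : ℂ) * (σ : ℂ) + b - (c + ρ * τ)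
        = (ρ * σ + (1 + h) * w) / (1 + h) := by
      rw [hw]
      push_cast
      field_simp
      ring
    have := hn2 σ
    rw [e3]
    push_cast
    field_simp
  have e2 : layerPot ρ b m (c + ρ * τ) = (2 * π * Complex.I)⁻¹ *
      contourInt fun σ => m σ * (ρ / (ρ * σ + w)) := by
    rw [layerPot]
    congr 2
    funext σ
    rw [show ρ * (σ : ℂ) + b - (c + ρ * τ) = ρ * σ + w by rw [hw]; ring]
    ring
  have c1 : Continuous fun σ : Circle => m σ * (ρ / (ρ * (σ : ℂ) + (1 + h) * w)) :=
    hm.mul (Continuous.div (by fun_prop) (by fun_prop) hn2)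
  have c2 : Continuous fun σ : Circle => m σ * (ρ / (ρ * (σ : ℂ) + w)) :=
    hm.mul (Continuous.div (by fun_prop) (by fun_prop) hn1)
  rw [e1, e2, ← mul_sub, ← contourInt_sub c1 c2, norm_mul, norm_two_pi_I_inv]
  have hbd : ∀ σ : Circle, ‖m σ * (ρ / (ρ * σ + (1 + h) * w)) - m σ * (ρ / (ρ * σ + w))‖
      ≤ B * (|ρ| * (‖b - c‖ + |ρ|) / δ ^ 2) * h := by
    intro σ
    have e4 : m σ * (ρ / (ρ * σ + (1 + h) * w)) - m σ * (ρ / (ρ * σ + w))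
        = m σ * (-(ρ * h * w) / ((ρ * σ + (1 + h) * w) * (ρ * σ + w))) := by
      have := hn1 σ
      have := hn2 σ
      field_simp
      ring
    obtain ⟨t, rfl⟩ := exp_surjective σ
    have hBt := hB t
    have hd1 := hden1 (Circle.exp t)
    have hd2 := hden2 (Circle.exp t)
    rw [e4, norm_mul, norm_div, norm_neg, norm_mul, norm_mul, norm_mul, Complex.norm_real,
      Complex.norm_real, Real.norm_eq_abs, Real.norm_eq_abs, abs_of_pos hh]
    calc _ ≤ B * (|ρ| * h * (‖b - c‖ + |ρ|) / (δ * δ)) := by gcongr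
      _ = _ := by ring
  calc (2 * π)⁻¹ * ‖_‖ ≤ (2 * π)⁻¹ * (2 * π * (B * (|ρ| * (‖b - c‖ + |ρ|) / δ ^ 2) * h)) := by
        gcongr
        exact norm_contourInt_le hbd
    _ = _ := by field_simp

/-- The traces of layer potentials with Hölder continuous densities are uniform limits of traces
of rational functions. -/
theorem traceZ_mem_exteriorTraces (ha0 : 0 < a) (ha1 : a < 1) (hρ : ρ ≠ 0) (hs : Separated Λ ρ)
    {m : Fin M → Circle → ℂ} (hm : ∀ j, CHolder a 0 fun t : ℝ => m j (Circle.exp t))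
    {T : C(Fin M × Circle, ℂ)} (hT : ∀ k τ, T (k, τ) = traceZ ρ Λ m k τ) :
    T ∈ exteriorTraces Λ ρ := by
  have hc := fun j => continuous_of_comp_exp ((hm j).continuous ha0)
  have hshrink : ∀ h : ℝ, 0 < h → |ρ / (1 + h)| < |ρ| := fun h hh => by
    rw [abs_div, abs_of_pos (by linarith : 0 < 1 + h)]
    exact div_lt_self (abs_pos.2 hρ) (by linarith)
  -- The limit, as the radius returns to ρ, of the potential of the j-th density on the k-th circle:
  -- singular for j = k, regular otherwise.
  let lim : Fin M → Fin M → ℝ → ℂ := fun k j θ =>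
    if j = k then cauchyS 1 (fun t => m k (Circle.exp t)) θ
    else layerPot ρ (Λ.ctr j) (m j) (Λ.ctr k + ρ * Circle.exp θ)
  have hlim : ∀ k θ, T (k, Circle.exp θ) = ∑ j, lim k j θ := by
    intro k θ
    rw [hT, traceZ_eq, ← Finset.add_sum_erase _ _ (Finset.mem_univ k)]
    congr 1
    · simp [lim]
    · refine Finset.sum_congr rfl fun j hj => ?_
      simp [lim, Finset.ne_of_mem_erase hj]
  have hbound : ∀ k j, ∃ C, 0 ≤ C ∧ ∀ h : ℝ, 0 < h → h ≤ 1 → ∀ θ : ℝ,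
      ‖layerPot (ρ / (1 + h)) (Λ.ctr j) (m j) (Λ.ctr k + ρ * Circle.exp θ) - lim k j θ‖
        ≤ C * h ^ a := by
    intro k j
    rcases eq_or_ne j k with rfl | hjk
    · obtain ⟨C, hC0, hC⟩ := (hm j).2.exists_nonneg
      have h5 : (0 : ℝ) < 1 - a := by linarith
      refine ⟨C * (π * (1 / a + 1 / (1 - a))), by positivity, fun h hh hh1 θ => ?_⟩
      rw [layerPot_self (hc j) hh hρ]
      simp only [lim, if_true]
      exact norm_cauchyS_sub_le ha0 ha1 ((hm j).continuous ha0)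
        (fun s _ => by simpa using hC (θ + s) θ) hh hh1
    · obtain ⟨C, hC0, hC⟩ := exists_layerPot_far_bound (hs j k hjk) (hc j)
      refine ⟨C, hC0, fun h hh hh1 θ => ?_⟩
      simp only [lim, if_neg hjk]
      refine (hC h hh _).trans (mul_le_mul_of_nonneg_left ?_ hC0)
      simpa using rpow_le_rpow_of_exponent_ge hh hh1 ha1.le
  choose C hC0 hC using hbound
  -- One shrunken radius serves all densities and all target circles; the sum of all constants C k j
  -- dominates each row.
  have happ : ∀ h : ℝ, 0 < h → h ≤ 1 → ∃ e ∈ exteriorTraces Λ ρ,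
      ‖T - e‖ ≤ (∑ k, ∑ j, C k j) * h ^ a := by
    intro h hh hh1
    choose e he hex using fun j => exists_layerPot_mem hs (hshrink h hh) j (hc j)
    refine ⟨∑ j, e j, sum_mem fun j _ => he j, ?_⟩
    have hha : 0 ≤ h ^ a := by positivity
    refine (ContinuousMap.norm_le _ (mul_nonneg (Finset.sum_nonneg fun k _ =>
      Finset.sum_nonneg fun j _ => hC0 k j) hha)).2 ?_
    rintro ⟨k, τ⟩
    obtain ⟨θ, rfl⟩ := exp_surjective τ
    rw [ContinuousMap.sub_apply, hlim, ContinuousMap.sum_apply, ← Finset.sum_sub_distrib]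
    refine (norm_sum_le _ _).trans ?_
    calc ∑ j, ‖lim k j θ - e j (k, Circle.exp θ)‖ ≤ ∑ j, C k j * h ^ a := by
          refine Finset.sum_le_sum fun j _ => ?_
          rw [hex, norm_sub_rev]
          exact hC k j h hh hh1 θ
      _ = (∑ j, C k j) * h ^ a := by rw [Finset.sum_mul]
      _ ≤ _ := mul_le_mul_of_nonneg_right (Finset.single_le_sum (f := fun k => ∑ j, C k j)
          (fun k _ => Finset.sum_nonneg fun j _ => hC0 k j) (Finset.mem_univ k)) hha
  rw [← SetLike.mem_coe, ← (isClosed_exteriorTraces (Λ := Λ) (ρ := ρ)).closure_eq,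
    Metric.mem_closure_iff]
  intro ε hε
  have hlim0 : Filter.Tendsto (fun h : ℝ => (∑ k, ∑ j, C k j) * h ^ a)
      (nhdsWithin 0 (Ioi 0)) (nhds 0) := by
    have h1 : Continuous fun h : ℝ => (∑ k, ∑ j, C k j) * h ^ a :=
      continuous_const.mul (continuous_id.rpow_const fun _ => Or.inr ha0.le)
    have h2 := h1.tendsto 0
    simp only [zero_rpow ha0.ne', mul_zero] at h2
    exact h2.mono_left nhdsWithin_le_nhds
  obtain ⟨h, hh1, hh2⟩ := ((hlim0.eventually (gt_mem_nhds hε)).and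
    (Ioc_mem_nhdsGT (zero_lt_one' ℝ))).exists
  obtain ⟨e, he, hTe⟩ := happ h hh2.1 hh2.2
  exact ⟨e, he, by rw [dist_eq_norm]; exact hTe.trans_lt hh1⟩

end PotentialTraces

end HollowVortex

end

open scoped NNReal ComplexConjugate

noncomputable section

namespace HollowVortex

/-! ### Conjugation, exact forms and the single circle -/

section ContourCalculus

open Real Set MeasureTheory Function

variable {a : ℝ} {M : ℕ} {Λ : Params M} {ρ : ℝ}

theorem contourInt_sum {ι : Type*} (s : Finset ι) {f : ι → Circle → ℂ}
    (hf : ∀ i ∈ s, Continuous (f i)) :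
    contourInt (fun τ => ∑ i ∈ s, f i τ) = ∑ i ∈ s, contourInt (f i) := by
  simp only [contourInt, Finset.sum_mul]
  refine intervalIntegral.integral_finsetSum fun i hi => ?_
  have := hf i hi
  exact (by fun_prop : Continuous fun θ : ℝ =>
    f i (Circle.exp θ) * (Complex.I * (Circle.exp θ : ℂ))).intervalIntegrable _ _

theorem conj_mul_self_circle (τ : Circle) : conj (τ : ℂ) * τ = 1 := by
  rw [mul_comm, Complex.mul_conj, Circle.normSq_coe, Complex.ofReal_one]

/-- Conjugation of a contour integral. -/
theorem contourInt_conj (f : Circle → ℂ) :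
    contourInt (fun τ => conj (τ : ℂ) ^ 2 * conj (f τ)) = -conj (contourInt f) := by
  have h : conj (contourInt f) = ∫ θ in (0 : ℝ)..(2 * π),
      conj (f (Circle.exp θ) * (Complex.I * (Circle.exp θ : ℂ))) := by
    rw [contourInt, intervalIntegral.integral_of_le (by positivity),
      intervalIntegral.integral_of_le (by positivity), integral_conj]
  rw [h, contourInt, ← intervalIntegral.integral_neg]
  refine intervalIntegral.integral_congr fun θ _ => ?_
  simp only [map_mul, Complex.conj_I]
  -- This is conj(dτ) = −conj τ² dτ, a consequence of conj τ · τ = 1.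
  linear_combination (conj (Circle.exp θ : ℂ) * conj (f (Circle.exp θ)) * Complex.I) *
    conj_mul_self_circle (Circle.exp θ)

theorem contourInt_deriv_eq_zero {g : ℝ → ℂ} {h : Circle → ℂ} (hp : Periodic g (2 * π))
    (hd : ∀ θ : ℝ, HasDerivAt g (h (Circle.exp θ) * (Complex.I * (Circle.exp θ : ℂ))) θ)
    (hc : Continuous h) : contourInt h = 0 := by
  rw [contourInt, intervalIntegral.integral_eq_sub_of_hasDerivAt (fun θ _ => hd θ)
    ((by fun_prop : Continuous fun θ : ℝ =>
      h (Circle.exp θ) * (Complex.I * (Circle.exp θ : ℂ))).intervalIntegrable _ _)]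
  have := hp 0
  rw [zero_add] at this
  rw [this, sub_self]

theorem contourInt_const (c : ℂ) : contourInt (fun _ => c) = 0 :=
  contourInt_deriv_eq_zero (g := fun θ => c * (Circle.exp θ : ℂ)) (fun θ => by simp)
    (fun θ => (hasDerivAt_circleExp θ).const_mul c) continuous_const

theorem contourInt_conj_coe : contourInt (fun τ => conj (τ : ℂ)) = 2 * π * Complex.I := by
  have : ∀ θ : ℝ, conj (Circle.exp θ : ℂ) * (Complex.I * (Circle.exp θ : ℂ)) = Complex.I :=
    fun θ => by linear_combination Complex.I * conj_mul_self_circle (Circle.exp θ)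
  simp only [contourInt, this, intervalIntegral.integral_const, sub_zero, Complex.real_smul]
  push_cast
  ring

theorem contourInt_inv_affine {b : ℂ} (hb : |ρ| < ‖b‖) :
    contourInt (fun τ => 1 / (b + ρ * τ)) = 0 := by
  have h0 : ∀ z : ℂ, ‖z‖ ≤ 1 → b + ρ * z ≠ 0 := by
    intro z hz h
    have h1 : ‖b‖ = |ρ| * ‖z‖ := by
      rw [eq_neg_of_add_eq_zero_left h, norm_neg, norm_mul, Complex.norm_real, Real.norm_eq_abs]
    nlinarith [abs_nonneg ρ]
  rw [contourInt_coe fun z => 1 / (b + ρ * z)]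
  refine Complex.circleIntegral_eq_zero_of_differentiable_on_off_countable zero_le_one
      countable_empty (f := fun z => 1 / (b + ρ * z)) ?_ ?_
  · exact ContinuousOn.div (by fun_prop) (by fun_prop) fun z hz =>
      h0 z (mem_closedBall_zero_iff.1 hz)
  · intro z hz
    exact DifferentiableAt.div (by fun_prop) (by fun_prop) (h0 z (mem_ball_zero_iff.1 hz.1).le)

/-- The integral of `conj f df` over a closed curve is imaginary. -/
theorem re_integral_conj_mul_deriv {f f' : ℝ → ℂ} (hd : ∀ θ, HasDerivAt f (f' θ) θ)
    (hc : Continuous f') (hp : Periodic f (2 * π)) :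
    (∫ θ in (0 : ℝ)..(2 * π), conj (f θ) * f' θ).re = 0 := by
  have hfc : Continuous f := continuous_iff_continuousAt.2 fun θ => (hd θ).continuousAt
  have h1 : (∫ θ in (0 : ℝ)..(2 * π), conj (f θ) * f' θ).re
      = ∫ θ in (0 : ℝ)..(2 * π), (conj (f θ) * f' θ).re := by
    have hi : IntervalIntegrable (fun θ => conj (f θ) * f' θ) volume 0 (2 * π) :=
      ((Complex.continuous_conj.comp hfc).mul hc).intervalIntegrable _ _
    exact (Complex.reCLM.intervalIntegral_comp_comm hi).symm
  -- The real part of conj f df is the differential of |f|²/2.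
  have h2 : ∀ θ, HasDerivAt (fun θ => Complex.normSq (f θ) / 2) ((conj (f θ) * f' θ).re) θ := by
    intro θ
    have hr := Complex.reCLM.hasFDerivAt.comp_hasDerivAt θ (hd θ)
    have hi := Complex.imCLM.hasFDerivAt.comp_hasDerivAt θ (hd θ)
    have := ((hr.mul hr).add (hi.mul hi)).div_const 2
    convert! this using 1
    simp
    ring
  rw [h1, intervalIntegral.integral_eq_sub_of_hasDerivAt (fun θ _ => h2 θ)]
  · have := hp 0
    rw [zero_add] at this
    rw [this, sub_self]
  · exact (Complex.continuous_re.comp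
      ((Complex.continuous_conj.comp hfc).mul hc)).intervalIntegrable _ _

/-- The integral of `|f|² conj f df` over a closed curve is imaginary. -/
theorem re_integral_normSq_mul_conj_mul_deriv {f f' : ℝ → ℂ} (hd : ∀ θ, HasDerivAt f (f' θ) θ)
    (hc : Continuous f') (hp : Periodic f (2 * π)) :
    (∫ θ in (0 : ℝ)..(2 * π), (f θ * conj (f θ)) * (conj (f θ) * f' θ)).re = 0 := by
  have hfc : Continuous f := continuous_iff_continuousAt.2 fun θ => (hd θ).continuousAt
  have hgc : Continuous fun θ => (f θ * conj (f θ)) * (conj (f θ) * f' θ) :=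
    (hfc.mul (Complex.continuous_conj.comp hfc)).mul
      ((Complex.continuous_conj.comp hfc).mul hc)
  have h1 : (∫ θ in (0 : ℝ)..(2 * π), (f θ * conj (f θ)) * (conj (f θ) * f' θ)).re
      = ∫ θ in (0 : ℝ)..(2 * π), ((f θ * conj (f θ)) * (conj (f θ) * f' θ)).re :=
    (Complex.reCLM.intervalIntegral_comp_comm (hgc.intervalIntegrable _ _)).symm
  -- The real part of |f|² conj f df is the differential of |f|⁴/4.
  have h2 : ∀ θ, HasDerivAt (fun θ => Complex.normSq (f θ) * Complex.normSq (f θ) / 4)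
      (((f θ * conj (f θ)) * (conj (f θ) * f' θ)).re) θ := by
    intro θ
    have hr := Complex.reCLM.hasFDerivAt.comp_hasDerivAt θ (hd θ)
    have hi := Complex.imCLM.hasFDerivAt.comp_hasDerivAt θ (hd θ)
    have h3 := (hr.mul hr).add (hi.mul hi)
    have := (h3.mul h3).div_const 4
    convert! this using 1
    simp
    ring
  rw [h1, intervalIntegral.integral_eq_sub_of_hasDerivAt (fun θ _ => h2 θ)]
  · have := hp 0
    rw [zero_add] at this
    rw [this, sub_self]
  · exact (Complex.continuous_re.comp hgc).intervalIntegrable _ _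

/-- The trace built from the undifferentiated densities is a periodic primitive. -/
theorem contourInt_traceZ_tDeriv (ha0 : 0 < a) (ha1 : a < 1) (hs : Separated Λ ρ)
    {φ : Fin M → Circle → ℝ} (hφ : ∀ j, CHolder a 1 (lift (φ j))) (i : Fin M) :
    contourInt (traceZ ρ Λ (fun j => tDeriv (φ j)) i) = 0 := by
  refine contourInt_deriv_eq_zero
    (g := fun t : ℝ => traceZ ρ Λ (fun j σ => (φ j σ : ℂ)) i (Circle.exp t)) (exp_periodic _)
    (fun θ => ?_)
    (continuous_traceZ ha0 ha1 hs (fun j => cHolder_tDeriv ha0 ha1.le (hφ j)) i)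
  have := hasDerivAt_traceZ ha0 ha1 hs hφ i θ
  rwa [mul_comm] at this

/-! The case of a single circle. -/

/-- A single vortex at the origin. -/
def unitParams : Params 1 := (0, 0, 0, 0)

theorem separated_unitParams : Separated unitParams 1 := fun j k hjk =>
  absurd (Subsingleton.elim j k) hjk

/-- At ρ = 0 the foreign terms vanish and the self-induced term does not involve ρ. It can thus be
read as the trace on one circle of radius 1, where the residue calculus for nonzero radius is
available. -/
theorem traceZ_zero (Λ : Params M) (m : Fin M → Circle → ℂ) (k : Fin M) (τ : Circle) :
    traceZ 0 Λ m k τ = traceZ 1 unitParams (fun _ => m k) 0 τ := by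
  simp [traceZ, contourInt]

/-- The exterior trace of the self-induced potential is orthogonal to negative powers. -/
theorem contourInt_traceZ_zero_mul_conj_pow (ha0 : 0 < a) (ha1 : a < 1) (Λ : Params M)
    {m : Fin M → Circle → ℂ} (k : Fin M)
    (hm : CHolder a 0 fun t : ℝ => m k (Circle.exp t)) (n : ℕ) :
    contourInt (fun τ => traceZ 0 Λ m k τ * conj (τ : ℂ) ^ (n + 1)) = 0 := by
  simp only [traceZ_zero]
  have hcont := continuous_traceZ (Λ := unitParams) (ρ := 1) ha0 ha1 separated_unitParams
    (m := fun _ => m k) (fun _ => hm) 0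
  let T : C(Fin 1 × Circle, ℂ) := ⟨fun x => traceZ 1 unitParams (fun _ => m k) 0 x.2, by fun_prop⟩
  have hT : T ∈ exteriorTraces unitParams 1 :=
    traceZ_mem_exteriorTraces (Λ := unitParams) (ρ := 1) ha0 ha1 one_ne_zero separated_unitParams
      (m := fun _ => m k) (fun _ => hm) (fun i τ => by
        rw [Subsingleton.elim i 0]
        rfl)
  -- On the unit circle conj τ = 1/τ, the trace of a simple pole at the centre; its powers times an
  -- exterior trace are exterior traces again.
  let e : C(Fin 1 × Circle, ℂ) := ⟨fun x => conj (x.2 : ℂ), by fun_prop⟩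
  have he : e ∈ exteriorTraces unitParams 1 := by
    refine poleTrace_mem ⟨0, ⟨0, by simp [Params.ctr, unitParams]⟩, fun x => ?_⟩
    have h0 : (x.2 : ℂ) ≠ 0 := Circle.coe_ne_zero _
    have h1 := conj_mul_self_circle x.2
    simp only [e, ContinuousMap.coe_mk, bdryPt, Params.ctr, unitParams]
    simp only [Pi.zero_apply, zero_add, Complex.ofReal_one, one_mul, sub_zero]
    exact eq_inv_of_mul_eq_one_left h1
  have hpow : ∀ n : ℕ, T * e ^ n ∈ exteriorTraces unitParams 1 := by
    intro n
    induction n with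
    | zero => simpa using hT
    | succ n ih =>
      rw [pow_succ, ← mul_assoc]
      exact mul_mem ih he
  have key := circlesInt_mul_eq_zero one_ne_zero separated_unitParams (hpow n) he
  rw [mul_assoc, ← pow_succ] at key
  simpa [circlesInt, T, e] using key

end ContourCalculus

end HollowVortex

end

open scoped NNReal ComplexConjugate

noncomputable section

namespace HollowVortex

/-! ### Regularity of the traces and of the residuals -/

section State

open Real Set MeasureTheory Function

variable {a : ℝ} {M ℓ : ℕ} {α : ℝ≥0} {Λ : Params M} {ρ : ℝ} {u : XSpace M ℓ α}

theorem CHolder.of_le {E : Type*} [NormedAddCommGroup E] [NormedSpace ℝ E] (ha0 : 0 < a)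
    (ha1 : a ≤ 1) {g : ℝ → E} {j k : ℕ} (hjk : j ≤ k) (h : CHolder a k g) : CHolder a j g := by
  induction k, hjk using Nat.le_induction with
  | base => exact h
  | succ k _ ih => exact ih (h.of_succ ha0 ha1)

theorem cHolder_lift (hα : 0 < α) (φ : HolderFun ℓ α) : CHolder α ℓ (lift φ) :=
  (cHolder_iff hα (lift_periodic _)).2 φ.2

theorem cHolder_mu (hα : 0 < α) (u : XSpace M ℓ α) (j : Fin M) :
    CHolder α ℓ (lift (u.mu j)) := cHolder_lift hα _

theorem cHolder_nu (hα : 0 < α) (u : XSpace M ℓ α) (j : Fin M) :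
    CHolder α ℓ (lift (u.nu j)) := cHolder_lift hα _

/-- The trace of the derivative of the conformal map. -/
def confDeriv (u : XSpace M ℓ α) (ρ : ℝ) (k : Fin M) (τ : Circle) : ℂ := 1 + ρ * zMu' u ρ k τ

/-- The trace of the conformal map. -/
def confMap (u : XSpace M ℓ α) (ρ : ℝ) (k : Fin M) (τ : Circle) : ℂ :=
  u.par.ctr k + ρ * τ + ρ ^ 2 * zMu u ρ k τ

theorem cHolder_zMu (hα0 : 0 < α) (hα1 : α < 1) (hs : Separated u.par ρ) (k : Fin M) :
    CHolder α ℓ fun t : ℝ => zMu u ρ k (Circle.exp t) :=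
  cHolder_traceZ (by exact_mod_cast hα0) (by exact_mod_cast hα1) hs
    (fun j => cHolder_ofReal (cHolder_mu hα0 u j)) k

theorem hasDerivAt_zMu (hα0 : 0 < α) (hα1 : α < 1) (hℓ : 1 ≤ ℓ) (hs : Separated u.par ρ)
    (k : Fin M) (θ : ℝ) : HasDerivAt (fun t : ℝ => zMu u ρ k (Circle.exp t))
      (Complex.I * Circle.exp θ * zMu' u ρ k (Circle.exp θ)) θ :=
  hasDerivAt_traceZ (by exact_mod_cast hα0) (by exact_mod_cast hα1) hs
    (fun j => (cHolder_mu hα0 u j).of_le (by exact_mod_cast hα0) (by exact_mod_cast hα1.le) hℓ) k θ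

theorem cHolder_zMu' (hα0 : 0 < α) (hα1 : α < 1) (hℓ : 1 ≤ ℓ) (hs : Separated u.par ρ)
    (k : Fin M) : CHolder α (ℓ - 1) fun t : ℝ => zMu' u ρ k (Circle.exp t) := by
  refine cHolder_traceZ (by exact_mod_cast hα0) (by exact_mod_cast hα1) hs (fun j => ?_) k
  refine cHolder_tDeriv (by exact_mod_cast hα0) (by exact_mod_cast hα1.le) ?_
  rw [Nat.sub_add_cancel hℓ]
  exact cHolder_mu hα0 u j

theorem cHolder_zNu' (hα0 : 0 < α) (hα1 : α < 1) (hℓ : 1 ≤ ℓ) (hs : Separated u.par ρ)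
    (k : Fin M) : CHolder α (ℓ - 1) fun t : ℝ => zNu' u ρ k (Circle.exp t) := by
  refine cHolder_traceZ (by exact_mod_cast hα0) (by exact_mod_cast hα1) hs (fun j => ?_) k
  refine cHolder_tDeriv (by exact_mod_cast hα0) (by exact_mod_cast hα1.le) ?_
  rw [Nat.sub_add_cancel hℓ]
  exact cHolder_nu hα0 u j

theorem continuous_zMu (hα0 : 0 < α) (hα1 : α < 1) (hs : Separated u.par ρ) (k : Fin M) :
    Continuous (zMu u ρ k) :=
  continuous_of_comp_exp ((cHolder_zMu hα0 hα1 hs k).continuous (by exact_mod_cast hα0))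

theorem continuous_zMu' (hα0 : 0 < α) (hα1 : α < 1) (hℓ : 1 ≤ ℓ) (hs : Separated u.par ρ)
    (k : Fin M) : Continuous (zMu' u ρ k) :=
  continuous_of_comp_exp ((cHolder_zMu' hα0 hα1 hℓ hs k).continuous (by exact_mod_cast hα0))

theorem continuous_zNu' (hα0 : 0 < α) (hα1 : α < 1) (hℓ : 1 ≤ ℓ) (hs : Separated u.par ρ)
    (k : Fin M) : Continuous (zNu' u ρ k) :=
  continuous_of_comp_exp ((cHolder_zNu' hα0 hα1 hℓ hs k).continuous (by exact_mod_cast hα0))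

theorem continuous_confMap (hα0 : 0 < α) (hα1 : α < 1) (hs : Separated u.par ρ) (k : Fin M) :
    Continuous (confMap u ρ k) := by
  have := continuous_zMu hα0 hα1 hs k
  unfold confMap
  fun_prop

theorem continuous_confDeriv (hα0 : 0 < α) (hα1 : α < 1) (hℓ : 1 ≤ ℓ) (hs : Separated u.par ρ)
    (k : Fin M) : Continuous (confDeriv u ρ k) := by
  have := continuous_zMu' hα0 hα1 hℓ hs k
  unfold confDeriv
  fun_prop

theorem ctr_add_sub_ne_zero (hs : Separated Λ ρ) {j k : Fin M} (hjk : j ≠ k) (τ : Circle) :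
    Λ.ctr k + ρ * τ - Λ.ctr j ≠ 0 :=
  norm_pos_iff.1 ((abs_nonneg ρ).trans_lt (abs_lt_norm_of_sep (hs j k hjk) τ))

theorem cHolder_w0Rest (ha0 : 0 < a) (ha1 : a ≤ 1) (hs : Separated Λ ρ) (k : Fin M) (n : ℕ) :
    CHolder a n fun t : ℝ => w0Rest Λ ρ k (Circle.exp t) := by
  unfold w0Rest
  refine CHolder.sum _ fun j hj => ?_
  refine CHolder.const_mul ha0 ha1 _ ?_
  simp only [one_div]
  exact (((CHolder.const _).add ((cHolder_exp ha0 ha1).const_mul ha0 ha1 _)).sub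
    (CHolder.const _)).inv ha0 ha1 fun t => ctr_add_sub_ne_zero hs (Finset.ne_of_mem_erase hj) _

theorem continuous_w0Rest (hs : Separated Λ ρ) (k : Fin M) : Continuous (w0Rest Λ ρ k) :=
  continuous_of_comp_exp ((cHolder_w0Rest one_pos le_rfl hs k 0).continuous one_pos)

theorem contourInt_w0Rest (hs : Separated Λ ρ) (k : Fin M) : contourInt (w0Rest Λ ρ k) = 0 := by
  unfold w0Rest
  rw [contourInt_sum]
  · refine Finset.sum_eq_zero fun j hj => ?_
    rw [contourInt_const_mul]
    have h : ∀ τ : Circle, Λ.ctr k + ρ * τ - Λ.ctr j = Λ.ctr k - Λ.ctr j + ρ * τ :=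
      fun τ => by ring
    have h2 := hs k j (Finset.ne_of_mem_erase hj).symm
    simp only [h]
    rw [contourInt_inv_affine (by linarith [abs_nonneg ρ]), mul_zero]
  · intro j hj
    exact continuous_const.mul (Continuous.div (by fun_prop) (by fun_prop) fun τ =>
      ctr_add_sub_ne_zero hs (Finset.ne_of_mem_erase hj) τ)

theorem contourInt_zNu' (hα0 : 0 < α) (hα1 : α < 1) (hℓ : 1 ≤ ℓ) (hs : Separated u.par ρ)
    (k : Fin M) : contourInt (zNu' u ρ k) = 0 :=
  contourInt_traceZ_tDeriv (a := α) (by exact_mod_cast hα0) (by exact_mod_cast hα1) hs (fun j =>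
    (cHolder_nu hα0 u j).of_le (by exact_mod_cast hα0) (by exact_mod_cast hα1.le) hℓ) k

theorem contourInt_zMu' (hα0 : 0 < α) (hα1 : α < 1) (hℓ : 1 ≤ ℓ) (hs : Separated u.par ρ)
    (k : Fin M) : contourInt (zMu' u ρ k) = 0 :=
  contourInt_traceZ_tDeriv (a := α) (by exact_mod_cast hα0) (by exact_mod_cast hα1) hs (fun j =>
    (cHolder_mu hα0 u j).of_le (by exact_mod_cast hα0) (by exact_mod_cast hα1.le) hℓ) k

theorem contourInt_confDeriv (hα0 : 0 < α) (hα1 : α < 1) (hℓ : 1 ≤ ℓ) (hs : Separated u.par ρ)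
    (k : Fin M) : contourInt (confDeriv u ρ k) = 0 := by
  have hc := continuous_zMu' hα0 hα1 hℓ hs k
  unfold confDeriv
  rw [contourInt_add continuous_const (by fun_prop), contourInt_const, contourInt_const_mul,
    contourInt_zMu' hα0 hα1 hℓ hs, mul_zero, add_zero]

theorem hasDerivAt_confMap (hα0 : 0 < α) (hα1 : α < 1) (hℓ : 1 ≤ ℓ) (hs : Separated u.par ρ)
    (k : Fin M) (θ : ℝ) : HasDerivAt (fun t : ℝ => confMap u ρ k (Circle.exp t))
      (ρ * (confDeriv u ρ k (Circle.exp θ) * (Complex.I * Circle.exp θ))) θ := by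
  have h := (((hasDerivAt_circleExp θ).const_mul (ρ : ℂ)).const_add (u.par.ctr k)).add
    ((hasDerivAt_zMu hα0 hα1 hℓ hs k θ).const_mul ((ρ : ℂ) ^ 2))
  convert! h using 1
  rw [confDeriv]
  ring

/-- Up to the factor ρ this is the integral of conj f df, an imaginary multiple of the enclosed
signed area. At ρ = 0 the integrand is constant and ∫ dτ = 0. -/
theorem re_contourInt_conj_confMap (hα0 : 0 < α) (hα1 : α < 1) (hℓ : 1 ≤ ℓ)
    (hs : Separated u.par ρ) (k : Fin M) :
    (contourInt fun τ => conj (confMap u ρ k τ) * confDeriv u ρ k τ).re = 0 := by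
  rcases eq_or_ne ρ 0 with rfl | hρ
  · simp [confMap, confDeriv, contourInt_const]
  have hcF := continuous_confDeriv hα0 hα1 hℓ hs k
  have h := re_integral_conj_mul_deriv (fun θ => hasDerivAt_confMap hα0 hα1 hℓ hs k θ)
    (by fun_prop) (exp_periodic _)
  have e : ∫ θ in (0 : ℝ)..(2 * π), conj (confMap u ρ k (Circle.exp θ)) *
      (ρ * (confDeriv u ρ k (Circle.exp θ) * (Complex.I * Circle.exp θ)))
      = ρ * contourInt fun τ => conj (confMap u ρ k τ) * confDeriv u ρ k τ := by
    rw [contourInt, ← intervalIntegral.integral_const_mul]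
    refine intervalIntegral.integral_congr fun θ _ => ?_
    ring
  rw [e, Complex.re_ofReal_mul] at h
  exact (mul_eq_zero.1 h).resolve_left hρ

theorem re_contourInt_normSq_confMap (hα0 : 0 < α) (hα1 : α < 1) (hℓ : 1 ≤ ℓ) (hρ : ρ ≠ 0)
    (hs : Separated u.par ρ) (k : Fin M) :
    (contourInt fun τ => confMap u ρ k τ * conj (confMap u ρ k τ) *
      (conj (confMap u ρ k τ) * confDeriv u ρ k τ)).re = 0 := by
  have hcF := continuous_confDeriv hα0 hα1 hℓ hs k
  have h := re_integral_normSq_mul_conj_mul_deriv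
    (fun θ => hasDerivAt_confMap hα0 hα1 hℓ hs k θ) (by fun_prop) (exp_periodic _)
  have e : ∫ θ in (0 : ℝ)..(2 * π), confMap u ρ k (Circle.exp θ) *
      conj (confMap u ρ k (Circle.exp θ)) * (conj (confMap u ρ k (Circle.exp θ)) *
      (ρ * (confDeriv u ρ k (Circle.exp θ) * (Complex.I * Circle.exp θ))))
      = ρ * contourInt fun τ => confMap u ρ k τ * conj (confMap u ρ k τ) *
      (conj (confMap u ρ k τ) * confDeriv u ρ k τ) := by
    rw [contourInt, ← intervalIntegral.integral_const_mul]
    refine intervalIntegral.integral_congr fun θ _ => ?_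
    ring
  rw [e, Complex.re_ofReal_mul] at h
  exact (mul_eq_zero.1 h).resolve_left hρ

/-! The residuals. -/

/-- Factored form of the expanded definition: the relative velocity multiplied by the derivative of
the conformal map, with the k-th pole removed. The integral identities are read off from it. -/
theorem kinExpr_eq (u : XSpace M ℓ α) (ρ : ℝ) (k : Fin M) (τ : Circle) :
    kinExpr u ρ k τ = zNu' u ρ k τ + w0Rest u.par ρ k τ
      + (Complex.I * u.par.angVel * conj (confMap u ρ k τ) - u.par.speed) * confDeriv u ρ k τ := by
  rw [kinExpr, relVel, confMap, confDeriv]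
  simp only [map_add, map_mul, map_pow, Complex.conj_ofReal]
  ring

theorem continuous_kinExpr (hα0 : 0 < α) (hα1 : α < 1) (hℓ : 1 ≤ ℓ) (hs : Separated u.par ρ)
    (k : Fin M) : Continuous (kinExpr u ρ k) := by
  have h1 := continuous_zNu' hα0 hα1 hℓ hs k
  have h2 := continuous_w0Rest hs k
  have h3 := continuous_confMap hα0 hα1 hs k
  have h4 := continuous_confDeriv hα0 hα1 hℓ hs k
  have : kinExpr u ρ k = fun τ => zNu' u ρ k τ + w0Rest u.par ρ k τ
      + (Complex.I * u.par.angVel * conj (confMap u ρ k τ) - u.par.speed) * confDeriv u ρ k τ :=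
    funext (kinExpr_eq u ρ k)
  rw [this]
  fun_prop

/-- Every contribution integrates to zero except that of iΩ conj f F, and iΩ times an imaginary
number is real. This is the mean-zero condition for the kinematic residual. -/
theorem im_contourInt_kinExpr (hα0 : 0 < α) (hα1 : α < 1) (hℓ : 1 ≤ ℓ)
    (hs : Separated u.par ρ) (k : Fin M) : (contourInt (kinExpr u ρ k)).im = 0 := by
  have h1 := continuous_zNu' hα0 hα1 hℓ hs k
  have h2 := continuous_w0Rest hs k
  have h3 := continuous_confMap hα0 hα1 hs k
  have h4 := continuous_confDeriv hα0 hα1 hℓ hs k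
  have e : kinExpr u ρ k = fun τ => (zNu' u ρ k τ + w0Rest u.par ρ k τ)
      + ((Complex.I * u.par.angVel) * (conj (confMap u ρ k τ) * confDeriv u ρ k τ)
        - u.par.speed * confDeriv u ρ k τ) := by
    funext τ
    rw [kinExpr_eq]
    ring
  rw [e, contourInt_add (by fun_prop) (by fun_prop), contourInt_add h1 h2,
    contourInt_sub (by fun_prop) (by fun_prop), contourInt_const_mul, contourInt_const_mul,
    contourInt_zNu' hα0 hα1 hℓ hs, contourInt_w0Rest hs, contourInt_confDeriv hα0 hα1 hℓ hs]
  have := re_contourInt_conj_confMap hα0 hα1 hℓ hs k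
  simp [mul_assoc, this]

theorem cHolder_confMap (hα0 : 0 < α) (hα1 : α < 1) (hs : Separated u.par ρ) (k : Fin M) :
    CHolder α ℓ fun t : ℝ => confMap u ρ k (Circle.exp t) := by
  have ha0 : (0 : ℝ) < α := by exact_mod_cast hα0
  have ha1 : (α : ℝ) ≤ 1 := by exact_mod_cast hα1.le
  exact ((CHolder.const _).add ((cHolder_exp ha0 ha1).const_mul ha0 ha1 _)).add
    ((cHolder_zMu hα0 hα1 hs k).const_mul ha0 ha1 _)

theorem cHolder_confDeriv (hα0 : 0 < α) (hα1 : α < 1) (hℓ : 1 ≤ ℓ) (hs : Separated u.par ρ)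
    (k : Fin M) : CHolder α (ℓ - 1) fun t : ℝ => confDeriv u ρ k (Circle.exp t) := by
  have ha0 : (0 : ℝ) < α := by exact_mod_cast hα0
  have ha1 : (α : ℝ) ≤ 1 := by exact_mod_cast hα1.le
  exact (CHolder.const _).add ((cHolder_zMu' hα0 hα1 hℓ hs k).const_mul ha0 ha1 _)

theorem CHolder.conj {k : ℕ} {f : ℝ → ℂ} (hf : CHolder a k f) :
    CHolder a k fun t => (starRingEnd ℂ) (f t) :=
  hf.clm_comp (Complex.conjCLE : ℂ →L[ℝ] ℂ)

theorem CHolder.re {k : ℕ} {f : ℝ → ℂ} (hf : CHolder a k f) : CHolder a k fun t => (f t).re :=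
  hf.clm_comp Complex.reCLM

theorem cHolder_kinExpr (hα0 : 0 < α) (hα1 : α < 1) (hℓ : 1 ≤ ℓ) (hs : Separated u.par ρ)
    (k : Fin M) : CHolder α (ℓ - 1) fun t : ℝ => kinExpr u ρ k (Circle.exp t) := by
  have ha0 : (0 : ℝ) < α := by exact_mod_cast hα0
  have ha1 : (α : ℝ) ≤ 1 := by exact_mod_cast hα1.le
  simp only [kinExpr_eq]
  exact ((cHolder_zNu' hα0 hα1 hℓ hs k).add (cHolder_w0Rest ha0 ha1 hs k _)).add
    (((((cHolder_confMap hα0 hα1 hs k).of_le ha0 ha1 (Nat.sub_le ℓ 1)).conj.const_mul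
      ha0 ha1 _).sub (CHolder.const _)).mul ha0 ha1 (cHolder_confDeriv hα0 hα1 hℓ hs k))

theorem cHolder_opA (hα0 : 0 < α) (hα1 : α < 1) (hℓ : 1 ≤ ℓ) (hs : Separated u.par ρ)
    (k : Fin M) : CHolder α (ℓ - 1) (lift (opA u ρ k)) := by
  have ha0 : (0 : ℝ) < α := by exact_mod_cast hα0
  have ha1 : (α : ℝ) ≤ 1 := by exact_mod_cast hα1.le
  exact ((cHolder_exp ha0 ha1).mul ha0 ha1 (cHolder_kinExpr hα0 hα1 hℓ hs k)).re

/-- Squared moduli are written as z · conj z inside one real part, so that the Hölder calculus for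
complex products and inverses applies. -/
theorem bernoulliOp_eq_re (u : XSpace M ℓ α) (ρ : ℝ) (k : Fin M) (τ : Circle) :
    bernoulliOp u ρ k τ = ((2 * (conj ((u.par.circ k : ℂ) / (2 * π * Complex.I * τ))
          * kinExpr u ρ k τ)
    + ρ * (kinExpr u ρ k τ * conj (kinExpr u ρ k τ))
    - (u.par.circ k : ℂ) ^ 2 / (4 * π ^ 2)
        * (2 * zMu' u ρ k τ + ρ * (zMu' u ρ k τ * conj (zMu' u ρ k τ))))
    * (confDeriv u ρ k τ * conj (confDeriv u ρ k τ))⁻¹).re := by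
  have h1 : ((confDeriv u ρ k τ * conj (confDeriv u ρ k τ))⁻¹ : ℂ)
      = ((‖confDeriv u ρ k τ‖ ^ 2)⁻¹ : ℝ) := by
    rw [Complex.mul_conj, Complex.normSq_eq_norm_sq, Complex.ofReal_inv]
  have h2 : (u.par.circ k : ℂ) ^ 2 / (4 * π ^ 2)
      = ((u.par.circ k ^ 2 / (4 * π ^ 2) : ℝ) : ℂ) := by push_cast; ring
  rw [h1, h2, Complex.mul_conj, Complex.mul_conj, Complex.normSq_eq_norm_sq,
    Complex.normSq_eq_norm_sq, Complex.re_mul_ofReal, Complex.sub_re, Complex.add_re,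
    Complex.re_ofReal_mul, Complex.re_ofReal_mul, Complex.add_re, Complex.re_ofReal_mul,
    Complex.ofReal_re, Complex.ofReal_re, bernoulliOp, confDeriv, div_eq_mul_inv]
  simp only [Complex.mul_re, Complex.re_ofNat, Complex.im_ofNat, zero_mul, sub_zero]

theorem cHolder_opB (hα0 : 0 < α) (hα1 : α < 1) (hℓ : 1 ≤ ℓ) (hs : Separated u.par ρ)
    (k : Fin M) (hF : ∀ τ, confDeriv u ρ k τ ≠ 0) : CHolder α (ℓ - 1) (lift (opB u ρ k)) := by
  have ha0 : (0 : ℝ) < α := by exact_mod_cast hα0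
  have ha1 : (α : ℝ) ≤ 1 := by exact_mod_cast hα1.le
  have hK := cHolder_kinExpr hα0 hα1 hℓ hs k
  have hD := cHolder_zMu' hα0 hα1 hℓ hs k
  have hFr := cHolder_confDeriv hα0 hα1 hℓ hs k
  have hpole : CHolder (α : ℝ) (ℓ - 1) fun t : ℝ =>
      conj ((u.par.circ k : ℂ) / (2 * π * Complex.I * Circle.exp t)) := by
    simp only [div_eq_mul_inv]
    exact (((((cHolder_exp ha0 ha1).const_mul ha0 ha1 _).inv ha0 ha1 fun t =>
      mul_ne_zero Complex.two_pi_I_ne_zero (Circle.coe_ne_zero _))).const_mul ha0 ha1 _).conj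
  have h1 := (((hpole.mul ha0 ha1 hK).const_mul ha0 ha1 2).add
    ((hK.mul ha0 ha1 hK.conj).const_mul ha0 ha1 ρ)).sub
    (((hD.const_mul ha0 ha1 2).add ((hD.mul ha0 ha1 hD.conj).const_mul ha0 ha1 ρ)).const_mul
      ha0 ha1 ((u.par.circ k : ℂ) ^ 2 / (4 * π ^ 2)))
  have h2 := (hFr.mul ha0 ha1 hFr.conj).inv ha0 ha1 fun t =>
    mul_ne_zero (hF _) ((map_ne_zero _).2 (hF _))
  have h3 := ((h1.mul ha0 ha1 h2).re).sub (CHolder.const (u.bern k))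
  have e : lift (opB u ρ k) = fun t : ℝ => bernoulliOp u ρ k (Circle.exp t) - u.bern k := rfl
  rw [e]
  simp only [bernoulliOp_eq_re]
  exact h3

theorem integral_opA (hα0 : 0 < α) (hα1 : α < 1) (hℓ : 1 ≤ ℓ)
    (hs : Separated u.par ρ) (k : Fin M) :
    ∫ θ in (0 : ℝ)..(2 * π), lift (opA u ρ k) θ = 0 := by
  have hc := continuous_kinExpr hα0 hα1 hℓ hs k
  -- Re(τK) dθ is the imaginary part of K dτ, because dτ = iτ dθ.
  have h1 : ∀ θ : ℝ, lift (opA u ρ k) θ = Complex.imCLM (kinExpr u ρ k (Circle.exp θ) *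
      (Complex.I * (Circle.exp θ : ℂ))) := by
    intro θ
    simp only [lift, opA, Complex.imCLM_apply, Complex.mul_re, Complex.mul_im, Complex.I_re,
      Complex.I_im]
    ring
  simp only [h1]
  rw [Complex.imCLM.intervalIntegral_comp_comm
    ((by fun_prop : Continuous fun θ : ℝ => kinExpr u ρ k (Circle.exp θ) *
      (Complex.I * (Circle.exp θ : ℂ))).intervalIntegrable _ _)]
  exact im_contourInt_kinExpr hα0 hα1 hℓ hs k

/-- The residuals as an element of the space of residuals. -/
theorem exists_residual (hα0 : 0 < α) (hα1 : α < 1) (hℓ : 1 ≤ ℓ) (hs : Separated u.par ρ)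
    (hF : ∀ k τ, confDeriv u ρ k τ ≠ 0) : ∃ Y : YSpace M ℓ α,
      (∀ k τ, Y.kin k τ = opA u ρ k τ) ∧ ∀ k τ, Y.dyn k τ = opB u ρ k τ :=
  ⟨(fun k => ⟨⟨opA u ρ k, (cHolder_iff hα0 (lift_periodic _)).1 (cHolder_opA hα0 hα1 hℓ hs k)⟩,
      integral_opA hα0 hα1 hℓ hs k⟩,
    fun k => ⟨opB u ρ k, (cHolder_iff hα0 (lift_periodic _)).1
      (cHolder_opB hα0 hα1 hℓ hs k (hF k))⟩), fun _ _ => rfl, fun _ _ => rfl⟩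

end State

end HollowVortex

end

open scoped NNReal ComplexConjugate

noncomputable section

namespace HollowVortex

/-! ### The identities for nonzero radius -/

section Identities

open Real Set MeasureTheory Function

variable {a : ℝ} {M ℓ : ℕ} {α : ℝ≥0} {Λ : Params M} {ρ : ℝ} {u : XSpace M ℓ α}

/-- Residues at infinity, with 1/(1 + d) = 1 + g and g an exterior trace. The first integrand is w ·
(w + wg), a product of two elements. In the second, ζw = c + q isolates the coefficient c of 1/ζ in
w at infinity. -/
theorem circlesInt_sq_div (hρ : ρ ≠ 0) (hs : Separated Λ ρ) {w d z q : C(Fin M × Circle, ℂ)}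
    (hw : w ∈ exteriorTraces Λ ρ) (hd : d ∈ exteriorTraces Λ ρ) (hz : z ∈ exteriorTraces Λ ρ)
    (hq : q ∈ exteriorTraces Λ ρ) (hd1 : ‖d‖ < 1) {c : ℂ}
    (hc : ∀ x, bdryPt Λ ρ x * w x = c + q x) :
    circlesInt (fun x => w x ^ 2 / (1 + d x)) = 0 ∧
      circlesInt (fun x => w x ^ 2 * (bdryPt Λ ρ x + z x) / (1 + d x)) = c * circlesInt w := by
  have h0 : ∀ x, 1 + d x ≠ 0 := by
    intro x h
    have h1 : ‖d x‖ = 1 := by rw [eq_neg_of_add_eq_zero_right h, norm_neg, norm_one]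
    linarith [d.norm_coe_le_norm x]
  let g : C(Fin M × Circle, ℂ) := ⟨fun x => (1 + d x)⁻¹ - 1, by
    exact (Continuous.inv₀ (by fun_prop) h0).sub continuous_const⟩
  have hg : g ∈ exteriorTraces Λ ρ := by
    refine mem_exteriorTraces_of_inverse hd hd1 fun x => ?_
    have := h0 x
    simp only [g, ContinuousMap.coe_mk]
    field_simp
    ring
  have hwg : w + w * g ∈ exteriorTraces Λ ρ := add_mem hw (mul_mem hw hg)
  refine ⟨?_, ?_⟩
  · rw [← circlesInt_mul_eq_zero hρ hs hw hwg]
    congr 1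
    funext x
    have := h0 x
    simp only [g, ContinuousMap.mul_apply, ContinuousMap.add_apply, ContinuousMap.coe_mk]
    field_simp
    ring
  -- After substituting c + q for ζw, every term except c · w is a product of two exterior traces.
  · have e : (fun x => w x ^ 2 * (bdryPt Λ ρ x + z x) / (1 + d x))
        = ((c • w + c • (w * g)) + (q * (w + w * g) + (w * z) * (w + w * g)) :
          C(Fin M × Circle, ℂ)) := by
      funext x
      have := h0 x
      have hcx := hc x
      simp only [g, ContinuousMap.mul_apply, ContinuousMap.add_apply, ContinuousMap.coe_mk,
        ContinuousMap.smul_apply, smul_eq_mul]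
      field_simp
      linear_combination (w x) * hcx
    rw [e, circlesInt_add, circlesInt_add, circlesInt_add, circlesInt_smul, circlesInt_smul,
      circlesInt_mul_eq_zero hρ hs hw hg, circlesInt_mul_eq_zero hρ hs hq hwg,
      circlesInt_mul_eq_zero hρ hs (mul_mem hw hz) hwg]
    ring

/-- The total circulation. -/
def totalCirc (Λ : Params M) : ℝ := ∑ j, Λ.circ j

/-- The trace of the derivative of the complex potential. -/
def potDeriv (u : XSpace M ℓ α) (ρ : ℝ) (x : Fin M × Circle) : ℂ :=
  w0Deriv u.par (bdryPt u.par ρ x) + zNu' u ρ x.1 x.2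

theorem ctr_mem_discs (hρ : ρ ≠ 0) (j : Fin M) : Λ.ctr j ∈ discs Λ ρ :=
  ⟨j, by simpa using hρ⟩

/-- The trace of the pole at the `j`-th centre. -/
def centrePole (hρ : ρ ≠ 0) (hs : Separated Λ ρ) (j : Fin M) : C(Fin M × Circle, ℂ) :=
  ⟨fun x => (bdryPt Λ ρ x - Λ.ctr j)⁻¹,
    Continuous.inv₀ (by fun_prop) (bdryPt_sub_ne_zero hs (ctr_mem_discs hρ j))⟩

theorem centrePole_mem (hρ : ρ ≠ 0) (hs : Separated Λ ρ) (j : Fin M) :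
    centrePole hρ hs j ∈ exteriorTraces Λ ρ :=
  poleTrace_mem ⟨_, ctr_mem_discs hρ j, fun _ => rfl⟩

theorem circlesInt_sum {ι : Type*} (s : Finset ι) (f : ι → C(Fin M × Circle, ℂ)) :
    circlesInt (∑ i ∈ s, f i : C(Fin M × Circle, ℂ)) = ∑ i ∈ s, circlesInt (f i) := by
  classical
  induction s using Finset.induction_on with
  | empty => simpa using circlesInt_zero (M := M)
  | insert i s hi ih => rw [Finset.sum_insert hi, Finset.sum_insert hi, circlesInt_add, ih]

/-- The potentials that enter the identities are exterior traces. -/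
theorem potential_identities (hα0 : 0 < α) (hα1 : α < 1) (hℓ : 1 ≤ ℓ) (hρ : ρ ≠ 0)
    (hs : Separated u.par ρ) (hD : ∃ r < 1, ∀ k τ, ‖ρ * zMu' u ρ k τ‖ ≤ r) :
    Continuous (potDeriv u ρ) ∧ circlesInt (potDeriv u ρ) = totalCirc u.par / ρ ∧
    circlesInt (fun x => potDeriv u ρ x ^ 2 / confDeriv u ρ x.1 x.2) = 0 ∧
    circlesInt (fun x => potDeriv u ρ x ^ 2 * confMap u ρ x.1 x.2 / confDeriv u ρ x.1 x.2)
      = totalCirc u.par / (2 * π * Complex.I) * (totalCirc u.par / ρ) := by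
  have ha0 : (0 : ℝ) < α := by exact_mod_cast hα0
  have ha1 : (α : ℝ) < 1 := by exact_mod_cast hα1
  have hμ := fun j => (cHolder_mu hα0 u j).of_le ha0 ha1.le hℓ
  have hν := fun j => (cHolder_nu hα0 u j).of_le ha0 ha1.le hℓ
  have hcN : Continuous fun x : Fin M × Circle => zNu' u ρ x.1 x.2 :=
    continuous_prod_of_discrete_left.2 fun k => continuous_zNu' hα0 hα1 hℓ hs k
  have hcD : Continuous fun x : Fin M × Circle => zMu' u ρ x.1 x.2 :=
    continuous_prod_of_discrete_left.2 fun k => continuous_zMu' hα0 hα1 hℓ hs k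
  have hcZ : Continuous fun x : Fin M × Circle => zMu u ρ x.1 x.2 :=
    continuous_prod_of_discrete_left.2 fun k => continuous_zMu hα0 hα1 hs k
  let N : C(Fin M × Circle, ℂ) := ⟨_, hcN⟩
  let D : C(Fin M × Circle, ℂ) := ⟨_, hcD⟩
  let Z : C(Fin M × Circle, ℂ) := ⟨_, hcZ⟩
  have hN : N ∈ exteriorTraces u.par ρ := traceZ_mem_exteriorTraces ha0 ha1 hρ hs
    (m := fun j => tDeriv (u.nu j)) (fun j => cHolder_tDeriv ha0 ha1.le (hν j)) fun _ _ => rfl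
  have hDm : D ∈ exteriorTraces u.par ρ := traceZ_mem_exteriorTraces ha0 ha1 hρ hs
    (m := fun j => tDeriv (u.mu j)) (fun j => cHolder_tDeriv ha0 ha1.le (hμ j)) fun _ _ => rfl
  have hZ : Z ∈ exteriorTraces u.par ρ := traceZ_mem_exteriorTraces ha0 ha1 hρ hs
    (m := fun j σ => (u.mu j σ : ℂ))
    (fun j => (cHolder_ofReal (cHolder_mu hα0 u j)).of_le ha0 ha1.le (Nat.zero_le ℓ))
    fun _ _ => rfl
  let cf : Fin M → ℂ := fun j => (u.par.circ j : ℂ) / (2 * π * Complex.I)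
  let W0 : C(Fin M × Circle, ℂ) := ∑ j, cf j • centrePole hρ hs j
  have hW0 : W0 ∈ exteriorTraces u.par ρ := sum_mem fun j _ =>
    SMulMemClass.smul_mem _ (centrePole_mem hρ hs j)
  have hwe : potDeriv u ρ = (W0 + N : C(Fin M × Circle, ℂ)) := by
    funext x
    simp [potDeriv, w0Deriv, W0, N, centrePole, cf, ContinuousMap.sum_apply]
  -- Multiplying this potential by ζ gives a layer potential again, with no constant at infinity,
  -- because the densities ν' integrate to zero.
  have hbN := fun (k : Fin M) (τ : Circle) => mul_traceZ ha0 ha1 hs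
    (fun j => cHolder_tDeriv ha0 ha1.le (hν j)) (fun j => contourInt_tDeriv ha0 (hν j)) k τ
  let BN : C(Fin M × Circle, ℂ) := ⟨fun x => bdryPt u.par ρ x * N x, by fun_prop⟩
  have hBN : BN ∈ exteriorTraces u.par ρ := traceZ_mem_exteriorTraces ha0 ha1 hρ hs
    (m := fun j σ => (u.par.ctr j + ρ * σ) * tDeriv (u.nu j) σ)
    (fun j => ((CHolder.const _).add ((cHolder_exp ha0 ha1.le).const_mul ha0 ha1.le _)).mul
      ha0 ha1.le (cHolder_tDeriv ha0 ha1.le (hν j))) hbN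
  -- From ζ/(ζ − ζ_j) = 1 + ζ_j/(ζ − ζ_j): the constants add up to the total circulation over 2πi,
  -- and the rest vanishes at infinity.
  let q : C(Fin M × Circle, ℂ) := ∑ j, (cf j * u.par.ctr j) • centrePole hρ hs j + BN
  have hq : q ∈ exteriorTraces u.par ρ := add_mem (sum_mem fun j _ =>
    SMulMemClass.smul_mem _ (centrePole_mem hρ hs j)) hBN
  have hc : ∀ x, bdryPt u.par ρ x * (W0 + N) x
      = totalCirc u.par / (2 * π * Complex.I) + q x := by
    intro x
    simp only [W0, q, BN, ContinuousMap.add_apply, ContinuousMap.sum_apply, ContinuousMap.coe_mk,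
      ContinuousMap.smul_apply, smul_eq_mul, centrePole, mul_add, Finset.mul_sum, totalCirc,
      Complex.ofReal_sum, Finset.sum_div]
    rw [← add_assoc, ← Finset.sum_add_distrib]
    congr 1
    refine Finset.sum_congr rfl fun j _ => ?_
    have := bdryPt_sub_ne_zero hs (ctr_mem_discs hρ j) x
    simp only [cf]
    field_simp
    ring
  have hint : circlesInt (W0 + N : C(Fin M × Circle, ℂ)) = totalCirc u.par / ρ := by
    have h1 : circlesInt N = 0 := Finset.sum_eq_zero fun k _ => contourInt_zNu' hα0 hα1 hℓ hs k
    have h2 : ∀ j, circlesInt (centrePole hρ hs j) = 2 * π * Complex.I / ρ := fun j =>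
      circlesInt_pole hs (ctr_mem_discs hρ j)
    have h3 := Complex.two_pi_I_ne_zero
    rw [circlesInt_add, h1, add_zero, circlesInt_sum, totalCirc, Complex.ofReal_sum,
      Finset.sum_div]
    refine Finset.sum_congr rfl fun j _ => ?_
    rw [circlesInt_smul, h2]
    simp only [cf]
    field_simp
  obtain ⟨r, hr1, hr⟩ := hD
  have hd1 : ‖(ρ : ℂ) • D‖ < 1 := by
    -- The maximum with 0 is needed because the hypothesis does not make r nonnegative when there
    -- are no circles.
    refine lt_of_le_of_lt ((ContinuousMap.norm_le _ (le_max_right r 0)).2 fun x => ?_)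
      (max_lt hr1 one_pos)
    exact (hr x.1 x.2).trans (le_max_left _ _)
  have key := circlesInt_sq_div hρ hs (add_mem hW0 hN)
    (SMulMemClass.smul_mem (ρ : ℂ) hDm) (SMulMemClass.smul_mem ((ρ : ℂ) ^ 2) hZ) hq hd1 hc
  rw [hint] at key
  refine ⟨hwe ▸ (W0 + N).continuous, by rw [hwe, hint], ?_, ?_⟩
  · rw [hwe]
    exact key.1
  · rw [hwe]
    exact key.2

theorem pole_add_conj (γ : ℝ) :
    ((γ : ℂ) / (2 * π * Complex.I)) + conj ((γ : ℂ) / (2 * π * Complex.I)) = 0 := by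
  simp only [map_div₀, map_mul, Complex.conj_ofReal, Complex.conj_I, map_ofNat, mul_neg, div_neg]
  ring

/-- The integrand at the residuals, multiplied by `ρ`. -/
theorem rho_mul_core (hF : ∀ k τ, confDeriv u ρ k τ ≠ 0) {Y : YSpace M ℓ α}
    (hA : ∀ k τ, Y.kin k τ = opA u ρ k τ) (hB : ∀ k τ, Y.dyn k τ = opB u ρ k τ) (hρ : ρ ≠ 0)
    (k : Fin M) (τ : Circle) {b : ℂ}
    (hb : b = Complex.I * u.par.angVel * conj (confMap u ρ k τ) - u.par.speed) :
    ρ * core Y u ρ k τ = (ρ ^ 2 / 2) * (conj b * (potDeriv u ρ (k, τ)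
        - conj (τ : ℂ) ^ 2 * conj (potDeriv u ρ (k, τ)))
      + b * conj b * confDeriv u ρ k τ
      - conj (τ : ℂ) ^ 2 * conj (potDeriv u ρ (k, τ) ^ 2 / confDeriv u ρ k τ))
      - ((u.par.circ k ^ 2 / (4 * π ^ 2) + ρ * u.bern k) / 2 : ℝ) * confDeriv u ρ k τ := by
  have hρ' : (ρ : ℂ) ≠ 0 := by exact_mod_cast hρ
  have hτ := conj_mul_self_circle τ
  have hτ0 : (τ : ℂ) ≠ 0 := Circle.coe_ne_zero τ
  set F := confDeriv u ρ k τ with hFdef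
  have hF0 : F ≠ 0 := hF k τ
  have hF0' : conj F ≠ 0 := (map_ne_zero _).2 hF0
  set w := potDeriv u ρ (k, τ) with hw
  -- The full relative velocity including the pole, scaled by ρτ; both residuals are functions of g
  -- and F.
  set g : ℂ := ρ * τ * (w + b * F) with hg
  have hW : scaledW0 u.par ρ k τ + ρ * τ * zNu' u ρ k τ = ρ * τ * w := by
    rw [scaledW0_eq u.par hρ, hw, potDeriv, bdryPt]
    ring
  have hgK : g = (u.par.circ k : ℂ) / (2 * π * Complex.I) + ρ * τ * kinExpr u ρ k τ := by
    rw [hg, mul_add, ← hW, kinExpr_eq, ← hb, scaledW0]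
    ring
  -- The pole contributes an imaginary constant to g and is not seen by the real part.
  have hAk : (ρ : ℂ) * (opA u ρ k τ : ℂ) = (g + conj g) / 2 := by
    have h1 : ((opA u ρ k τ : ℝ) : ℂ)
        = (τ * kinExpr u ρ k τ + conj (τ * kinExpr u ρ k τ)) / 2 := by
      rw [opA, Complex.re_eq_add_conj]
    have h2 := pole_add_conj (u.par.circ k)
    rw [h1, hgK]
    simp only [map_add, map_mul, Complex.conj_ofReal]
    linear_combination (-1 / 2 : ℂ) * h2
  have hBk : (ρ : ℂ) * (opB u ρ k τ : ℂ) = g * conj g / (F * conj F)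
      - (u.par.circ k ^ 2 / (4 * π ^ 2) + ρ * u.bern k : ℝ) := by
    have h1 := bernoulliOp_spec u ρ k τ hF0
    have h2 : ‖(u.par.circ k : ℂ) / (2 * π * Complex.I * τ) + ρ * kinExpr u ρ k τ‖ = ‖g‖ := by
      rw [hgK, ← mul_one ‖(u.par.circ k : ℂ) / (2 * π * Complex.I * τ) + ρ * kinExpr u ρ k τ‖,
        ← Circle.norm_coe τ, ← norm_mul]
      congr 1
      field_simp
    have h3 : opB u ρ k τ = bernoulliOp u ρ k τ - u.bern k := rfl
    have h4 : ρ * opB u ρ k τ = ‖g‖ ^ 2 / ‖F‖ ^ 2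
        - (u.par.circ k ^ 2 / (4 * π ^ 2) + ρ * u.bern k) := by
      rw [h3, ← h2, hFdef, confDeriv, h1]
      ring
    rw [Complex.mul_conj, Complex.mul_conj, Complex.normSq_eq_norm_sq, Complex.normSq_eq_norm_sq]
    exact_mod_cast h4
  have e1 : ρ * core Y u ρ k τ = (1 / 2 : ℂ) * (ρ * (opB u ρ k τ : ℂ)) * F
      - conj ((ρ : ℂ) * τ * w) / conj F * (ρ * (opA u ρ k τ : ℂ)) := by
    rw [core, hA, hB, hW, hFdef, confDeriv]
    ring
  rw [e1, hAk, hBk, hg]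
  simp only [map_mul, map_add, Complex.conj_ofReal, map_div₀, map_pow]
  push_cast
  simp only [div_eq_mul_inv, mul_inv]
  have hi := mul_inv_cancel₀ hF0
  have hi' := mul_inv_cancel₀ hF0'
  set t := conj (τ : ℂ)
  set w' := conj w
  set b' := conj b
  set F' := conj F
  linear_combination (ρ ^ 2 / 2 * (τ * t) * (w + b * F) * (w' + b' * F') * F'⁻¹) * hi
    + (ρ ^ 2 / 2 * (τ * t) * (w + b * F) * b' - ρ ^ 2 / 2 * t ^ 2 * w' * b') * hi'
    + (ρ ^ 2 / 2 * (w + b * F) * b') * hτ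

/-- Here b = −c is constant. The multiples of F integrate to zero, the sum of ∫ W²/F has no residue
at infinity, and ∑ ∫ W dτ = Γ/ρ is real. What remains is real for every c, and zero when c = 0. -/
theorem transInt_residual (hα0 : 0 < α) (hα1 : α < 1) (hℓ : 1 ≤ ℓ) (hρ : ρ ≠ 0)
    (hs : Separated u.par ρ) (hD : ∃ r < 1, ∀ k τ, ‖ρ * zMu' u ρ k τ‖ ≤ r)
    (hF : ∀ k τ, confDeriv u ρ k τ ≠ 0) {Y : YSpace M ℓ α}
    (hA : ∀ k τ, Y.kin k τ = opA u ρ k τ) (hB : ∀ k τ, Y.dyn k τ = opB u ρ k τ)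
    (hΩ : u.par.angVel = 0) :
    transInt Y u ρ = -(u.par.speed * totalCirc u.par : ℝ) := by
  obtain ⟨hcw, h1, h2, -⟩ := potential_identities hα0 hα1 hℓ hρ hs hD
  have hρ' : (ρ : ℂ) ≠ 0 := by exact_mod_cast hρ
  have hk : ∀ k, ρ * contourInt (fun τ => core Y u ρ k τ)
      = (-(u.par.speed : ℂ) * ρ ^ 2 / 2) * (contourInt (fun τ => potDeriv u ρ (k, τ))
          + conj (contourInt fun τ => potDeriv u ρ (k, τ)))
        + ρ ^ 2 / 2 * conj (contourInt fun τ => potDeriv u ρ (k, τ) ^ 2 / confDeriv u ρ k τ) := by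
    intro k
    have hw : Continuous fun τ => potDeriv u ρ (k, τ) := hcw.comp (by fun_prop)
    have hFc := continuous_confDeriv hα0 hα1 hℓ hs k
    have hq : Continuous fun τ => potDeriv u ρ (k, τ) ^ 2 / confDeriv u ρ k τ :=
      (hw.pow 2).div hFc (hF k)
    have e : ∀ τ, ρ * core Y u ρ k τ = ((-(u.par.speed : ℂ) * ρ ^ 2 / 2) * (potDeriv u ρ (k, τ)
        - conj (τ : ℂ) ^ 2 * conj (potDeriv u ρ (k, τ)))
        - ρ ^ 2 / 2 * (conj (τ : ℂ) ^ 2 * conj (potDeriv u ρ (k, τ) ^ 2 / confDeriv u ρ k τ)))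
        + (ρ ^ 2 / 2 * (u.par.speed : ℂ) ^ 2
          - ((u.par.circ k ^ 2 / (4 * π ^ 2) + ρ * u.bern k) / 2 : ℝ)) * confDeriv u ρ k τ := by
      intro τ
      rw [rho_mul_core hF hA hB hρ k τ (b := -(u.par.speed : ℂ)) (by rw [hΩ]; simp)]
      simp only [map_neg, Complex.conj_ofReal]
      ring
    rw [← contourInt_const_mul]
    simp only [e]
    rw [contourInt_add (by fun_prop) (by fun_prop), contourInt_sub (by fun_prop) (by fun_prop),
      contourInt_const_mul, contourInt_const_mul, contourInt_const_mul,
      contourInt_sub (by fun_prop) (by fun_prop), contourInt_conj, contourInt_conj,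
      contourInt_confDeriv hα0 hα1 hℓ hs]
    ring
  have hsum : ρ * transInt Y u ρ
      = (-(u.par.speed : ℂ) * ρ ^ 2 / 2) * (circlesInt (potDeriv u ρ)
          + conj (circlesInt (potDeriv u ρ))) + ρ ^ 2 / 2 *
        conj (circlesInt fun x => potDeriv u ρ x ^ 2 / confDeriv u ρ x.1 x.2) := by
    simp only [transInt, circlesInt, Finset.mul_sum, hk, map_sum, ← Finset.sum_add_distrib]
  rw [h1, h2] at hsum
  refine mul_left_cancel₀ hρ' (hsum.trans ?_)
  simp only [map_div₀, Complex.conj_ofReal, map_zero]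
  push_cast
  field_simp
  ring

/-- Here b = iΩ conj f. The terms linear in W form an imaginary multiple of X + conj X with X = ∫
|f|² W dτ, the two terms in F have imaginary integrals, and the residue of W² f/F is Γ²/(2πiρ),
imaginary as well. -/
theorem re_rotInt_residual (hα0 : 0 < α) (hα1 : α < 1) (hℓ : 1 ≤ ℓ) (hρ : ρ ≠ 0)
    (hs : Separated u.par ρ) (hD : ∃ r < 1, ∀ k τ, ‖ρ * zMu' u ρ k τ‖ ≤ r)
    (hF : ∀ k τ, confDeriv u ρ k τ ≠ 0) {Y : YSpace M ℓ α}
    (hA : ∀ k τ, Y.kin k τ = opA u ρ k τ) (hB : ∀ k τ, Y.dyn k τ = opB u ρ k τ)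
    (hc : u.par.speed = 0) : (rotInt Y u ρ).re = 0 := by
  obtain ⟨hcw, -, -, h1⟩ := potential_identities hα0 hα1 hℓ hρ hs hD
  have hk : ∀ k, ρ * (contourInt (fun τ => core Y u ρ k τ * conj (confMap u ρ k τ))).re
      = ρ ^ 2 / 2 * (contourInt fun τ =>
        potDeriv u ρ (k, τ) ^ 2 * confMap u ρ k τ / confDeriv u ρ k τ).re := by
    intro k
    have hw : Continuous fun τ => potDeriv u ρ (k, τ) := hcw.comp (by fun_prop)
    have hFc := continuous_confDeriv hα0 hα1 hℓ hs k
    have hfc := continuous_confMap hα0 hα1 hs k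
    have hq : Continuous fun τ => potDeriv u ρ (k, τ) ^ 2 * confMap u ρ k τ / confDeriv u ρ k τ :=
      ((hw.pow 2).mul hfc).div hFc (hF k)
    -- The conjugated parts are arranged as conj τ² conj(·), the form that `contourInt_conj`
    -- integrates.
    have e : ∀ τ, ρ * (core Y u ρ k τ * conj (confMap u ρ k τ))
        = (((-(Complex.I * u.par.angVel) * ρ ^ 2 / 2) *
          (confMap u ρ k τ * conj (confMap u ρ k τ) * potDeriv u ρ (k, τ)
            - conj (τ : ℂ) ^ 2 *
              conj (confMap u ρ k τ * conj (confMap u ρ k τ) * potDeriv u ρ (k, τ)))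
        - (ρ ^ 2 / 2 : ℝ) * (conj (τ : ℂ) ^ 2 *
          conj (potDeriv u ρ (k, τ) ^ 2 * confMap u ρ k τ / confDeriv u ρ k τ)))
        + (ρ ^ 2 / 2 * u.par.angVel ^ 2 : ℝ) * (confMap u ρ k τ * conj (confMap u ρ k τ) *
          (conj (confMap u ρ k τ) * confDeriv u ρ k τ)))
        - ((u.par.circ k ^ 2 / (4 * π ^ 2) + ρ * u.bern k) / 2 : ℝ) *
          (conj (confMap u ρ k τ) * confDeriv u ρ k τ) := by
      intro τ
      rw [← mul_assoc, rho_mul_core hF hA hB hρ k τ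
        (b := Complex.I * u.par.angVel * conj (confMap u ρ k τ)) (by rw [hc]; simp)]
      simp only [map_mul, map_div₀, map_pow, Complex.conj_I, Complex.conj_ofReal, Complex.conj_conj]
      push_cast
      linear_combination (-(ρ ^ 2 / 2 * (u.par.angVel : ℂ) ^ 2 * confMap u ρ k τ *
        conj (confMap u ρ k τ) ^ 2 * confDeriv u ρ k τ)) * Complex.I_sq
    have hint := contourInt_const_mul (ρ : ℂ) fun τ => core Y u ρ k τ * conj (confMap u ρ k τ)
    simp only [e] at hint
    rw [contourInt_sub (by fun_prop) (by fun_prop), contourInt_add (by fun_prop) (by fun_prop),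
      contourInt_sub (by fun_prop) (by fun_prop), contourInt_const_mul, contourInt_const_mul,
      contourInt_const_mul, contourInt_const_mul, contourInt_sub (by fun_prop) (by fun_prop),
      contourInt_conj, contourInt_conj] at hint
    have h2 := re_contourInt_conj_confMap hα0 hα1 hℓ hs k
    have h3 := re_contourInt_normSq_confMap hα0 hα1 hℓ hρ hs k
    rw [← Complex.re_ofReal_mul, ← hint, sub_neg_eq_add, Complex.add_conj]
    have e5 : ∀ x : ℝ, (-(Complex.I * u.par.angVel) * (ρ : ℂ) ^ 2 / 2 * (x : ℂ)).re = 0 := by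
      intro x
      have : -(Complex.I * u.par.angVel) * (ρ : ℂ) ^ 2 / 2 * (x : ℂ)
          = ((-(u.par.angVel) * ρ ^ 2 / 2 * x : ℝ) : ℂ) * Complex.I := by
        push_cast
        ring
      rw [this, Complex.re_ofReal_mul, Complex.I_re, mul_zero]
    rw [Complex.sub_re, Complex.add_re, Complex.sub_re, Complex.re_ofReal_mul,
      Complex.re_ofReal_mul, Complex.re_ofReal_mul, h2, h3, e5, Complex.neg_re, Complex.conj_re]
    ring
  have hsum : ρ * (rotInt Y u ρ).re = ρ ^ 2 / 2 * (circlesInt fun x =>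
      potDeriv u ρ x ^ 2 * confMap u ρ x.1 x.2 / confDeriv u ρ x.1 x.2).re := by
    rw [rotInt, circlesInt, Complex.re_sum, Complex.re_sum, Finset.mul_sum, Finset.mul_sum]
    exact Finset.sum_congr rfl fun k _ => hk k
  rw [h1] at hsum
  have h4 : (totalCirc u.par : ℂ) / (2 * π * Complex.I) * (totalCirc u.par / ρ)
      = ((-(totalCirc u.par ^ 2 / (2 * π * ρ)) : ℝ) : ℂ) * Complex.I := by
    have hρ' : (ρ : ℂ) ≠ 0 := by exact_mod_cast hρ
    have hπ : (π : ℂ) ≠ 0 := by exact_mod_cast pi_ne_zero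
    push_cast
    field_simp
    rw [Complex.I_sq]
    ring
  rw [h4, Complex.re_ofReal_mul, Complex.I_re, mul_zero, mul_zero] at hsum
  exact (mul_eq_zero.1 hsum).resolve_left hρ

end Identities

end HollowVortex

end

open scoped NNReal ComplexConjugate

noncomputable section

namespace HollowVortex

/-! ### The identities at radius zero -/

section PointVortex

open Real Set MeasureTheory Function

variable {M ℓ : ℕ} {α : ℝ≥0} {ρ : ℝ} {u : XSpace M ℓ α}

/-- The velocity of the `k`-th point vortex relative to the moving frame. -/
def pointVel (Λ : Params M) (k : Fin M) : ℂ :=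
  ∑ j, (Λ.circ j : ℂ) / (2 * π * Complex.I) * (1 / (Λ.ctr k - Λ.ctr j))
    + Complex.I * Λ.angVel * conj (Λ.ctr k) - Λ.speed

theorem relVel_zero (Λ : Params M) (k : Fin M) (τ : Circle) : relVel Λ 0 k τ = pointVel Λ k := by
  -- The diagonal term may be included because division by zero gives zero.
  rw [relVel, w0Rest, pointVel, Finset.sum_erase _ (by simp)]
  simp

/-- The mutual interactions are antisymmetric in the pair (k, j), so their double sum equals its own
negative. -/
theorem sum_circ_mul_pointVel (Λ : Params M) (hΩ : Λ.angVel = 0) :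
    ∑ k, (Λ.circ k : ℂ) * pointVel Λ k = -(Λ.speed * totalCirc Λ : ℝ) := by
  set S := ∑ k, ∑ j, (Λ.circ k : ℂ) * ((Λ.circ j : ℂ) / (2 * π * Complex.I)
    * (1 / (Λ.ctr k - Λ.ctr j))) with hS
  have h1 : S = -S := by
    conv_lhs => rw [hS, Finset.sum_comm]
    rw [hS, ← Finset.sum_neg_distrib]
    refine Finset.sum_congr rfl fun k _ => ?_
    rw [← Finset.sum_neg_distrib]
    refine Finset.sum_congr rfl fun j _ => ?_
    rw [← neg_sub (Λ.ctr k), one_div_neg_eq_neg_one_div]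
    ring
  have h2 : S = 0 := by linear_combination h1 / 2
  have h3 : ∑ k, (Λ.circ k : ℂ) * pointVel Λ k = S - Λ.speed * ∑ k, (Λ.circ k : ℂ) := by
    rw [hS, Finset.mul_sum, ← Finset.sum_sub_distrib]
    refine Finset.sum_congr rfl fun k _ => ?_
    rw [pointVel, hΩ, ← Finset.mul_sum]
    push_cast
    ring
  rw [h3, h2, totalCirc]
  push_cast
  ring

/-- Symmetrizing in (k, j) replaces ζ_k/(ζ_k − ζ_j) by half of (ζ_k − ζ_j)/(ζ_k − ζ_j), leaving an
imaginary constant for each pair. The rotation adds iΩ ∑ γ_k |ζ_k|², also imaginary. -/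
theorem re_sum_circ_mul_pointVel_mul_ctr (Λ : Params M) (hc : Λ.speed = 0) :
    (∑ k, (Λ.circ k : ℂ) * pointVel Λ k * Λ.ctr k).re = 0 := by
  set S := ∑ k, ∑ j, (Λ.circ k : ℂ) * ((Λ.circ j : ℂ) / (2 * π * Complex.I)
    * (1 / (Λ.ctr k - Λ.ctr j))) * Λ.ctr k with hS
  -- The quotient is not cancelled: it is 0 for coinciding centres, in particular on the diagonal,
  -- and 1 otherwise. Both values leave an imaginary term.
  have h1 : S + S = ∑ k, ∑ j, ((-(Λ.circ k * Λ.circ j / (2 * π)) : ℝ) : ℂ) * Complex.I *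
      ((Λ.ctr k - Λ.ctr j) / (Λ.ctr k - Λ.ctr j)) := by
    conv_lhs => enter [2]; rw [hS, Finset.sum_comm]
    rw [hS, ← Finset.sum_add_distrib]
    refine Finset.sum_congr rfl fun k _ => ?_
    rw [← Finset.sum_add_distrib]
    refine Finset.sum_congr rfl fun j _ => ?_
    rw [← neg_sub (Λ.ctr k), one_div_neg_eq_neg_one_div]
    have : (2 * π * Complex.I : ℂ)⁻¹ = -Complex.I / (2 * π) := by
      rw [mul_inv, Complex.inv_I]
      ring
    simp only [div_eq_mul_inv _ (2 * π * Complex.I : ℂ), this]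
    push_cast
    ring
  have h2 : S.re = 0 := by
    have h3 : (S + S).re = 0 := by
      rw [h1, Complex.re_sum]
      refine Finset.sum_eq_zero fun k _ => ?_
      rw [Complex.re_sum]
      refine Finset.sum_eq_zero fun j _ => ?_
      by_cases h : Λ.ctr k - Λ.ctr j = 0
      · simp [h]
      · rw [div_self h, mul_one, Complex.re_ofReal_mul, Complex.I_re, mul_zero]
    rw [Complex.add_re] at h3
    linarith
  have h4 : ∑ k, (Λ.circ k : ℂ) * pointVel Λ k * Λ.ctr k
      = S + ((∑ k, Λ.circ k * Λ.angVel * ‖Λ.ctr k‖ ^ 2 : ℝ) : ℂ) * Complex.I := by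
    rw [hS, Complex.ofReal_sum, Finset.sum_mul, ← Finset.sum_add_distrib]
    refine Finset.sum_congr rfl fun k _ => ?_
    rw [pointVel, hc, ← Finset.sum_mul, ← Finset.mul_sum]
    push_cast
    rw [← Complex.conj_mul']
    ring
  rw [h4, Complex.add_re, h2, Complex.re_ofReal_mul, Complex.I_re, mul_zero, add_zero]

/-- The integrand at the residuals for `ρ = 0`. -/
theorem core_zero {Y : YSpace M ℓ α} (hA : ∀ k τ, Y.kin k τ = opA u 0 k τ)
    (hB : ∀ k τ, Y.dyn k τ = opB u 0 k τ) (k : Fin M) (τ : Circle) :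
    core Y u 0 k τ = (u.par.circ k : ℂ) / (2 * π * Complex.I) * conj (τ * kinExpr u 0 k τ)
      - (u.par.circ k : ℂ) ^ 2 / (8 * π ^ 2) * (zMu' u 0 k τ + conj (zMu' u 0 k τ))
      - (u.bern k : ℂ) / 2 := by
  have hp : conj ((u.par.circ k : ℂ) / (2 * π * Complex.I))
      = -((u.par.circ k : ℂ) / (2 * π * Complex.I)) := by
    linear_combination pole_add_conj (u.par.circ k)
  have hτ := conj_mul_self_circle τ
  have hτ0 : (τ : ℂ) ≠ 0 := Circle.coe_ne_zero τ
  have hpτ : (u.par.circ k : ℂ) / (2 * π * Complex.I * τ)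
      = (u.par.circ k : ℂ) / (2 * π * Complex.I) * conj (τ : ℂ) := by
    have : conj (τ : ℂ) = (τ : ℂ)⁻¹ := eq_inv_of_mul_eq_one_left hτ
    rw [this, ← div_div, div_eq_mul_inv _ (τ : ℂ)]
  have h1 : ((opA u 0 k τ : ℝ) : ℂ)
      = (τ * kinExpr u 0 k τ + conj (τ * kinExpr u 0 k τ)) / 2 := by
    rw [opA, Complex.re_eq_add_conj]
  have h2 : ((opB u 0 k τ : ℝ) : ℂ) = -((u.par.circ k : ℂ) / (2 * π * Complex.I)) *
      (τ * kinExpr u 0 k τ - conj (τ * kinExpr u 0 k τ))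
      - (u.par.circ k : ℂ) ^ 2 / (4 * π ^ 2) * (zMu' u 0 k τ + conj (zMu' u 0 k τ))
      - u.bern k := by
    have e1 := Complex.re_eq_add_conj (conj ((u.par.circ k : ℂ) / (2 * π * Complex.I * τ))
      * kinExpr u 0 k τ)
    have e2 := Complex.re_eq_add_conj (zMu' u 0 k τ)
    rw [opB, bernoulliOp]
    simp only [Complex.ofReal_zero, zero_mul, add_zero, norm_one, one_pow, div_one]
    push_cast
    rw [e1, e2, hpτ]
    simp only [map_mul, hp, map_neg, Complex.conj_conj]
    ring
  rw [core, hA, hB, h1, h2, scaledW0]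
  simp only [Complex.ofReal_zero, zero_mul, add_zero, map_one, div_one, hp]
  ring

/-- The self-induced traces at ρ = 0 are orthogonal to negative powers of τ, so neither μ nor ν
contributes. Of the constant velocity, ∫ conj τ dτ = 2πi cancels the 2πi under the circulation. -/
theorem contourInt_core_zero (hα0 : 0 < α) (hα1 : α < 1) (hℓ : 1 ≤ ℓ) (hs : Separated u.par 0)
    {Y : YSpace M ℓ α} (hA : ∀ k τ, Y.kin k τ = opA u 0 k τ)
    (hB : ∀ k τ, Y.dyn k τ = opB u 0 k τ) (k : Fin M) :
    contourInt (core Y u 0 k) = u.par.circ k * conj (pointVel u.par k) := by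
  have ha0 : (0 : ℝ) < α := by exact_mod_cast hα0
  have ha1 : (α : ℝ) < 1 := by exact_mod_cast hα1
  have hD := continuous_zMu' hα0 hα1 hℓ hs k
  have hN := continuous_zNu' hα0 hα1 hℓ hs k
  have hI1 : contourInt (fun τ => zNu' u 0 k τ * conj (τ : ℂ) ^ (0 + 1)) = 0 :=
    contourInt_traceZ_zero_mul_conj_pow ha0 ha1 u.par (m := fun j => tDeriv (u.nu j)) k
      (cHolder_tDeriv ha0 ha1.le ((cHolder_nu hα0 u k).of_le ha0 ha1.le hℓ)) 0
  have hI2 : contourInt (fun τ => zMu' u 0 k τ * conj (τ : ℂ) ^ (1 + 1)) = 0 :=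
    contourInt_traceZ_zero_mul_conj_pow ha0 ha1 u.par (m := fun j => tDeriv (u.mu j)) k
      (cHolder_tDeriv ha0 ha1.le ((cHolder_mu hα0 u k).of_le ha0 ha1.le hℓ)) 1
  -- All conjugates are put in the form conj τ² conj(·): conj(τN) requires N conj τ inside and conj
  -- D requires D conj τ², which explains the exponents in the two orthogonality relations.
  have e : core Y u 0 k = fun τ : Circle => ((u.par.circ k : ℂ) / (2 * π * Complex.I) *
      (conj (τ : ℂ) ^ 2 * conj (zNu' u 0 k τ * conj (τ : ℂ) ^ (0 + 1)
        + pointVel u.par k * conj (τ : ℂ)))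
      - (u.par.circ k : ℂ) ^ 2 / (8 * π ^ 2) * (zMu' u 0 k τ
        + conj (τ : ℂ) ^ 2 * conj (zMu' u 0 k τ * conj (τ : ℂ) ^ (1 + 1))))
      - (u.bern k : ℂ) / 2 := by
    funext τ
    have hτ := conj_mul_self_circle τ
    rw [core_zero hA hB, kinExpr, relVel_zero]
    simp only [Complex.ofReal_zero, map_add, map_mul, map_pow, Complex.conj_conj]
    simp only [mul_zero, zero_mul, add_zero, map_zero, ne_eq, OfNat.ofNat_ne_zero,
      not_false_eq_true, zero_pow]
    set t := conj (τ : ℂ)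
    linear_combination (-(u.par.circ k : ℂ) / (2 * π * Complex.I) * t * conj (zNu' u 0 k τ)
      - (u.par.circ k : ℂ) / (2 * π * Complex.I) * t * conj (pointVel u.par k)
      + (u.par.circ k : ℂ) ^ 2 / (8 * π ^ 2) * conj (zMu' u 0 k τ) * (t * τ + 1)) * hτ
  rw [e, contourInt_sub (by fun_prop) (by fun_prop), contourInt_sub (by fun_prop) (by fun_prop),
    contourInt_const, contourInt_const_mul, contourInt_const_mul,
    contourInt_add (by fun_prop) (by fun_prop), contourInt_conj, contourInt_conj, hI2,
    contourInt_add (by fun_prop) (by fun_prop), hI1, contourInt_const_mul, contourInt_conj_coe,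
    contourInt_zMu' hα0 hα1 hℓ hs]
  have h2 := Complex.two_pi_I_ne_zero
  simp only [map_add, map_mul, map_zero, Complex.conj_ofReal, Complex.conj_I, map_ofNat]
  field_simp
  ring

theorem transInt_zero_residual (hα0 : 0 < α) (hα1 : α < 1) (hℓ : 1 ≤ ℓ) (hs : Separated u.par 0)
    {Y : YSpace M ℓ α} (hA : ∀ k τ, Y.kin k τ = opA u 0 k τ)
    (hB : ∀ k τ, Y.dyn k τ = opB u 0 k τ) (hΩ : u.par.angVel = 0) :
    transInt Y u 0 = -(u.par.speed * totalCirc u.par : ℝ) := by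
  have h := congrArg conj (sum_circ_mul_pointVel u.par hΩ)
  rw [map_sum, map_neg, Complex.conj_ofReal] at h
  rw [← h, transInt]
  refine Finset.sum_congr rfl fun k _ => ?_
  rw [map_mul, Complex.conj_ofReal]
  exact contourInt_core_zero hα0 hα1 hℓ hs hA hB k

theorem re_rotInt_zero_residual (hα0 : 0 < α) (hα1 : α < 1) (hℓ : 1 ≤ ℓ)
    (hs : Separated u.par 0) {Y : YSpace M ℓ α} (hA : ∀ k τ, Y.kin k τ = opA u 0 k τ)
    (hB : ∀ k τ, Y.dyn k τ = opB u 0 k τ) (hc : u.par.speed = 0) : (rotInt Y u 0).re = 0 := by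
  have h := re_sum_circ_mul_pointVel_mul_ctr u.par hc
  rw [← Complex.conj_re, map_sum] at h
  refine Eq.trans (congrArg Complex.re ?_) h
  rw [rotInt]
  refine Finset.sum_congr rfl fun k _ => ?_
  have e : (fun τ : Circle => core Y u 0 k τ * conj (u.par.ctr k + (0 : ℝ) * τ
      + (0 : ℝ) ^ 2 * zMu u 0 k τ)) = fun τ => conj (u.par.ctr k) * core Y u 0 k τ := by
    funext τ
    simp [mul_comm]
  rw [e, contourInt_const_mul, contourInt_core_zero hα0 hα1 hℓ hs hA hB]
  simp only [map_mul, Complex.conj_ofReal]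
  ring

/-- The hollow vortex identities for the residuals. -/
theorem phiS_residual (hα0 : 0 < α) (hα1 : α < 1) (hℓ : 1 ≤ ℓ)
    (hs : Separated u.par ρ) (hD : ∃ r < 1, ∀ k τ, ‖ρ * zMu' u ρ k τ‖ ≤ r)
    (hF : ∀ k τ, confDeriv u ρ k τ ≠ 0) {Y : YSpace M ℓ α}
    (hA : ∀ k τ, Y.kin k τ = opA u ρ k τ) (hB : ∀ k τ, Y.dyn k τ = opB u ρ k τ) :
    (u.par.angVel = 0 → transInt Y u ρ = -(u.par.speed * totalCirc u.par : ℝ)) ∧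
      (u.par.speed = 0 → (rotInt Y u ρ).re = 0) := by
  rcases eq_or_ne ρ 0 with rfl | hρ
  · exact ⟨transInt_zero_residual hα0 hα1 hℓ hs hA hB, re_rotInt_zero_residual hα0 hα1 hℓ hs hA hB⟩
  · exact ⟨transInt_residual hα0 hα1 hℓ hρ hs hD hF hA hB,
      re_rotInt_residual hα0 hα1 hℓ hρ hs hD hF hA hB⟩

end PointVortex

end HollowVortex

end

open scoped NNReal ComplexConjugate

noncomputable section

namespace HollowVortex

/-! ### Bounds of the traces by the Hölder norm -/

section Estimates

open Real Set MeasureTheory Function Filter Topology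

variable {M ℓ : ℕ} {α : ℝ≥0} {ρ : ℝ} {u : XSpace M ℓ α}

theorem HolderFun.abs_iteratedDeriv_le (φ : HolderFun ℓ α) {j : ℕ} (hj : j ≤ ℓ) (θ : ℝ) :
    |iteratedDeriv j (lift φ) θ| ≤ ‖φ‖ := by
  have h1 : |iteratedDeriv j (lift φ) θ| ≤ derivSup j φ := le_ciSup (φ.bddAbove hj) θ
  have h2 : derivSup j φ ≤ ∑ i ∈ Finset.range (ℓ + 1), derivSup i φ :=
    Finset.single_le_sum (f := fun i => derivSup i φ) (fun i _ => derivSup_nonneg i φ)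
      (Finset.mem_range.2 (Nat.lt_succ_of_le hj))
  rw [HolderFun.norm_def]
  linarith [NNReal.coe_nonneg (nnHolderNorm α (iteratedDeriv ℓ (lift φ)))]

theorem HolderFun.abs_apply_le (φ : HolderFun ℓ α) (τ : Circle) : |φ τ| ≤ ‖φ‖ := by
  obtain ⟨θ, rfl⟩ := exp_surjective τ
  have h := φ.abs_iteratedDeriv_le (Nat.zero_le ℓ) θ
  rwa [iteratedDeriv_zero] at h

/-- The top derivative is controlled by its Hölder constant; lower ones by the mean value theorem
together with |s| ≤ π |s|^α on |s| ≤ π. The factor π covers both cases. -/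
theorem HolderFun.abs_iteratedDeriv_sub_le (hα1 : α < 1) (φ : HolderFun ℓ α) {j : ℕ} (hj : j ≤ ℓ)
    (θ s : ℝ) (hs : |s| ≤ π) :
    |iteratedDeriv j (lift φ) (θ + s) - iteratedDeriv j (lift φ) θ| ≤ π * ‖φ‖ * |s| ^ (α : ℝ) := by
  have hp : 0 ≤ |s| ^ (α : ℝ) := by positivity
  rcases hj.eq_or_lt with rfl | hj
  · have h1 := φ.2.2.holderWith.dist_le (θ + s) θ
    rw [Real.dist_eq, Real.dist_eq, add_sub_cancel_left] at h1
    refine h1.trans (mul_le_mul_of_nonneg_right ?_ hp)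
    have h2 : (nnHolderNorm α (iteratedDeriv j (lift φ)) : ℝ) ≤ ‖φ‖ := by
      rw [HolderFun.norm_def]
      linarith [Finset.sum_nonneg fun i (_ : i ∈ Finset.range (j + 1)) => derivSup_nonneg i φ]
    have h3 : ‖φ‖ ≤ π * ‖φ‖ := le_mul_of_one_le_left (norm_nonneg φ) (by linarith [pi_gt_three])
    exact h2.trans h3
  · have hd : Differentiable ℝ (iteratedDeriv j (lift φ)) :=
      φ.2.1.differentiable_iteratedDeriv j (by exact_mod_cast hj)
    have h1 := norm_sub_le_of_deriv_bound hd (L := ‖φ‖) (fun x => by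
      rw [← iteratedDeriv_succ]
      exact φ.abs_iteratedDeriv_le hj x) (θ + s) θ
    rw [Real.norm_eq_abs, add_sub_cancel_left] at h1
    have h2 : |s| ≤ π * |s| ^ (α : ℝ) := by
      rcases eq_or_ne s 0 with rfl | hs0
      · rw [abs_zero]
        positivity
      have e : |s| = |s| ^ (1 - (α : ℝ)) * |s| ^ (α : ℝ) := by
        rw [← rpow_add (abs_pos.2 hs0), sub_add_cancel, rpow_one]
      have hα1' : (α : ℝ) < 1 := by exact_mod_cast hα1
      have h3 : |s| ^ (1 - (α : ℝ)) ≤ π := by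
        calc |s| ^ (1 - (α : ℝ)) ≤ π ^ (1 - (α : ℝ)) :=
              rpow_le_rpow (abs_nonneg s) hs (by linarith)
          _ ≤ π ^ (1 : ℝ) := rpow_le_rpow_of_exponent_le (by linarith [pi_gt_three])
              (by linarith [α.coe_nonneg])
          _ = π := rpow_one π
      calc |s| = |s| ^ (1 - (α : ℝ)) * |s| ^ (α : ℝ) := e
        _ ≤ _ := mul_le_mul_of_nonneg_right h3 hp
    calc _ ≤ ‖φ‖ * |s| := h1
      _ ≤ ‖φ‖ * (π * |s| ^ (α : ℝ)) := mul_le_mul_of_nonneg_left h2 (norm_nonneg φ)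
      _ = _ := by ring

theorem norm_cauchyS_density_le (hα0 : 0 < α) (hα1 : α < 1) (φ : HolderFun ℓ α) (θ : ℝ) :
    ‖cauchyS 1 (fun t => (φ (Circle.exp t) : ℂ)) θ‖ ≤ π * ‖φ‖ * (π ^ (α : ℝ) / α) := by
  refine norm_cauchyS_one_le (by exact_mod_cast hα0) fun s hs => ?_
  have h := φ.abs_iteratedDeriv_sub_le hα1 (Nat.zero_le ℓ) θ s hs
  rw [iteratedDeriv_zero] at h
  rw [← Complex.ofReal_sub, Complex.norm_real]
  exact h

/-- The derivative of the Cauchy integral of φ can be computed with τ- or with θ-derivatives of the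
density, and the results agree up to the unimodular factor iτ. Hence the Hölder bound of the angular
derivative suffices. -/
theorem norm_cauchyS_tDeriv_le (hα0 : 0 < α) (hα1 : α < 1) (hℓ : 1 ≤ ℓ) (φ : HolderFun ℓ α)
    (θ : ℝ) :
    ‖cauchyS 1 (fun t => tDeriv φ (Circle.exp t)) θ‖ ≤ π * ‖φ‖ * (π ^ (α : ℝ) / α) := by
  have ha0 : (0 : ℝ) < α := by exact_mod_cast hα0
  have ha1 : (α : ℝ) < 1 := by exact_mod_cast hα1
  have hφ : CHolder α 1 (lift φ) := (cHolder_lift hα0 φ).of_le ha0 ha1.le hℓ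
  have hd : deriv (fun t => (lift φ t : ℂ)) = fun t => ((deriv (lift φ) t : ℝ) : ℂ) :=
    funext fun t => (deriv_ofReal_comp hφ.2.1 t).deriv
  have hc := cHolder_ofReal hφ
  have h1 := hasDerivAt_cauchyS ha0 ha1.le hc.1 hc.2.1 (hc.2.2.isHolder ha0 ha1.le) θ
  have h2 := (hasDerivAt_cauchyS_density ha0 ha1 hφ θ).unique h1
  have h3 := congrArg norm h2
  rw [norm_mul, norm_mul, Complex.norm_I, Circle.norm_coe, one_mul, one_mul] at h3
  rw [h3, hd]
  refine norm_cauchyS_one_le ha0 fun s hs => ?_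
  have h := φ.abs_iteratedDeriv_sub_le hα1 hℓ θ s hs
  rw [iteratedDeriv_one] at h
  rw [← Complex.ofReal_sub, Complex.norm_real]
  exact h

theorem norm_tDeriv_le (hℓ : 1 ≤ ℓ) (φ : HolderFun ℓ α) (τ : Circle) : ‖tDeriv φ τ‖ ≤ ‖φ‖ := by
  obtain ⟨θ, rfl⟩ := exp_surjective τ
  rw [tDeriv_exp, norm_div, norm_mul, Complex.norm_I, Circle.norm_coe, mul_one, div_one,
    Complex.norm_real, ← iteratedDeriv_one]
  exact φ.abs_iteratedDeriv_le hℓ θ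

theorem norm_layerPot_le {b z : ℂ} {m : Circle → ℂ} {B d : ℝ} (hB : ∀ σ, ‖m σ‖ ≤ B) (hd : 0 < d)
    (hz : d ≤ ‖z - b‖ - |ρ|) : ‖layerPot ρ b m z‖ ≤ B / d * |ρ| := by
  have h1 : ∀ σ : Circle, ‖m σ / (ρ * σ + b - z) * ρ‖ ≤ B / d * |ρ| := fun σ => by
    rw [norm_mul, norm_div, Complex.norm_real, Real.norm_eq_abs]
    refine mul_le_mul_of_nonneg_right ?_ (abs_nonneg ρ)
    exact div_le_div₀ ((norm_nonneg _).trans (hB σ)) (hB σ) hd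
      (hz.trans (sub_norm_le_denom ρ b z σ))
  rw [layerPot, norm_mul, norm_two_pi_I_inv]
  calc (2 * π)⁻¹ * _ ≤ (2 * π)⁻¹ * (2 * π * (B / d * |ρ|)) :=
        mul_le_mul_of_nonneg_left (norm_contourInt_le h1) (by positivity)
    _ = _ := by
      have := pi_pos
      field_simp

theorem norm_traceZ_le {Λ : Params M} {m : Fin M → Circle → ℂ} {B d S : ℝ}
    (hB : ∀ j σ, ‖m j σ‖ ≤ B) (hd : 0 < d)
    (hsep : ∀ j k, j ≠ k → d ≤ ‖Λ.ctr j - Λ.ctr k‖ - 2 * |ρ|) (k : Fin M)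
    (hS : ∀ θ, ‖cauchyS 1 (fun t => m k (Circle.exp t)) θ‖ ≤ S) (τ : Circle) :
    ‖traceZ ρ Λ m k τ‖ ≤ S + M * (B / d * |ρ|) := by
  obtain ⟨θ, rfl⟩ := exp_surjective τ
  have hB0 : 0 ≤ B := (norm_nonneg _).trans (hB k 1)
  rw [traceZ_eq]
  refine (norm_add_le _ _).trans (add_le_add (hS θ) ((norm_sum_le _ _).trans ?_))
  have h : ∀ j ∈ Finset.univ.erase k,
      ‖layerPot ρ (Λ.ctr j) (m j) (Λ.ctr k + ρ * Circle.exp θ)‖ ≤ B / d * |ρ| := by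
    intro j hj
    refine norm_layerPot_le (hB j) hd ?_
    have h1 := hsep k j (Finset.ne_of_mem_erase hj).symm
    have h2 := norm_sub_norm_le (Λ.ctr k - Λ.ctr j) (-(ρ * (Circle.exp θ : ℂ)))
    rw [norm_neg, norm_mul, Circle.norm_coe, mul_one, Complex.norm_real, Real.norm_eq_abs,
      sub_neg_eq_add, sub_add_eq_add_sub] at h2
    linarith
  refine (Finset.sum_le_card_nsmul _ _ _ h).trans ?_
  rw [nsmul_eq_mul]
  refine mul_le_mul_of_nonneg_right ?_ (by positivity)
  exact_mod_cast (Finset.card_le_univ _).trans_eq (Fintype.card_fin M)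

theorem norm_mu_le (u : XSpace M ℓ α) (k : Fin M) : ‖(u.1 k : HolderFun ℓ α)‖ ≤ ‖u.1‖ :=
  norm_le_pi_norm u.1 k

theorem norm_zMu_le (hα0 : 0 < α) (hα1 : α < 1) {d : ℝ} (hd : 0 < d)
    (hsep : ∀ j k, j ≠ k → d ≤ ‖u.par.ctr j - u.par.ctr k‖ - 2 * |ρ|) (k : Fin M) (τ : Circle) :
    ‖zMu u ρ k τ‖ ≤ π * ‖u.1‖ * (π ^ (α : ℝ) / α) + M * (‖u.1‖ / d * |ρ|) := by
  refine norm_traceZ_le (fun j σ => ?_) hd hsep k (fun θ => ?_) τ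
  · rw [Complex.norm_real]
    exact ((u.1 j : HolderFun ℓ α).abs_apply_le σ).trans (norm_mu_le u j)
  · refine (norm_cauchyS_density_le hα0 hα1 (u.1 k : HolderFun ℓ α) θ).trans ?_
    have := norm_mu_le u k
    gcongr

theorem norm_zMu'_le (hα0 : 0 < α) (hα1 : α < 1) (hℓ : 1 ≤ ℓ) {d : ℝ} (hd : 0 < d)
    (hsep : ∀ j k, j ≠ k → d ≤ ‖u.par.ctr j - u.par.ctr k‖ - 2 * |ρ|) (k : Fin M) (τ : Circle) :
    ‖zMu' u ρ k τ‖ ≤ π * ‖u.1‖ * (π ^ (α : ℝ) / α) + M * (‖u.1‖ / d * |ρ|) := by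
  refine norm_traceZ_le (fun j σ => ?_) hd hsep k (fun θ => ?_) τ
  · exact (norm_tDeriv_le hℓ (u.1 j : HolderFun ℓ α) σ).trans (norm_mu_le u j)
  · refine (norm_cauchyS_tDeriv_le hα0 hα1 hℓ (u.1 k : HolderFun ℓ α) θ).trans ?_
    have := norm_mu_le u k
    gcongr

end Estimates

end HollowVortex

end

open scoped NNReal ComplexConjugate

noncomputable section

namespace HollowVortex

/-! ### Dependence on the residuals -/

section Identities

open Real Set MeasureTheory Function Filter Topology

variable {M ℓ : ℕ} {α : ℝ≥0} {ρ : ℝ} {u : XSpace M ℓ α}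

/-! Linearity and boundedness in the residuals. -/

theorem YSpace.abs_kin_le (Y : YSpace M ℓ α) (k : Fin M) (τ : Circle) : |Y.kin k τ| ≤ ‖Y‖ :=
  (HolderFun.abs_apply_le (Y.1 k : HolderFun (ℓ - 1) α) τ).trans
    ((norm_le_pi_norm Y.1 k).trans (norm_fst_le Y))

theorem YSpace.abs_dyn_le (Y : YSpace M ℓ α) (k : Fin M) (τ : Circle) : |Y.dyn k τ| ≤ ‖Y‖ :=
  (HolderFun.abs_apply_le (Y.2 k) τ).trans ((norm_le_pi_norm Y.2 k).trans (norm_snd_le Y))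

theorem YSpace.continuous_kin (Y : YSpace M ℓ α) (k : Fin M) : Continuous (Y.kin k) :=
  continuous_of_comp_exp (HolderFun.continuous_lift (Y.1 k).1)

theorem YSpace.continuous_dyn (Y : YSpace M ℓ α) (k : Fin M) : Continuous (Y.dyn k) :=
  continuous_of_comp_exp (HolderFun.continuous_lift (Y.2 k))

theorem exists_clm_contourInt {p q : Circle → ℂ} (hp : Continuous p) (hq : Continuous q)
    (k : Fin M) : ∃ T : YSpace M ℓ α →L[ℝ] ℂ, ∀ Y : YSpace M ℓ α,
      T Y = contourInt fun τ => p τ * (Y.dyn k τ : ℂ) + q τ * (Y.kin k τ : ℂ) := by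
  obtain ⟨P, hP⟩ := isCompact_univ.exists_bound_of_continuousOn hp.continuousOn
  obtain ⟨Q, hQ⟩ := isCompact_univ.exists_bound_of_continuousOn hq.continuousOn
  have hc : ∀ Y : YSpace M ℓ α,
      Continuous fun τ => p τ * (Y.dyn k τ : ℂ) + q τ * (Y.kin k τ : ℂ) := fun Y => by
    have h1 := Y.continuous_kin k
    have h2 := Y.continuous_dyn k
    fun_prop
  refine ⟨LinearMap.mkContinuous
    { toFun := fun Y : YSpace M ℓ α =>
        contourInt fun τ => p τ * (Y.dyn k τ : ℂ) + q τ * (Y.kin k τ : ℂ)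
      map_add' := fun Y Y' => ?_
      map_smul' := fun c Y => ?_ } (2 * π * (P + Q)) fun Y => ?_, fun _ => rfl⟩
  · rw [← contourInt_add (hc Y) (hc Y')]
    congr 1
    funext τ
    have h1 : (Y + Y').dyn k τ = Y.dyn k τ + Y'.dyn k τ := rfl
    have h2 : (Y + Y').kin k τ = Y.kin k τ + Y'.kin k τ := rfl
    rw [h1, h2]
    push_cast
    ring
  · rw [RingHom.id_apply, Complex.real_smul, ← contourInt_const_mul]
    congr 1
    funext τ
    have h1 : (c • Y).dyn k τ = c * Y.dyn k τ := rfl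
    have h2 : (c • Y).kin k τ = c * Y.kin k τ := rfl
    rw [h1, h2]
    push_cast
    ring
  · rw [mul_assoc]
    refine norm_contourInt_le fun τ => (norm_add_le _ _).trans ?_
    rw [norm_mul, norm_mul, Complex.norm_real, Complex.norm_real, add_mul]
    exact add_le_add
      (mul_le_mul (hP τ (mem_univ τ)) (Y.abs_dyn_le k τ) (abs_nonneg _)
        ((norm_nonneg _).trans (hP τ (mem_univ τ))))
      (mul_le_mul (hQ τ (mem_univ τ)) (Y.abs_kin_le k τ) (abs_nonneg _)
        ((norm_nonneg _).trans (hQ τ (mem_univ τ))))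

theorem exists_clm_contourInt_core_mul (hα0 : 0 < α) (hα1 : α < 1) (hℓ : 1 ≤ ℓ)
    (hs : Separated u.par ρ) (hF : ∀ k τ, confDeriv u ρ k τ ≠ 0) {h : Fin M → Circle → ℂ}
    (hh : ∀ k, Continuous (h k)) : ∃ T : YSpace M ℓ α →L[ℝ] ℂ, ∀ Y : YSpace M ℓ α,
      T Y = ∑ k, contourInt fun τ => core Y u ρ k τ * h k τ := by
  have key : ∀ k, ∃ T : YSpace M ℓ α →L[ℝ] ℂ, ∀ Y : YSpace M ℓ α,
      T Y = contourInt fun τ => core Y u ρ k τ * h k τ := fun k => by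
    have h1 := continuous_zNu' hα0 hα1 hℓ hs k
    have h2 := continuous_w0Rest hs k
    have h3 := continuous_confDeriv hα0 hα1 hℓ hs k
    have h4 := hh k
    have h5 : Continuous fun τ : Circle => conj (scaledW0 u.par ρ k τ + ρ * τ * zNu' u ρ k τ) /
        conj (confDeriv u ρ k τ) * h k τ := by
      unfold scaledW0
      exact (Continuous.div (by fun_prop) (by fun_prop)
        fun τ => (map_ne_zero _).2 (hF k τ)).mul h4
    obtain ⟨T, hT⟩ := exists_clm_contourInt (ℓ := ℓ) (α := α)
      (p := fun τ => (1 / 2 : ℂ) * confDeriv u ρ k τ * h k τ) (by fun_prop) h5.neg k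
    refine ⟨T, fun Y => (hT Y).trans (congrArg contourInt (funext fun τ => ?_))⟩
    simp only [Pi.neg_apply]
    rw [core, confDeriv]
    ring
  choose T hT using key
  exact ⟨∑ k, T k, fun Y => by simp [hT]⟩

/-- For fixed (u, ρ) the common factor `core` is real-linear in (A, B) with continuous coefficients.
The map is therefore bounded and is its own derivative. -/
theorem exists_clm_phiS (hα0 : 0 < α) (hα1 : α < 1) (hℓ : 1 ≤ ℓ)
    (hs : Separated u.par ρ) (hF : ∀ k τ, confDeriv u ρ k τ ≠ 0) :
    ∃ T : YSpace M ℓ α →L[ℝ] ℂ × ℝ, ∀ Y, phiS Y u ρ = T Y := by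
  obtain ⟨T₁, h1⟩ := exists_clm_contourInt_core_mul hα0 hα1 hℓ hs hF (h := fun _ _ => 1)
    fun _ => continuous_const
  obtain ⟨T₂, h2⟩ := exists_clm_contourInt_core_mul hα0 hα1 hℓ hs hF
    (h := fun k τ => conj (confMap u ρ k τ)) fun k => by
      have := continuous_confMap hα0 hα1 hs k
      fun_prop
  refine ⟨T₁.prod (Complex.reCLM.comp T₂), fun Y => Prod.ext ?_ ?_⟩
  · simp [phiS, transInt, h1]
  · exact congrArg Complex.re (h2 Y).symm

/-! Surjectivity. -/

theorem surjective_of_norm_sub_le {E F : Type*} [AddCommGroup E] [Module ℝ E]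
    [NormedAddCommGroup F] [NormedSpace ℝ F] [FiniteDimensional ℝ F] (T : E →ₗ[ℝ] F)
    (h : ∀ w, ∃ x, ‖T x - w‖ ≤ 1 / 2 * ‖w‖) : Surjective T := by
  rw [← LinearMap.range_eq_top]
  by_contra hT
  obtain ⟨w, hw, hd⟩ := riesz_lemma (F := LinearMap.range T)
    (Submodule.closed_of_finiteDimensional _)
    (by
      by_contra! hall
      exact hT (eq_top_iff.2 fun x _ => hall x)) (show (3 / 4 : ℝ) < 1 by norm_num)
  obtain ⟨x, hx⟩ := h w
  have h1 := hd (T x) ⟨x, rfl⟩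
  rw [norm_sub_rev] at h1
  have h2 : 0 < ‖w‖ := norm_pos_iff.2 fun h0 => hw (h0 ▸ Submodule.zero_mem _)
  linarith

theorem contourInt_re_mul_conj (b : ℂ) :
    contourInt (fun τ => ((b * conj (τ : ℂ)).re : ℂ)) = π * Complex.I * b := by
  -- The second summand is τ conj(b)/2, written so that conjugation of contour integrals applies;
  -- only the conj τ part has a nonzero integral.
  have e : (fun τ : Circle => ((b * conj (τ : ℂ)).re : ℂ))
      = fun τ : Circle => b / 2 * conj (τ : ℂ) + conj (τ : ℂ) ^ 2 *
        conj (conj (conj b) / 2 * conj (τ : ℂ) ^ 3) := by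
    funext τ
    have h := conj_mul_self_circle τ
    rw [Complex.re_eq_add_conj]
    simp only [map_mul, map_div₀, map_pow, Complex.conj_conj, map_ofNat]
    set t := conj (τ : ℂ)
    linear_combination (-(conj b) / 2 * τ * (t * τ + 1)) * h
  have h3 : contourInt (fun τ => conj (τ : ℂ) ^ 3) = 0 := by
    have e3 : (fun τ : Circle => conj (τ : ℂ) ^ 3)
        = fun τ : Circle => conj (τ : ℂ) ^ 2 * conj ((fun τ : Circle => (τ : ℂ)) τ) := by
      funext τ
      ring
    have h1 : contourInt (fun τ => (τ : ℂ)) = 0 := by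
      refine contourInt_deriv_eq_zero (g := fun θ => (Circle.exp θ : ℂ) ^ 2 / 2)
        (fun θ => by simp) (fun θ => ?_) (by fun_prop)
      convert! ((hasDerivAt_circleExp θ).pow 2).div_const 2 using 1
      ring
    rw [e3, contourInt_conj, h1, map_zero, neg_zero]
  rw [e, contourInt_add (by fun_prop) (by fun_prop), contourInt_conj, contourInt_const_mul,
    contourInt_const_mul, h3, contourInt_conj_coe]
  simp only [mul_zero, map_zero, neg_zero]
  ring

theorem norm_contourInt_test_sub_le {h : Circle → ℂ} {h0 : ℂ} {ε : ℝ} (hc : Continuous h)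
    (hh : ∀ τ, ‖h τ - h0‖ ≤ ε) (b : ℂ) :
    ‖contourInt (fun τ => (1 / 2 : ℂ) * ((b * conj (τ : ℂ)).re : ℂ) * h τ)
      - π * Complex.I / 2 * b * h0‖ ≤ π * ‖b‖ * ε := by
  have e : contourInt (fun τ => (1 / 2 : ℂ) * ((b * conj (τ : ℂ)).re : ℂ) * h τ)
      - π * Complex.I / 2 * b * h0
      = contourInt fun τ => (1 / 2 : ℂ) * ((b * conj (τ : ℂ)).re : ℂ) * (h τ - h0) := by
    have h1 : (fun τ : Circle => (1 / 2 : ℂ) * ((b * conj (τ : ℂ)).re : ℂ) * (h τ - h0))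
        = fun τ : Circle => (1 / 2 : ℂ) * ((b * conj (τ : ℂ)).re : ℂ) * h τ
          - h0 / 2 * ((b * conj (τ : ℂ)).re : ℂ) := by
      funext τ
      ring
    rw [h1, contourInt_sub (by fun_prop) (by fun_prop), contourInt_const_mul,
      contourInt_re_mul_conj]
    ring
  rw [e]
  refine (norm_contourInt_le (B := 1 / 2 * ‖b‖ * ε) fun τ => ?_).trans (le_of_eq (by ring))
  have h1 : |(b * conj (τ : ℂ)).re| ≤ ‖b‖ := by
    refine (Complex.abs_re_le_norm _).trans ?_
    rw [norm_mul, RCLike.norm_conj, Circle.norm_coe, mul_one]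
  rw [norm_mul, norm_mul, Complex.norm_real, Real.norm_eq_abs]
  have h2 := hh τ
  have h3 : ‖(1 / 2 : ℂ)‖ = 1 / 2 := by norm_num
  rw [h3]
  gcongr

/-- The residuals with vanishing kinematic part and first harmonics in the Bernoulli part. -/
theorem exists_test (hα0 : 0 < α) (hα1 : α < 1) (b : Fin M → ℂ) : ∃ Y : YSpace M ℓ α,
    (∀ k τ, Y.kin k τ = 0) ∧ ∀ k τ, Y.dyn k τ = (b k * conj (τ : ℂ)).re := by
  have ha0 : (0 : ℝ) < α := by exact_mod_cast hα0
  have ha1 : (α : ℝ) ≤ 1 := by exact_mod_cast hα1.le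
  exact ⟨(0, fun k => ⟨fun τ => (b k * conj (τ : ℂ)).re,
    (cHolder_iff hα0 (lift_periodic _)).1 ((cHolder_exp ha0 ha1).conj.const_mul ha0 ha1 (b k)).re⟩),
    fun _ _ => rfl, fun _ _ => rfl⟩

/-- With F = 1 and f = ζ_k, suitable first harmonics would give exactly the sum and the first moment
of the weights; ε measures the deviation of F and of F conj f from these values. -/
theorem exists_norm_phiS_sub_le (hα0 : 0 < α) (hα1 : α < 1) (hℓ : 1 ≤ ℓ)
    (hs : Separated u.par ρ) {ε : ℝ} (h1 : ∀ k τ, ‖confDeriv u ρ k τ - 1‖ ≤ ε)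
    (h2 : ∀ k τ, ‖confDeriv u ρ k τ * conj (confMap u ρ k τ) - conj (u.par.ctr k)‖ ≤ ε)
    (a : Fin M → ℂ) : ∃ Y : YSpace M ℓ α,
      ‖phiS Y u ρ - (∑ k, a k, (∑ k, a k * conj (u.par.ctr k)).re)‖ ≤ 2 * ε * ∑ k, ‖a k‖ := by
  -- The factor 2/(πi) normalizes: half of the harmonic with coefficient b integrates to πi b/2.
  obtain ⟨Y, hA, hB⟩ := exists_test (M := M) (ℓ := ℓ) hα0 hα1 fun k => 2 / (π * Complex.I) * a k
  have hπ : (π : ℂ) ≠ 0 := by exact_mod_cast pi_ne_zero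
  have hI := Complex.I_ne_zero
  have hpt : ∀ (k : Fin M) (h : Circle → ℂ) (h0 : ℂ), Continuous h → (∀ τ, ‖h τ - h0‖ ≤ ε) →
      ‖contourInt (fun τ => (1 / 2 : ℂ) * (Y.dyn k τ : ℂ) * h τ) - a k * h0‖ ≤ 2 * ε * ‖a k‖ := by
    intro k h h0 hc hh
    have := norm_contourInt_test_sub_le hc hh (2 / (π * Complex.I) * a k)
    simp only [hB]
    have e1 : π * Complex.I / 2 * (2 / (π * Complex.I) * a k) = a k := by field_simp
    have e2 : ‖2 / (π * Complex.I) * a k‖ = 2 / π * ‖a k‖ := by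
      rw [norm_mul, norm_div, norm_mul, Complex.norm_I, Complex.norm_real, Real.norm_eq_abs,
        abs_of_pos pi_pos, mul_one]
      norm_num
    rw [e1, e2] at this
    refine this.trans (le_of_eq ?_)
    have := pi_ne_zero
    field_simp
  have hcore : ∀ k τ, core Y u ρ k τ = (1 / 2 : ℂ) * (Y.dyn k τ : ℂ) * confDeriv u ρ k τ := by
    intro k τ
    rw [core, hA, confDeriv]
    simp
  refine ⟨Y, norm_prod_le_iff.2 ⟨?_, ?_⟩⟩
  · simp only [phiS, transInt, Prod.fst_sub, hcore]
    rw [← Finset.sum_sub_distrib, Finset.mul_sum]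
    refine (norm_sum_le _ _).trans (Finset.sum_le_sum fun k _ => ?_)
    have := hpt k _ 1 (continuous_confDeriv hα0 hα1 hℓ hs k) (h1 k)
    rwa [mul_one] at this
  · simp only [phiS, rotInt, Prod.snd_sub]
    rw [← Complex.sub_re, ← Finset.sum_sub_distrib, Finset.mul_sum]
    refine (Complex.abs_re_le_norm _).trans ((norm_sum_le _ _).trans
      (Finset.sum_le_sum fun k _ => ?_))
    have hcf := continuous_confMap hα0 hα1 hs k
    have hcF := continuous_confDeriv hα0 hα1 hℓ hs k
    have := hpt k (fun τ => confDeriv u ρ k τ * conj (confMap u ρ k τ)) _ (by fun_prop) (h2 k)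
    simp only [← mul_assoc, ← hcore] at this
    exact this

/-- Weights with prescribed sum and first moment, at two distinct points. -/
theorem exists_weights {ζ : Fin M → ℂ} {i j : Fin M} {d R : ℝ} (hd : 0 < d)
    (hζ : d ≤ ‖ζ i - ζ j‖) (hR : ‖ζ j‖ ≤ R) (w : ℂ × ℝ) : ∃ a : Fin M → ℂ,
      ∑ k, a k = w.1 ∧ (∑ k, a k * conj (ζ k)).re = w.2 ∧
        ∑ k, ‖a k‖ ≤ (1 + 2 * ((1 + R) / d)) * ‖w‖ := by
  have hR0 : 0 ≤ R := (norm_nonneg _).trans hR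
  have hn : 0 < ‖ζ i - ζ j‖ := hd.trans_le hζ
  have h0 : ζ i - ζ j ≠ 0 := norm_pos_iff.1 hn
  -- Placing b at i and w.1 − b at j fixes the sum and gives the moment b conj(ζ_i − ζ_j) + w.1 conj
  -- ζ_j; the real number s is what the first term must supply.
  set s : ℝ := w.2 - (conj (ζ j) * w.1).re with hsdef
  set b : ℂ := s / conj (ζ i - ζ j) with hb
  have hbn : ‖b‖ ≤ (1 + R) / d * ‖w‖ := by
    have h1 : |s| ≤ (1 + R) * ‖w‖ := by
      have e1 : |w.2| ≤ ‖w‖ := norm_snd_le w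
      have e2 : |(conj (ζ j) * w.1).re| ≤ R * ‖w‖ := by
        refine (Complex.abs_re_le_norm _).trans ?_
        rw [norm_mul, RCLike.norm_conj]
        exact mul_le_mul hR (norm_fst_le w) (norm_nonneg _) hR0
      calc |s| ≤ |w.2| + |(conj (ζ j) * w.1).re| := abs_sub _ _
        _ ≤ ‖w‖ + R * ‖w‖ := add_le_add e1 e2
        _ = _ := by ring
    rw [hb, norm_div, RCLike.norm_conj, Complex.norm_real, Real.norm_eq_abs, div_mul_eq_mul_div]
    exact div_le_div₀ (by positivity) h1 hd hζ
  refine ⟨fun k => Pi.single (M := fun _ => ℂ) i b k + Pi.single (M := fun _ => ℂ) j (w.1 - b) k,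
    ?_, ?_, ?_⟩
  · simp [Finset.sum_add_distrib]
  · have e : ∑ k, (Pi.single (M := fun _ => ℂ) i b k + Pi.single (M := fun _ => ℂ) j (w.1 - b) k)
        * conj (ζ k) = s + w.1 * conj (ζ j) := by
      simp only [add_mul, Finset.sum_add_distrib, Pi.single_apply, ite_mul, zero_mul,
        Finset.sum_ite_eq', Finset.mem_univ, if_true]
      have : b * conj (ζ i - ζ j) = s := div_mul_cancel₀ _ ((map_ne_zero _).2 h0)
      rw [map_sub] at this
      linear_combination this
    rw [e, Complex.add_re, Complex.ofReal_re, hsdef, mul_comm w.1]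
    ring
  · have e1 : ∀ (l : Fin M) (c : ℂ), ∑ k, ‖Pi.single (M := fun _ => ℂ) l c k‖ = ‖c‖ := fun l c => by
      simp [Pi.single_apply, apply_ite norm]
    calc _ ≤ ∑ k, (‖Pi.single (M := fun _ => ℂ) i b k‖
          + ‖Pi.single (M := fun _ => ℂ) j (w.1 - b) k‖) :=
          Finset.sum_le_sum fun k _ => norm_add_le _ _
      _ = ‖b‖ + ‖w.1 - b‖ := by rw [Finset.sum_add_distrib, e1, e1]
      _ ≤ ‖b‖ + (‖w‖ + ‖b‖) := by
          have := norm_sub_le w.1 b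
          have := norm_fst_le w
          linarith
      _ ≤ _ := by linarith

/-- The weights cost at most the factor 1 + 2(1 + R)/d, so the smallness of ε turns the deviation
into a relative error of at most 1/2. -/
theorem surjective_phiS (hα0 : 0 < α) (hα1 : α < 1) (hℓ : 1 ≤ ℓ)
    (hs : Separated u.par ρ) {i j : Fin M} {d R ε : ℝ} (hd : 0 < d)
    (hζ : d ≤ ‖u.par.ctr i - u.par.ctr j‖) (hR : ‖u.par.ctr j‖ ≤ R)
    (hε : 2 * ε * (1 + 2 * ((1 + R) / d)) ≤ 1 / 2)
    (h1 : ∀ k τ, ‖confDeriv u ρ k τ - 1‖ ≤ ε)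
    (h2 : ∀ k τ, ‖confDeriv u ρ k τ * conj (confMap u ρ k τ) - conj (u.par.ctr k)‖ ≤ ε)
    (T : YSpace M ℓ α →L[ℝ] ℂ × ℝ) (hT : ∀ Y, phiS Y u ρ = T Y) : Surjective T := by
  refine surjective_of_norm_sub_le (T : YSpace M ℓ α →ₗ[ℝ] ℂ × ℝ) fun w => ?_
  obtain ⟨a, ha1, ha2, ha3⟩ := exists_weights hd hζ hR w
  obtain ⟨Y, hY⟩ := exists_norm_phiS_sub_le hα0 hα1 hℓ hs h1 h2 a
  rw [ha1, ha2, hT] at hY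
  have hε0 : 0 ≤ ε := (norm_nonneg _).trans (h1 i 1)
  refine ⟨Y, hY.trans ?_⟩
  calc 2 * ε * ∑ k, ‖a k‖ ≤ 2 * ε * ((1 + 2 * ((1 + R) / d)) * ‖w‖) := by gcongr
    _ = 2 * ε * (1 + 2 * ((1 + R) / d)) * ‖w‖ := by ring
    _ ≤ _ := mul_le_mul_of_nonneg_right hε (norm_nonneg w)

end Identities

end HollowVortex

end

open scoped NNReal ComplexConjugate

noncomputable section

namespace HollowVortex

/-! ### A neighbourhood of the point vortex -/

section Neighbourhood

open Real Set MeasureTheory Function Filter Topology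

variable {M ℓ : ℕ} {α : ℝ≥0} {ρ : ℝ} {u : XSpace M ℓ α}

/-- The conditions that hold near a point vortex configuration and imply the identities. -/
structure NearVortex (d R ε : ℝ) (u : XSpace M ℓ α) (ρ : ℝ) : Prop where
  sep : ∀ j k, j ≠ k → d ≤ ‖u.par.ctr j - u.par.ctr k‖ - 2 * |ρ|
  ctr : ∀ k, ‖u.par.ctr k‖ ≤ R
  confDeriv_sub_one : ∀ k τ, ‖confDeriv u ρ k τ - 1‖ ≤ ε
  moment : ∀ k τ, ‖confDeriv u ρ k τ * conj (confMap u ρ k τ)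
    - conj (u.par.ctr k)‖ ≤ ε

/-- Both F − 1 and f − ζ_k carry an explicit factor ρ, and what multiplies it is bounded through C
and R. -/
theorem norm_confDeriv_mul_sub_le {C R : ℝ} {k : Fin M} {τ : Circle} (hρ : |ρ| ≤ 1)
    (h1 : ‖zMu u ρ k τ‖ ≤ C) (h2 : ‖zMu' u ρ k τ‖ ≤ C) (hR : ‖u.par.ctr k‖ ≤ R) :
    ‖confDeriv u ρ k τ * conj (confMap u ρ k τ) - conj (u.par.ctr k)‖
      ≤ |ρ| * (C * (R + 1 + C) + (1 + C)) := by
  have hC : 0 ≤ C := (norm_nonneg _).trans h1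
  have hR0 : 0 ≤ R := (norm_nonneg _).trans hR
  have hr : ‖(ρ : ℂ)‖ = |ρ| := by rw [Complex.norm_real, Real.norm_eq_abs]
  have hg : ‖(τ : ℂ) + ρ * zMu u ρ k τ‖ ≤ 1 + C := by
    refine (norm_add_le _ _).trans ?_
    rw [Circle.norm_coe, norm_mul, hr]
    have := mul_le_mul hρ h1 (norm_nonneg _) zero_le_one
    linarith
  have hf : confMap u ρ k τ = u.par.ctr k + ρ * (τ + ρ * zMu u ρ k τ) := by
    rw [confMap]
    ring
  have hfn : ‖confMap u ρ k τ‖ ≤ R + 1 + C := by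
    rw [hf]
    refine (norm_add_le _ _).trans ?_
    rw [norm_mul, hr]
    have := mul_le_mul hρ hg (norm_nonneg _) zero_le_one
    linarith
  have e : confDeriv u ρ k τ * conj (confMap u ρ k τ) - conj (u.par.ctr k)
      = ρ * (zMu' u ρ k τ * conj (confMap u ρ k τ) + conj ((τ : ℂ) + ρ * zMu u ρ k τ)) := by
    have : conj (confMap u ρ k τ) = conj (u.par.ctr k) + ρ * conj ((τ : ℂ) + ρ * zMu u ρ k τ) := by
      rw [hf, map_add, map_mul, Complex.conj_ofReal]
    rw [confDeriv]
    linear_combination this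
  rw [e, norm_mul, hr]
  refine mul_le_mul_of_nonneg_left ((norm_add_le _ _).trans (add_le_add ?_ ?_)) (abs_nonneg ρ)
  · rw [norm_mul, RCLike.norm_conj]
    exact mul_le_mul h2 hfn (norm_nonneg _) hC
  · rwa [RCLike.norm_conj]

theorem eventually_nearVortex (hα0 : 0 < α) (hα1 : α < 1) (hℓ : 1 ≤ ℓ) {Λ₀ : Params M} {d R ε : ℝ}
    (hd : 0 < d) (hε : 0 < ε) (hsep : ∀ j k, j ≠ k → d < ‖Λ₀.ctr j - Λ₀.ctr k‖)
    (hR : ∀ k, ‖Λ₀.ctr k‖ < R) :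
    ∀ᶠ p in 𝓝 ((pointVortex ℓ α Λ₀, 0) : XSpace M ℓ α × ℝ), NearVortex d R ε p.1 p.2 := by
  have hctr : ∀ k : Fin M, Continuous fun p : XSpace M ℓ α × ℝ => p.1.par.ctr k := fun k =>
    (continuous_apply k).comp (continuous_fst.comp (continuous_snd.comp (continuous_snd.comp
      (continuous_snd.comp (continuous_snd.comp continuous_fst)))))
  have hmu : Continuous fun p : XSpace M ℓ α × ℝ => ‖p.1.1‖ :=
    continuous_norm.comp (continuous_fst.comp continuous_fst)
  -- The bound of `norm_zMu_le` and `norm_zMu'_le` with ‖μ‖ and |ρ| both replaced by 1.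
  set C : ℝ := π * 1 * (π ^ (α : ℝ) / α) + M * (1 / d * 1) with hCdef
  have hC : 0 ≤ C := by positivity
  have e1 : ∀ᶠ p in 𝓝 ((pointVortex ℓ α Λ₀, 0) : XSpace M ℓ α × ℝ), ∀ j k, j ≠ k →
      d < ‖p.1.par.ctr j - p.1.par.ctr k‖ - 2 * |p.2| := by
    refine eventually_all.2 fun j => eventually_all.2 fun k => ?_
    by_cases hjk : j = k
    · exact Eventually.of_forall fun p h => absurd hjk h
    have hc : Continuous fun p : XSpace M ℓ α × ℝ =>
        ‖p.1.par.ctr j - p.1.par.ctr k‖ - 2 * |p.2| :=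
      (((hctr j).sub (hctr k)).norm).sub (continuous_const.mul continuous_snd.abs)
    refine (hc.continuousAt.eventually (lt_mem_nhds ?_)).mono fun p hp _ => hp
    simpa [pointVortex, XSpace.par] using hsep j k hjk
  have e2 : ∀ᶠ p in 𝓝 ((pointVortex ℓ α Λ₀, 0) : XSpace M ℓ α × ℝ), ∀ k,
      ‖p.1.par.ctr k‖ < R :=
    eventually_all.2 fun k => (hctr k).norm.continuousAt.eventually (gt_mem_nhds (hR k))
  have e3 : ∀ᶠ p in 𝓝 ((pointVortex ℓ α Λ₀, 0) : XSpace M ℓ α × ℝ), ‖p.1.1‖ < 1 :=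
    hmu.continuousAt.eventually (gt_mem_nhds (by simp [pointVortex]))
  have e4 : ∀ᶠ p in 𝓝 ((pointVortex ℓ α Λ₀, 0) : XSpace M ℓ α × ℝ), |p.2| < 1 :=
    continuous_snd.abs.continuousAt.eventually (gt_mem_nhds (by simp))
  have e5 : ∀ᶠ p in 𝓝 ((pointVortex ℓ α Λ₀, 0) : XSpace M ℓ α × ℝ), |p.2| * C < ε :=
    (continuous_snd.abs.mul continuous_const).continuousAt.eventually
      (gt_mem_nhds (by simpa using hε))
  have e6 : ∀ᶠ p in 𝓝 ((pointVortex ℓ α Λ₀, 0) : XSpace M ℓ α × ℝ),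
      |p.2| * (C * (R + 1 + C) + (1 + C)) < ε :=
    (continuous_snd.abs.mul continuous_const).continuousAt.eventually
      (gt_mem_nhds (by simpa using hε))
  filter_upwards [e1, e2, e3, e4, e5, e6] with p h1 h2 h3 h4 h5 h6
  have hsp : ∀ j k, j ≠ k → d ≤ ‖p.1.par.ctr j - p.1.par.ctr k‖ - 2 * |p.2| :=
    fun j k hjk => (h1 j k hjk).le
  have hCle : π * ‖p.1.1‖ * (π ^ (α : ℝ) / α) + M * (‖p.1.1‖ / d * |p.2|) ≤ C := by
    rw [hCdef]
    gcongr
  have hZ := fun k τ => (norm_zMu_le hα0 hα1 hd hsp k τ).trans hCle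
  have hD := fun k τ => (norm_zMu'_le hα0 hα1 hℓ hd hsp k τ).trans hCle
  refine ⟨hsp, fun k => (h2 k).le, fun k τ => ?_, fun k τ => ?_⟩
  · rw [confDeriv, add_sub_cancel_left, norm_mul, Complex.norm_real, Real.norm_eq_abs]
    exact (mul_le_mul_of_nonneg_left (hD k τ) (abs_nonneg _)).trans h5.le
  · exact (norm_confDeriv_mul_sub_le h4.le (hZ k τ) (hD k τ) (h2 k).le).trans h6.le

theorem identitiesAt_of_clm {E : Type*} [NormedAddCommGroup E] [NormedSpace ℝ E]
    {φ : YSpace M ℓ α → XSpace M ℓ α → ℝ → E} {T : YSpace M ℓ α →L[ℝ] E}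
    (hT : ∀ Y, φ Y u ρ = T Y) (hsurj : Surjective T)
    (hres : ∃ Y : YSpace M ℓ α, (∀ k τ, Y.kin k τ = opA u ρ k τ) ∧
      (∀ k τ, Y.dyn k τ = opB u ρ k τ) ∧ φ Y u ρ = 0) : IdentitiesAt φ u ρ := by
  have e : (fun Y => φ Y u ρ) = T := funext hT
  refine ⟨hres, by rw [hT, map_zero], ?_, ?_⟩
  · rw [e]
    exact T.differentiableAt
  · rw [e, T.fderiv]
    exact hsurj

/-- The maps for translation and rotation are the compositions of the stationary map with the
surjections Im ∘ fst and snd, so one continuous linear map and one surjectivity proof serve all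
three. -/
theorem NearVortex.identitiesAt (hα0 : 0 < α) (hα1 : α < 1) (hℓ : 1 ≤ ℓ) {d R ε : ℝ} (hd : 0 < d)
    (hε1 : ε < 1) (hε : 2 * ε * (1 + 2 * ((1 + R) / d)) ≤ 1 / 2) {i j : Fin M} (hij : i ≠ j)
    (h : NearVortex d R ε u ρ) :
    (u.par.angVel = 0 → IdentitiesAt phiT u ρ) ∧ (u.par.speed = 0 → IdentitiesAt phiR u ρ) ∧
      (u.par.speed = 0 → u.par.angVel = 0 → IdentitiesAt phiS u ρ) := by
  have hs : Separated u.par ρ := fun j k hjk => by linarith [h.sep j k hjk]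
  have hD : ∀ k τ, ‖ρ * zMu' u ρ k τ‖ ≤ ε := fun k τ => by
    have := h.confDeriv_sub_one k τ
    rwa [confDeriv, add_sub_cancel_left] at this
  have hF : ∀ k τ, confDeriv u ρ k τ ≠ 0 := fun k τ h0 => by
    have := h.confDeriv_sub_one k τ
    rw [h0, zero_sub, norm_neg, norm_one] at this
    linarith
  obtain ⟨Y, hA, hB⟩ := exists_residual hα0 hα1 hℓ hs hF
  obtain ⟨h1, h2⟩ := phiS_residual hα0 hα1 hℓ hs ⟨ε, hε1, hD⟩ hF hA hB
  obtain ⟨T, hT⟩ := exists_clm_phiS hα0 hα1 hℓ hs hF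
  have hsurj := surjective_phiS hα0 hα1 hℓ hs (i := i) (j := j) hd
    (by linarith [h.sep i j hij, abs_nonneg ρ]) (h.ctr j) hε h.confDeriv_sub_one h.moment T hT
  refine ⟨fun hΩ => ?_, fun hc => ?_, fun hc hΩ => ?_⟩
  · refine identitiesAt_of_clm
      (T := Complex.imCLM.comp ((ContinuousLinearMap.fst ℝ ℂ ℝ).comp T))
      (fun Y => congrArg (fun x : ℂ × ℝ => x.1.im) (hT Y)) ?_ ⟨Y, hA, hB, ?_⟩
    · have him : Surjective Complex.im := fun x => ⟨Complex.I * x, by simp⟩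
      exact him.comp (Prod.fst_surjective.comp hsurj)
    · rw [phiT, h1 hΩ, ← Complex.ofReal_neg, Complex.ofReal_im]
  · refine identitiesAt_of_clm (T := (ContinuousLinearMap.snd ℝ ℂ ℝ).comp T)
      (fun Y => congrArg Prod.snd (hT Y)) (Prod.snd_surjective.comp hsurj) ⟨Y, hA, hB, h2 hc⟩
  · refine identitiesAt_of_clm hT hsurj ⟨Y, hA, hB, Prod.ext ?_ (h2 hc)⟩
    change transInt Y u ρ = 0
    rw [h1 hΩ, hc]
    simp

theorem eventually_identitiesAt (hM : 2 ≤ M) (hℓ : 1 ≤ ℓ) (hα0 : 0 < α) (hα1 : α < 1)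
    {Λ₀ : Params M} (hζ : ∀ j k, j ≠ k → Λ₀.ctr j ≠ Λ₀.ctr k) :
    ∀ᶠ p in 𝓝 ((pointVortex ℓ α Λ₀, 0) : XSpace M ℓ α × ℝ),
      (p.1.par.angVel = 0 → IdentitiesAt phiT p.1 p.2) ∧
      (p.1.par.speed = 0 → IdentitiesAt phiR p.1 p.2) ∧
      (p.1.par.speed = 0 → p.1.par.angVel = 0 → IdentitiesAt phiS p.1 p.2) := by
  obtain ⟨d, hsep, hd⟩ : ∃ d : ℝ, (∀ j k, j ≠ k → d < ‖Λ₀.ctr j - Λ₀.ctr k‖) ∧ 0 < d := by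
    have h : ∀ᶠ d in 𝓝[>] (0 : ℝ), ∀ j k, j ≠ k → d < ‖Λ₀.ctr j - Λ₀.ctr k‖ := by
      refine eventually_all.2 fun j => eventually_all.2 fun k => ?_
      by_cases hjk : j = k
      · exact Eventually.of_forall fun p h => absurd hjk h
      · exact (eventually_nhdsWithin_of_eventually_nhds
          (gt_mem_nhds (norm_pos_iff.2 (sub_ne_zero.2 (hζ j k hjk))))).mono fun _ h _ => h
    exact (h.and self_mem_nhdsWithin).exists
  obtain ⟨R, hR⟩ : ∃ R : ℝ, ∀ k, ‖Λ₀.ctr k‖ < R :=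
    (eventually_all.2 fun k => eventually_gt_atTop ‖Λ₀.ctr k‖).exists
  -- Two vortices exist since M ≥ 2; their distinct centres allow the sum and the first moment of
  -- the weights to be prescribed independently.
  let i : Fin M := ⟨0, by omega⟩
  let j : Fin M := ⟨1, by omega⟩
  have hij : i ≠ j := by simp [i, j]
  have hR0 : 0 < R := (norm_nonneg _).trans_lt (hR i)
  set L := 1 + 2 * ((1 + R) / d) with hL
  have hL1 : 1 ≤ L := by
    rw [hL, le_add_iff_nonneg_right]
    positivity
  have hL0 : 0 < L := by linarith
  have hε1 : 1 / (4 * L) < 1 := by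
    rw [div_lt_one (by linarith)]
    linarith
  -- The choice ε = 1/(4L) makes 2εL equal to 1/2.
  refine (eventually_nearVortex hα0 hα1 hℓ hd (ε := 1 / (4 * L)) (by positivity) hsep hR).mono
    fun p hp => hp.identitiesAt hα0 hα1 hℓ hd hε1 (le_of_eq ?_) hij
  rw [← hL]
  field_simp
  norm_num

end Neighbourhood

end HollowVortex

end

open HollowVortex Topology in
theorem theorem5p1 (M : ℕ) (hM : 2 ≤ M) (ℓ : ℕ) (hℓ : 1 ≤ ℓ)
    (α : NNReal) (hα0 : 0 < α) (hα1 : α < 1)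
    (Λ₀ : Params M) (hγ : ∀ k, Λ₀.circ k ≠ 0) (hζ : ∀ j k, j ≠ k → Λ₀.ctr j ≠ Λ₀.ctr k) :
    (Λ₀.speed ≠ 0 → Λ₀.angVel = 0 →
      ∀ᶠ p in 𝓝 ((pointVortex ℓ α Λ₀, 0) : XSpace M ℓ α × ℝ), p ∈ domainO M ℓ α →
        p.1.par.speed = Λ₀.speed → p.1.par.angVel = Λ₀.angVel →
        IdentitiesAt phiT p.1 p.2) ∧
    (Λ₀.speed = 0 → Λ₀.angVel ≠ 0 →
      ∀ᶠ p in 𝓝 ((pointVortex ℓ α Λ₀, 0) : XSpace M ℓ α × ℝ), p ∈ domainO M ℓ α →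
        p.1.par.speed = Λ₀.speed → p.1.par.angVel = Λ₀.angVel →
        IdentitiesAt phiR p.1 p.2) ∧
    (Λ₀.speed = 0 → Λ₀.angVel = 0 →
      ∀ᶠ p in 𝓝 ((pointVortex ℓ α Λ₀, 0) : XSpace M ℓ α × ℝ), p ∈ domainO M ℓ α →
        p.1.par.speed = Λ₀.speed → p.1.par.angVel = Λ₀.angVel →
        IdentitiesAt phiS p.1 p.2) := by
  have h := eventually_identitiesAt hM hℓ hα0 hα1 hζ
  refine ⟨fun _ hΩ => ?_, fun hc _ => ?_, fun hc hΩ => ?_⟩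
  · filter_upwards [h] with p hp _ _ hΩ'
    exact hp.1 (hΩ'.trans hΩ)
  · filter_upwards [h] with p hp _ hc' _
    exact hp.2.1 (hc'.trans hc)
  · filter_upwards [h] with p hp _ hc' hΩ'
    exact hp.2.2 (hc'.trans hc) (hΩ'.trans hΩ)
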